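/- Let $N\ge 1$ be an integer, $s\in(0,1)$, $\alpha\ge 0$, $C_0>0$ and $\beta\in\mathbb R$, and suppose that one of the following conditions holds: (i) $0<\beta\le N-2s$ and $\alpha\le 2$; (ii) $N-2s<\beta<N$ and $\alpha\le 2s$; (iii) $\beta=N$ and $\alpha<2s$; (iv) $\beta>N$ and $\alpha+\beta\le N+2s$. Write $\mathcal L^s(\mathbb R^N)$ for the set of functions $f:\mathbb R^N\to\mathbb R$ with $\int_{\mathbb R^N}\frac{|f(x)|}{1+|x|^{N+2s}}\,dx<\infty$, put $\psi_\beta(x)=(1+|x|^2)^{-\beta/2}$, and let $$(-\Delta)^su(x)=C_{N,s}\lim_{\varepsilon\to0^+}\int_{\{|x-y|\ge\varepsilon\}}\frac{u(x)-u(y)}{|x-y|^{N+2s}}\,dy,\qquad C_{N,s}=\frac{2^{2s-1}\,2s\,\Gamma((N+2s)/2)}{\pi^{N/2}\,\Gamma(1-s)}.$$ Then there is a constant $K$, depending only on $N,s,\alpha,\beta,C_0$, with the following property. Let $\rho,c:\mathbb R^N\to\mathbb R$ be continuous functions with $$\rho(x)\ge C_0(1+|x|^2)^{-\alpha/2}\quad\text{and}\quad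 c(x)\ge c_0\qquad\text{for all }x\in\mathbb R^N,$$ for some $c_0>0$, and let $p\in[1,\infty)$ satisfy $p\,c_0\ge K$. Let $u\in C^2(\mathbb R^N)\cap\mathcal L^s(\mathbb R^N)$ be a classical solution of $$\Delta u-(-\Delta)^su-\rho\,c\,u=0\quad\text{in }\mathbb R^N$$ (that is, the equation holds at every point) such that $|u|^p\in\mathcal L^s(\mathbb R^N)$ and $u\in L^p_{\psi_\beta}(\mathbb R^N)$, i.e. $\int_{\mathbb R^N}|u|^p\,\psi_\beta\,dx<\infty$. Then $u\equiv0$ in $\mathbb R^N$. -/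

import Mathlib

open Filter Topology MeasureTheory

/-- Membership in `𝓛^s(ℝ^N)`: `∫ |f(x)| / (1 + |x|^(N+2s)) dx < ∞`. -/
def MemLs {N : ℕ} (s : ℝ) (f : EuclideanSpace ℝ (Fin N) → ℝ) : Prop :=
  Integrable (fun x : EuclideanSpace ℝ (Fin N) => |f x| / (1 + ‖x‖ ^ ((N : ℝ) + 2 * s)))

/-- The normalization constant of the fractional Laplacian,
`C_{N,s} = 2^(2s-1) 2s Γ((N+2s)/2) / (π^(N/2) Γ(1-s))`. -/
noncomputable def fracLaplacianConst (N : ℕ) (s : ℝ) : ℝ :=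
  (2 : ℝ) ^ (2 * s - 1) * (2 * s) * Real.Gamma (((N : ℝ) + 2 * s) / 2) /
    (Real.pi ^ ((N : ℝ) / 2) * Real.Gamma (1 - s))

/-- The truncation at distance `ε` of the singular integral that defines `(-Δ)^s u (x)`.
For `u ∈ 𝓛^s(ℝ^N)` the integrand is integrable on `{|x - y| ≥ ε}` for every `ε > 0`. -/
noncomputable def fracLaplacianTrunc {N : ℕ} (s : ℝ) (u : EuclideanSpace ℝ (Fin N) → ℝ)
    (x : EuclideanSpace ℝ (Fin N)) (ε : ℝ) : ℝ :=
  fracLaplacianConst N s *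
    ∫ y in {y : EuclideanSpace ℝ (Fin N) | ε ≤ ‖x - y‖},
      (u x - u y) / ‖x - y‖ ^ ((N : ℝ) + 2 * s)

/-- `(-Δ)^s u (x)` exists as a principal value and equals `ℓ`. The sign is the one for which
`(-Δ)^s` is the positive operator with Fourier symbol `|ξ|^(2s)`. -/
def HasFracLaplacianAt {N : ℕ} (s : ℝ) (u : EuclideanSpace ℝ (Fin N) → ℝ)
    (ℓ : ℝ) (x : EuclideanSpace ℝ (Fin N)) : Prop :=
  Tendsto (fracLaplacianTrunc s u x) (𝓝[>] 0) (𝓝 ℓ)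

/-- `u` is a classical solution of `Δ u - (-Δ)^s u - ρ c u = 0` in `ℝ^N`:
`u ∈ C²(ℝ^N) ∩ 𝓛^s(ℝ^N)` and the equation holds at every point. -/
structure IsClassicalSolution {N : ℕ} (s : ℝ) (ρ c u : EuclideanSpace ℝ (Fin N) → ℝ) : Prop where
  contDiff : ContDiff ℝ 2 u
  memLs : MemLs s u
  equation : ∀ x, ∃ ℓ : ℝ, HasFracLaplacianAt s u ℓ x ∧
    (Laplacian.laplacian u : EuclideanSpace ℝ (Fin N) → ℝ) x - ℓ - ρ x * c x * u x = 0

/-- The weight `ψ_β(x) = (1 + |x|²)^(-β/2)`. -/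
noncomputable def weightPsi {N : ℕ} (β : ℝ) (x : EuclideanSpace ℝ (Fin N)) : ℝ :=
  (1 + ‖x‖ ^ 2) ^ (-β / 2)

/-- Membership in the weighted space `L^p_f(ℝ^N)`, `1 ≤ p < ∞`: `∫ |u|^p f dx < ∞`. -/
def MemWeightedLp {N : ℕ} (p : ℝ) (f u : EuclideanSpace ℝ (Fin N) → ℝ) : Prop :=
  Integrable (fun x : EuclideanSpace ℝ (Fin N) => |u x| ^ p * f x)

/-! Write `w = |u|^p`, `⟨x⟩ = √(1+|x|²)`, `q = N+2s`. Convexity of `a ↦ |a|^p` makes `w` a weak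
subsolution: formally `Δw - (-Δ)^s w ≥ p ρ c w`. Testing with `ψ_β` and moving the operators onto
the weight gives `p c₀ C₀ ∫ w ψ_{β+α} ≤ ∫ w (Δψ_β - (-Δ)^s ψ_β)`. If the bracket on the right is at
most `A' ψ_{β+α}` with `A'` depending only on `N, s, α, β`, then `p c₀ C₀ ≥ A' + 1` forces `∫ w
ψ_{β+α} = 0`, hence `u = 0`.

The local term satisfies `Δψ_β = O(⟨x⟩^(-β-2))`, which is enough because `α ≤ 2` in all four cases.
For the nonlocal term there are two mechanisms. Outside case (i) one proves `(-Δ)^s ψ_β =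
O(⟨x⟩^(-β-γ))` with some `γ ≥ α`, by splitting the second-difference integral at `|z| = ⟨x⟩/2`
(`exists_integral_diffMajorant_le`); the exponent is governed by the growth of the mass of `ψ_β` on
balls. In case (i) `α` may exceed `2s`, and a sign is used instead: `(-Δ)^s ψ_β ≥ 0`
(`integral_secondDiff_weightPsi_nonpos`). Both `ψ_β` and the kernel `|z|^(-q)` are mixtures of
Gaussians, and the Gaussian semigroup law reduces this sign to a one-dimensional inequality between
the mixing densities.

Two regularizations make the testing rigorous. Since `w` need not be `C²`, convexity is applied to a
discrete Laplacian and to the singular integral truncated near the diagonal; both are symmetric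
under integration, and on `u` they converge to the true operators (`discrete_weak_inequality`).
Since `ψ_β` is not compactly supported, it is multiplied by a `C²` cutoff whose second differences
obey the same bounds uniformly in the radius. The step tends to zero first
(`weak_inequality_cutoff`), then the radius to infinity, always by domination with a multiple of the
integrable function `w ψ_β`. -/

/-- The second difference `f(x+z) + f(x-z) - 2 f(x)`. -/
def secondDiff {N : ℕ} (f : EuclideanSpace ℝ (Fin N) → ℝ) (x z : EuclideanSpace ℝ (Fin N)) : ℝ :=
  f (x + z) + f (x - z) - 2 * f x

/-- The weight `ψ_β` multiplied by the compactly supported `C²` cutoff `(1 - |x|²/R)₊³`. -/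
noncomputable def cutoffWeight {N : ℕ} (β R : ℝ) (x : EuclideanSpace ℝ (Fin N)) : ℝ :=
  weightPsi β x * (max 0 (1 - ‖x‖ ^ 2 / R)) ^ 3

/-! ### One-variable calculus: second differences and powers of the positive part. -/

/-- The mean value inequality is used twice: `h t + h (-t)` has derivative `h' t - h' (-t)`, which
is at most `2B` because the two points are at distance at most `2`. -/
theorem abs_add_sub_two_mul_le_of_deriv2_bound {h h' h'' : ℝ → ℝ} {B : ℝ}
    (hd : ∀ t ∈ Set.Icc (-1 : ℝ) 1, HasDerivAt h (h' t) t)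
    (hd' : ∀ t ∈ Set.Icc (-1 : ℝ) 1, HasDerivAt h' (h'' t) t)
    (hB : ∀ t ∈ Set.Icc (-1 : ℝ) 1, |h'' t| ≤ B) :
    |h 1 + h (-1) - 2 * h 0| ≤ 2 * B := by
  have hB0 : 0 ≤ B := (abs_nonneg _).trans (hB 0 (by simp))
  have hlip : ∀ t ∈ Set.Icc (0 : ℝ) 1, |h' t - h' (-t)| ≤ 2 * B := by
    intro t ht
    have := (convex_Icc (-1 : ℝ) 1).norm_image_sub_le_of_norm_hasDerivWithin_le
      (fun x hx => (hd' x hx).hasDerivWithinAt) (C := B) (fun x hx => hB x hx)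
      (x := -t) (y := t) ⟨by linarith [ht.2], by linarith [ht.1]⟩ ⟨by linarith [ht.1], ht.2⟩
    rw [Real.norm_eq_abs, Real.norm_eq_abs] at this
    refine this.trans ?_
    have : |t - -t| ≤ 2 := by
      rw [abs_le]; constructor <;> linarith [ht.1, ht.2]
    nlinarith
  have key := (convex_Icc (0 : ℝ) 1).norm_image_sub_le_of_norm_hasDerivWithin_le
    (f := fun t => h t + h (-t)) (f' := fun t => h' t - h' (-t)) (C := 2 * B)
    (fun t ht => by
      have h1 := hd t ⟨by linarith [ht.1], ht.2⟩
      have h2 := (hd (-t) ⟨by linarith [ht.2], by linarith [ht.1]⟩).comp t (hasDerivAt_neg t)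
      have h3 := (h1.add h2).hasDerivWithinAt (s := Set.Icc (0 : ℝ) 1)
      convert! h3 using 1
      ring) (fun t ht => hlip t ht) (x := 0) (y := 1) (by simp) (by simp)
  simp only [Real.norm_eq_abs] at key
  calc _ = |h 1 + h (-1) - (h 0 + h (-0))| := by rw [neg_zero]; congr 1; ring
    _ ≤ _ := by simpa using key

/-- One application of L'Hôpital leaves a difference quotient of `h'` at `0`, so no continuity of
the second derivative is needed. -/
theorem tendsto_second_difference_quotient {h h' : ℝ → ℝ} {L : ℝ}
    (hd : ∀ t, HasDerivAt h (h' t) t) (hd' : HasDerivAt h' L 0) :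
    Tendsto (fun t => (h t + h (-t) - 2 * h 0) / t ^ 2) (𝓝[>] 0) (𝓝 L) := by
  have hf : ∀ t, HasDerivAt (fun t => h t + h (-t) - 2 * h 0) (h' t - h' (-t)) t := by
    intro t
    have h2 := (hd (-t)).comp t (hasDerivAt_neg t)
    have h3 := ((hd t).add h2).sub_const (2 * h 0)
    convert! h3 using 1
    ring
  have hc : Continuous (fun t => h t + h (-t) - 2 * h 0) :=
    continuous_iff_continuousAt.2 fun t => (hf t).continuousAt
  refine HasDerivAt.lhopital_zero_nhdsGT (f' := fun t => h' t - h' (-t)) (g' := fun t => 2 * t)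
    (Eventually.of_forall hf) (Eventually.of_forall fun t => ?_) ?_ ?_ ?_ ?_
  · simpa using hasDerivAt_pow 2 t
  · filter_upwards [self_mem_nhdsWithin] with t ht
    have : (0 : ℝ) < t := ht
    positivity
  · have := (hc.tendsto 0).mono_left (nhdsWithin_le_nhds (s := Set.Ioi 0))
    convert! this using 2
    simp; ring
  · have := ((continuous_pow 2).tendsto (0 : ℝ)).mono_left (nhdsWithin_le_nhds (s := Set.Ioi 0))
    simpa using this
  · have h1 : HasDerivAt (fun t => h' t - h' (-t)) (2 * L) 0 := by
      have h2 : HasDerivAt (fun t => h' (-t)) (L * -1) 0 := by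
        have h0 : HasDerivAt h' L (-0) := by simpa using hd'
        exact h0.comp 0 (hasDerivAt_neg 0)
      convert! hd'.sub h2 using 1
      ring
    have h3 := (hasDerivAt_iff_tendsto_slope.1 h1).mono_left
      (nhdsWithin_mono 0 (show Set.Ioi (0 : ℝ) ⊆ {0}ᶜ from fun x hx => ne_of_gt hx))
    have h4 := h3.div_const 2
    rw [show 2 * L / 2 = L by ring] at h4
    refine h4.congr fun t => ?_
    simp only [slope_def_field, neg_zero, sub_self, sub_zero]
    rw [div_div, mul_comm t 2]

/-- Taken with `k = 1` and then `k = 0`, this differentiates the cubed positive part twice; an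
exponent of at least `2` makes the function `o(x)` at the corner. -/
theorem hasDerivAt_posPart_pow (k : ℕ) (x : ℝ) :
    HasDerivAt (fun x : ℝ => (max 0 x) ^ (k + 2)) ((k + 2 : ℝ) * (max 0 x) ^ (k + 1)) x := by
  rcases lt_trichotomy x 0 with hx | rfl | hx
  · have : (fun x : ℝ => (max 0 x) ^ (k + 2)) =ᶠ[𝓝 x] fun _ => 0 := by
      filter_upwards [Iio_mem_nhds hx] with y hy
      rw [max_eq_left (le_of_lt hy)]; simp
    rw [max_eq_left hx.le]
    simpa using (hasDerivAt_const x (0 : ℝ)).congr_of_eventuallyEq this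
  · rw [hasDerivAt_iff_isLittleO]
    have h1 : (fun x' : ℝ => (max 0 x') ^ (k + 2)) =O[𝓝 0] fun x' => x' ^ (k + 2) := by
      refine Asymptotics.IsBigO.of_bound 1 (Eventually.of_forall fun y => ?_)
      rw [norm_pow, norm_pow, one_mul]
      gcongr
      simp only [Real.norm_eq_abs]
      rcases le_total y 0 with h | h
      · simp [max_eq_left h]
      · simp [max_eq_right h]
    have h2 : (fun x' : ℝ => x' ^ (k + 2)) =o[𝓝 0] fun x' => x' := by
      simpa using Asymptotics.isLittleO_pow_pow (𝕜 := ℝ) (m := 1) (n := k + 2) (by omega)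
    simpa using h1.trans_isLittleO h2
  · have : (fun x : ℝ => (max 0 x) ^ (k + 2)) =ᶠ[𝓝 x] fun y => y ^ (k + 2) := by
      filter_upwards [Ioi_mem_nhds hx] with y hy
      rw [max_eq_right (le_of_lt hy)]
    rw [max_eq_right hx.le]
    have h0 := (hasDerivAt_pow (k + 2) x).congr_of_eventuallyEq this
    simpa using h0

/-! ### The weights `ψ_β` and the bracket `⟨x⟩`. -/

theorem weightPsi_pos {N : ℕ} (β : ℝ) (x : EuclideanSpace ℝ (Fin N)) : 0 < weightPsi β x := by
  unfold weightPsi; positivity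

theorem weightPsi_add {N : ℕ} (a b : ℝ) (x : EuclideanSpace ℝ (Fin N)) :
    weightPsi (a + b) x = weightPsi a x * weightPsi b x := by
  unfold weightPsi
  rw [← Real.rpow_add (by positivity)]
  congr 1; ring

theorem weightPsi_anti {N : ℕ} {a b : ℝ} (h : a ≤ b) (x : EuclideanSpace ℝ (Fin N)) :
    weightPsi b x ≤ weightPsi a x := by
  unfold weightPsi
  apply Real.rpow_le_rpow_of_exponent_le
  · nlinarith [sq_nonneg ‖x‖]
  · linarith

theorem continuous_weightPsi {N : ℕ} (β : ℝ) :
    Continuous (weightPsi β : EuclideanSpace ℝ (Fin N) → ℝ) := by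
  unfold weightPsi
  refine Continuous.rpow_const (by fun_prop) fun x => Or.inl ?_
  positivity

theorem sqrt_rpow_eq_weightPsi {N : ℕ} (β : ℝ) (x : EuclideanSpace ℝ (Fin N)) :
    (√(1 + ‖x‖ ^ 2)) ^ (-β) = weightPsi β x := by
  unfold weightPsi
  rw [Real.sqrt_eq_rpow, ← Real.rpow_mul (by positivity)]
  congr 1; ring

theorem one_le_bracket {N : ℕ} (x : EuclideanSpace ℝ (Fin N)) : 1 ≤ √(1 + ‖x‖ ^ 2) := by
  rw [Real.one_le_sqrt]; nlinarith [sq_nonneg ‖x‖]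

theorem norm_le_bracket {N : ℕ} (x : EuclideanSpace ℝ (Fin N)) : ‖x‖ ≤ √(1 + ‖x‖ ^ 2) :=
  Real.le_sqrt_of_sq_le (by linarith)

theorem rpow_le_of_comparable {a b : ℝ} (r : ℝ) (hb : 0 < b) (h1 : b / 4 ≤ a) (h2 : a ≤ 4 * b) :
    a ^ r ≤ 4 ^ |r| * b ^ r := by
  have ha : 0 < a := by linarith
  rcases le_total 0 r with hr | hr
  · rw [abs_of_nonneg hr, ← Real.mul_rpow (by norm_num) hb.le]
    exact Real.rpow_le_rpow ha.le h2 hr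
  · rw [abs_of_nonpos hr]
    calc a ^ r ≤ (b / 4) ^ r := Real.rpow_le_rpow_of_nonpos (by positivity) h1 hr
      _ = 4 ^ (-r) * b ^ r := by
        rw [Real.div_rpow hb.le (by norm_num), Real.rpow_neg (by norm_num)]
        field_simp

/-- The radius `⟨x⟩/2` defines the near zone used throughout: on it every weight is comparable to
its value at `x`. -/
theorem bracket_sq_comparable {N : ℕ} {x z : EuclideanSpace ℝ (Fin N)}
    (hz : ‖z‖ ≤ √(1 + ‖x‖ ^ 2) / 2) {t : ℝ} (ht : |t| ≤ 1) :
    (1 + ‖x‖ ^ 2) / 4 ≤ 1 + ‖x + t • z‖ ^ 2 ∧ 1 + ‖x + t • z‖ ^ 2 ≤ 4 * (1 + ‖x‖ ^ 2) := by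
  set l := √(1 + ‖x‖ ^ 2) with hl
  have hl2 : l ^ 2 = 1 + ‖x‖ ^ 2 := Real.sq_sqrt (by positivity)
  have hl1 : 1 ≤ l := one_le_bracket x
  have hxl : ‖x‖ ≤ l := norm_le_bracket x
  have htz : ‖t • z‖ ≤ l / 2 := by
    rw [norm_smul, Real.norm_eq_abs]
    nlinarith [norm_nonneg z, abs_nonneg t]
  have h1 : ‖x‖ ≤ ‖x + t • z‖ + l / 2 := by
    calc ‖x‖ = ‖(x + t • z) - t • z‖ := by simp
      _ ≤ ‖x + t • z‖ + ‖t • z‖ := norm_sub_le _ _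
      _ ≤ _ := by linarith
  have h2 : ‖x + t • z‖ ≤ ‖x‖ + l / 2 := (norm_add_le _ _).trans (by linarith)
  have hn := norm_nonneg (x + t • z)
  have hx := norm_nonneg x
  rw [← hl2]
  constructor
  · by_contra hcon
    push Not at hcon
    set y := ‖x + t • z‖
    have hy : y < l / 2 := by nlinarith
    have h3 : ‖x‖ ^ 2 ≤ (y + l / 2) ^ 2 := by gcongr
    have h5 : y * (l / 2) ≤ y ^ 2 / 2 + l ^ 2 / 8 := by nlinarith [sq_nonneg (y - l / 2)]
    nlinarith
  · have h3 : ‖x + t • z‖ ^ 2 ≤ (‖x‖ + l / 2) ^ 2 := by gcongr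
    nlinarith

/-! ### Second differences of the truncated weights, uniformly in the radius. -/

/-- Second differences of a radial function whose profile satisfies symbol bounds. -/
theorem abs_secondDiff_radial_le {N : ℕ} {F F' F'' : ℝ → ℝ} {A β : ℝ}
    (hF : ∀ r, 0 ≤ r → HasDerivAt F (F' r) r) (hF' : ∀ r, 0 ≤ r → HasDerivAt F' (F'' r) r)
    (hA' : ∀ r, 0 ≤ r → |F' r| ≤ A * (1 + r) ^ (-β / 2 - 1))
    (hA'' : ∀ r, 0 ≤ r → |F'' r| ≤ A * (1 + r) ^ (-β / 2 - 2))
    {x z : EuclideanSpace ℝ (Fin N)} (hz : ‖z‖ ≤ √(1 + ‖x‖ ^ 2) / 2) :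
    |secondDiff (fun y => F (‖y‖ ^ 2)) x z| ≤
      12 * A * 4 ^ |-β / 2 - 1| * weightPsi (β + 2) x * ‖z‖ ^ 2 := by
  set q : ℝ → ℝ := fun t => ‖x + t • z‖ ^ 2 with hq
  set q' : ℝ → ℝ := fun t => 2 * inner ℝ (x + t • z) z with hq'
  have hline : ∀ t : ℝ, HasDerivAt (fun t : ℝ => x + t • z) z t := fun t => by
    simpa using ((hasDerivAt_id t).smul_const z).const_add x
  have hdq : ∀ t, HasDerivAt q (q' t) t := fun t => (hline t).norm_sq
  have hdq' : ∀ t, HasDerivAt q' (2 * ‖z‖ ^ 2) t := fun t => by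
    have := ((hline t).inner ℝ (hasDerivAt_const t z)).const_mul 2
    convert! this using 1
    simp
  have hq0 : ∀ t, 0 ≤ q t := fun t => by positivity
  have hA0 : 0 ≤ A := by
    have := (abs_nonneg _).trans (hA' 0 le_rfl)
    simpa using this
  have key := abs_add_sub_two_mul_le_of_deriv2_bound (h := fun t => F (q t))
    (h' := fun t => F' (q t) * q' t) (h'' := fun t => F'' (q t) * q' t * q' t + F' (q t) * (2 * ‖z‖ ^ 2))
    -- The `6` is `4 + 2`: the term `F'' q'²` contributes `4A`, by `q'² ≤ 4 q ‖z‖²`, and `F' q''`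
    -- contributes `2A`, by `q'' = 2‖z‖²`.
    (B := 6 * A * 4 ^ |-β / 2 - 1| * weightPsi (β + 2) x * ‖z‖ ^ 2)
    (fun t _ => (hF _ (hq0 t)).comp t (hdq t))
    (fun t _ => ((hF' _ (hq0 t)).comp t (hdq t)).mul (hdq' t))
    (fun t ht => by
      obtain ⟨c1, c2⟩ := bracket_sq_comparable hz (abs_le.2 ht)
      have e1 : |q' t| ^ 2 ≤ 4 * (1 + q t) * ‖z‖ ^ 2 := by
        have : |q' t| ≤ 2 * (‖x + t • z‖ * ‖z‖) := by
          rw [hq', abs_mul, abs_two]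
          gcongr
          exact abs_real_inner_le_norm _ _
        calc |q' t| ^ 2 ≤ (2 * (‖x + t • z‖ * ‖z‖)) ^ 2 := by gcongr
          _ = 4 * q t * ‖z‖ ^ 2 := by rw [hq]; ring
          _ ≤ _ := by gcongr; linarith
      have h1q : 0 < 1 + q t := by linarith [hq0 t]
      have e2 : (1 + q t) ^ (-β / 2 - 2) * (1 + q t) = (1 + q t) ^ (-β / 2 - 1) := by
        rw [← Real.rpow_add_one h1q.ne']; congr 1; ring
      have e3 : (1 + q t) ^ (-β / 2 - 1) ≤ 4 ^ |-β / 2 - 1| * weightPsi (β + 2) x := by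
        have := rpow_le_of_comparable (-β / 2 - 1) (by positivity) c1 c2
        unfold weightPsi
        rwa [show -(β + 2) / 2 = -β / 2 - 1 by ring]
      calc |F'' (q t) * q' t * q' t + F' (q t) * (2 * ‖z‖ ^ 2)|
          ≤ |F'' (q t)| * |q' t| ^ 2 + |F' (q t)| * (2 * ‖z‖ ^ 2) := by
            refine (abs_add_le _ _).trans (le_of_eq ?_)
            rw [abs_mul (F' (q t)), abs_of_nonneg (show 0 ≤ 2 * ‖z‖ ^ 2 by positivity),
              abs_mul _ (q' t), abs_mul _ (q' t)]
            ring
        _ ≤ (A * (1 + q t) ^ (-β / 2 - 2)) * (4 * (1 + q t) * ‖z‖ ^ 2) +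
            (A * (1 + q t) ^ (-β / 2 - 1)) * (2 * ‖z‖ ^ 2) := by
            gcongr
            · exact hA'' _ (hq0 t)
            · exact hA' _ (hq0 t)
        _ = 6 * A * ((1 + q t) ^ (-β / 2 - 2) * (1 + q t)) * ‖z‖ ^ 2 +
            2 * A * ((1 + q t) ^ (-β / 2 - 1) - (1 + q t) ^ (-β / 2 - 2) * (1 + q t)) * ‖z‖ ^ 2 := by
            ring
        _ = 6 * A * (1 + q t) ^ (-β / 2 - 1) * ‖z‖ ^ 2 := by rw [e2]; ring
        _ ≤ 6 * A * (4 ^ |-β / 2 - 1| * weightPsi (β + 2) x) * ‖z‖ ^ 2 := by gcongr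
        _ = _ := by ring)
  simp only [hq, one_smul, zero_smul, add_zero, neg_smul] at key
  unfold secondDiff
  rw [sub_eq_add_neg x z]
  calc _ ≤ _ := key
    _ = _ := by ring

/-- On the support `r ≤ R`, and `R ≥ 1`, so `1 + r ≤ 2R`. Each derivative of the cutoff costs a
factor `1/R`; this trades it for a factor `(1+r)⁻¹`, independently of `R`. -/
theorem cutoff_div_le {R r : ℝ} (hR : 1 ≤ R) (hr : 0 ≤ r) :
    max 0 (1 - r / R) / R ≤ 2 * (1 + r)⁻¹ := by
  have hR0 : 0 < R := by linarith
  rcases le_total (1 - r / R) 0 with h | h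
  · rw [max_eq_left h]; simp; positivity
  · rw [max_eq_right h]
    have h1 : r ≤ R := by
      have : r / R ≤ 1 := by linarith
      rwa [div_le_one hR0] at this
    rw [← div_eq_mul_inv, div_le_div_iff₀ hR0 (by positivity)]
    have h2 : 1 - r / R ≤ 1 := by
      have : 0 ≤ r / R := by positivity
      linarith
    nlinarith

/-- Second differences of the truncated weights, uniformly in the truncation. -/
theorem exists_abs_secondDiff_cutoffWeight_le (N : ℕ) (β : ℝ) :
    ∃ C, 0 < C ∧ ∀ R, 1 ≤ R → ∀ x z : EuclideanSpace ℝ (Fin N), ‖z‖ ≤ √(1 + ‖x‖ ^ 2) / 2 →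
      |secondDiff (cutoffWeight β R) x z| ≤ C * weightPsi (β + 2) x * ‖z‖ ^ 2 := by
  set b := |-β / 2| with hb
  have hb0 : 0 ≤ b := abs_nonneg _
  -- The sum of the four coefficients in the product rule for `F''`: `b(b+1)`, twice `6b`, and `24`.
  -- It also dominates the `b + 6` needed for `F'`.
  set A := b ^ 2 + 13 * b + 24 with hA
  refine ⟨12 * A * 4 ^ |-β / 2 - 1|, by positivity, fun R hR x z hz => ?_⟩
  have hR0 : 0 < R := by linarith
  set χ : ℝ → ℝ := fun r => max 0 (1 - r / R) with hχ
  have hχ0 : ∀ r, 0 ≤ χ r := fun r => le_max_left _ _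
  have hχ1 : ∀ r, 0 ≤ r → χ r ≤ 1 := fun r hr => by
    refine max_le zero_le_one ?_
    have : 0 ≤ r / R := by positivity
    linarith
  have hin : ∀ r, HasDerivAt (fun r : ℝ => 1 - r / R) (-(1 / R)) r := fun r =>
    ((hasDerivAt_id r).div_const R).const_sub 1
  have hd3 : ∀ r, HasDerivAt (fun r => χ r ^ 3) (-(3 * χ r ^ 2 / R)) r := fun r => by
    have := (hasDerivAt_posPart_pow 1 (1 - r / R)).comp r (hin r)
    convert! this using 1
    push_cast; simp only [hχ]; ring
  have hd2 : ∀ r, HasDerivAt (fun r => -(3 * χ r ^ 2 / R)) (6 * χ r / R ^ 2) r := fun r => by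
    have := (((hasDerivAt_posPart_pow 0 (1 - r / R)).comp r (hin r)).const_mul 3).div_const R |>.neg
    convert! this using 1
    push_cast; simp only [hχ]; field_simp; ring
  have hp : ∀ (e r : ℝ), 0 ≤ r → HasDerivAt (fun r : ℝ => (1 + r) ^ e) (e * (1 + r) ^ (e - 1)) r :=
    fun e r hr => by
      have := ((hasDerivAt_id r).const_add 1).rpow_const (p := e) (Or.inl (by simp; linarith))
      convert! this using 1
      simp
  set F' : ℝ → ℝ := fun r => (-β / 2 * (1 + r) ^ (-β / 2 - 1)) * χ r ^ 3 +
    (1 + r) ^ (-β / 2) * (-(3 * χ r ^ 2 / R)) with hF'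
  set F'' : ℝ → ℝ := fun r =>
    ((-β / 2 * ((-β / 2 - 1) * (1 + r) ^ (-β / 2 - 1 - 1))) * χ r ^ 3 +
      (-β / 2 * (1 + r) ^ (-β / 2 - 1)) * (-(3 * χ r ^ 2 / R))) +
    ((-β / 2 * (1 + r) ^ (-β / 2 - 1)) * (-(3 * χ r ^ 2 / R)) +
      (1 + r) ^ (-β / 2) * (6 * χ r / R ^ 2)) with hF''
  have key := abs_secondDiff_radial_le (N := N) (F := fun r => (1 + r) ^ (-β / 2) * χ r ^ 3)
    (F' := F') (F'' := F'') (A := A) (β := β)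
    (fun r hr => (hp _ r hr).mul (hd3 r))
    (fun r hr => (((hp _ r hr).const_mul _).mul (hd3 r)).add ((hp _ r hr).mul (hd2 r)))
    (fun r hr => ?_) (fun r hr => ?_) hz
  · exact key
  · have h1r : 0 < 1 + r := by linarith
    have hc := cutoff_div_le hR hr
    have e1 : (1 + r) ^ (-β / 2) = (1 + r) ^ (-β / 2 - 1) * (1 + r) := by
      rw [← Real.rpow_add_one h1r.ne']; congr 1; ring
    have hP : 0 < (1 + r) ^ (-β / 2 - 1) := by positivity
    have t1 : |(-β / 2 * (1 + r) ^ (-β / 2 - 1)) * χ r ^ 3| ≤ b * (1 + r) ^ (-β / 2 - 1) := by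
      rw [abs_mul, abs_mul, abs_of_pos hP, abs_of_nonneg (pow_nonneg (hχ0 r) 3)]
      exact mul_le_of_le_one_right (by positivity) (pow_le_one₀ (hχ0 r) (hχ1 r hr))
    have t2 : |(1 + r) ^ (-β / 2) * (-(3 * χ r ^ 2 / R))| ≤ 6 * (1 + r) ^ (-β / 2 - 1) := by
      rw [abs_mul, abs_neg, abs_of_pos (show 0 < (1 + r) ^ (-β / 2) by positivity),
        abs_of_nonneg (by have := hχ0 r; positivity), e1]
      calc (1 + r) ^ (-β / 2 - 1) * (1 + r) * (3 * χ r ^ 2 / R)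
          = (1 + r) ^ (-β / 2 - 1) * (1 + r) * (3 * χ r * (χ r / R)) := by ring
        _ ≤ (1 + r) ^ (-β / 2 - 1) * (1 + r) * (3 * 1 * (2 * (1 + r)⁻¹)) := by
          have := hχ0 r
          gcongr
          exact hχ1 r hr
        _ = _ := by field_simp; ring
    calc |F' r| ≤ _ := abs_add_le _ _
      _ ≤ b * (1 + r) ^ (-β / 2 - 1) + 6 * (1 + r) ^ (-β / 2 - 1) := add_le_add t1 t2
      _ ≤ A * (1 + r) ^ (-β / 2 - 1) := by
        rw [← add_mul]; gcongr; rw [hA]; nlinarith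
  · have h1r : 0 < 1 + r := by linarith
    have hc := cutoff_div_le hR hr
    have e1 : (1 + r) ^ (-β / 2 - 1) = (1 + r) ^ (-β / 2 - 2) * (1 + r) := by
      rw [← Real.rpow_add_one h1r.ne']; congr 1; ring
    have e0 : (1 + r) ^ (-β / 2) = (1 + r) ^ (-β / 2 - 2) * (1 + r) * (1 + r) := by
      rw [← e1, ← Real.rpow_add_one h1r.ne']; congr 1; ring
    have e2 : -β / 2 - 1 - 1 = -β / 2 - 2 := by ring
    have hP : 0 < (1 + r) ^ (-β / 2 - 2) := by positivity
    have hb1 : |-β / 2 - 1| ≤ b + 1 := (abs_sub _ _).trans (by simp [hb])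
    have h0 := hχ0 r
    have h1 := hχ1 r hr
    have t1 : |(-β / 2 * ((-β / 2 - 1) * (1 + r) ^ (-β / 2 - 1 - 1))) * χ r ^ 3| ≤
        b * (b + 1) * (1 + r) ^ (-β / 2 - 2) := by
      rw [e2, abs_mul, abs_mul, abs_mul, abs_of_pos hP, abs_of_nonneg (pow_nonneg h0 3)]
      refine (mul_le_of_le_one_right (by positivity) (pow_le_one₀ h0 h1)).trans ?_
      rw [← mul_assoc]
      gcongr
    have t2 : |(-β / 2 * (1 + r) ^ (-β / 2 - 1)) * (-(3 * χ r ^ 2 / R))| ≤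
        6 * b * (1 + r) ^ (-β / 2 - 2) := by
      rw [abs_mul, abs_mul, abs_neg, abs_of_pos (show 0 < (1 + r) ^ (-β / 2 - 1) by positivity),
        abs_of_nonneg (show 0 ≤ 3 * χ r ^ 2 / R by positivity), e1]
      calc b * ((1 + r) ^ (-β / 2 - 2) * (1 + r)) * (3 * χ r ^ 2 / R)
          = b * ((1 + r) ^ (-β / 2 - 2) * (1 + r)) * (3 * χ r * (χ r / R)) := by ring
        _ ≤ b * ((1 + r) ^ (-β / 2 - 2) * (1 + r)) * (3 * 1 * (2 * (1 + r)⁻¹)) := by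
          gcongr
        _ = _ := by field_simp; ring
    have t3 : |(1 + r) ^ (-β / 2) * (6 * χ r / R ^ 2)| ≤ 24 * (1 + r) ^ (-β / 2 - 2) := by
      -- Only one factor `χ` is left for two factors `1/R`, so `cutoff_div_le` cannot be applied
      -- twice; where `χ` is positive, `r < R` holds and bounds `R⁻¹` directly.
      have hRr : χ r / R ^ 2 ≤ 4 * ((1 + r)⁻¹ * (1 + r)⁻¹) := by
        rcases eq_or_lt_of_le h0 with h | h
        · rw [← h]; simp; positivity
        · have hrR : r ≤ R := by
            by_contra hcon
            push Not at hcon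
            have : 1 - r / R ≤ 0 := by
              have : 1 ≤ r / R := by rw [one_le_div hR0]; exact hcon.le
              linarith
            rw [hχ] at h
            simp only [max_eq_left this] at h
            exact lt_irrefl _ h
          have : R⁻¹ ≤ 2 * (1 + r)⁻¹ := by
            rw [← div_eq_mul_inv, inv_eq_one_div, div_le_div_iff₀ hR0 h1r]
            linarith
          calc χ r / R ^ 2 ≤ 1 / R ^ 2 := by gcongr
            _ = R⁻¹ * R⁻¹ := by field_simp
            _ ≤ (2 * (1 + r)⁻¹) * (2 * (1 + r)⁻¹) := by gcongr
            _ = _ := by ring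
      rw [abs_of_nonneg (by positivity), e0]
      calc (1 + r) ^ (-β / 2 - 2) * (1 + r) * (1 + r) * (6 * χ r / R ^ 2)
          = (1 + r) ^ (-β / 2 - 2) * (1 + r) * (1 + r) * (6 * (χ r / R ^ 2)) := by ring
        _ ≤ (1 + r) ^ (-β / 2 - 2) * (1 + r) * (1 + r) * (6 * (4 * ((1 + r)⁻¹ * (1 + r)⁻¹))) := by
          gcongr
        _ = _ := by field_simp; ring
    calc |F'' r| ≤ _ := abs_add_le _ _
      _ ≤ _ := add_le_add (abs_add_le _ _) (abs_add_le _ _)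
      _ ≤ (b * (b + 1) * (1 + r) ^ (-β / 2 - 2) + 6 * b * (1 + r) ^ (-β / 2 - 2)) +
          (6 * b * (1 + r) ^ (-β / 2 - 2) + 24 * (1 + r) ^ (-β / 2 - 2)) :=
        add_le_add (add_le_add t1 t2) (add_le_add t2 t3)
      _ = A * (1 + r) ^ (-β / 2 - 2) := by rw [hA]; ring

theorem tendsto_cutoffWeight {N : ℕ} (β : ℝ) (x : EuclideanSpace ℝ (Fin N)) :
    Tendsto (fun n : ℕ => cutoffWeight β ((n : ℝ) + 1) x) atTop (𝓝 (weightPsi β x)) := by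
  unfold cutoffWeight
  have h : Tendsto (fun n : ℕ => ‖x‖ ^ 2 / ((n : ℝ) + 1)) atTop (𝓝 0) := by
    have := (tendsto_one_div_add_atTop_nhds_zero_nat (𝕜 := ℝ)).const_mul (‖x‖ ^ 2)
    simpa [div_eq_mul_inv] using this
  have h2 := ((((tendsto_const_nhds (x := (0 : ℝ))).max (h.const_sub 1)).pow 3).const_mul
    (weightPsi β x))
  simpa using h2

theorem tendsto_secondDiff_cutoffWeight {N : ℕ} (β : ℝ) (x z : EuclideanSpace ℝ (Fin N)) :
    Tendsto (fun n : ℕ => secondDiff (cutoffWeight β ((n : ℝ) + 1)) x z) atTop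
      (𝓝 (secondDiff (weightPsi β) x z)) :=
  ((tendsto_cutoffWeight β _).add (tendsto_cutoffWeight β _)).sub
    ((tendsto_cutoffWeight β _).const_mul 2)

theorem cutoffWeight_nonneg {N : ℕ} (β R : ℝ) (x : EuclideanSpace ℝ (Fin N)) :
    0 ≤ cutoffWeight β R x :=
  mul_nonneg (weightPsi_pos β x).le (pow_nonneg (le_max_left _ _) 3)

theorem cutoffWeight_le {N : ℕ} (β : ℝ) {R : ℝ} (hR : 1 ≤ R) (x : EuclideanSpace ℝ (Fin N)) :
    cutoffWeight β R x ≤ weightPsi β x := by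
  refine mul_le_of_le_one_right (weightPsi_pos β x).le (pow_le_one₀ (le_max_left _ _) ?_)
  have : 0 ≤ ‖x‖ ^ 2 / R := by positivity
  exact max_le zero_le_one (by linarith)

theorem continuous_cutoffWeight {N : ℕ} (β R : ℝ) :
    Continuous (cutoffWeight β R : EuclideanSpace ℝ (Fin N) → ℝ) := by
  unfold cutoffWeight
  exact (continuous_weightPsi β).mul (by fun_prop)

theorem cutoffWeight_eq_zero {N : ℕ} (β : ℝ) {R : ℝ} (hR : 1 ≤ R) {x : EuclideanSpace ℝ (Fin N)}
    (hx : R ≤ ‖x‖) : cutoffWeight β R x = 0 := by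
  unfold cutoffWeight
  have : 1 - ‖x‖ ^ 2 / R ≤ 0 := by
    have : 1 ≤ ‖x‖ ^ 2 / R := by
      rw [one_le_div (by linarith)]; nlinarith
    linarith
  rw [max_eq_left this]; simp

theorem hasCompactSupport_cutoffWeight {N : ℕ} (β : ℝ) {R : ℝ} (hR : 1 ≤ R) :
    HasCompactSupport (cutoffWeight β R : EuclideanSpace ℝ (Fin N) → ℝ) := by
  refine HasCompactSupport.of_support_subset_isCompact (isCompact_closedBall 0 R) fun x hx => ?_
  by_contra hcon
  simp only [Metric.mem_closedBall, dist_zero_right, not_le] at hcon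
  exact hx (cutoffWeight_eq_zero β hR hcon.le)

/-! ### Second differences of `C²` functions and the discrete Laplacian. -/

theorem exists_abs_secondDiff_le_of_contDiff {N : ℕ} {u : EuclideanSpace ℝ (Fin N) → ℝ}
    (hu : ContDiff ℝ 2 u) (R : ℝ) :
    ∃ B, 0 ≤ B ∧ ∀ x z : EuclideanSpace ℝ (Fin N), ‖x‖ ≤ R → ‖z‖ ≤ 1 →
      |secondDiff u x z| ≤ B * ‖z‖ ^ 2 := by
  have hu1 : ContDiff ℝ 1 (fderiv ℝ u) := hu.fderiv_right (by norm_num)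
  have hc : Continuous (fderiv ℝ (fderiv ℝ u)) := hu1.continuous_fderiv (by norm_num)
  obtain ⟨B, hB⟩ := IsCompact.exists_bound_of_continuousOn (f := fderiv ℝ (fderiv ℝ u))
    (isCompact_closedBall (0 : EuclideanSpace ℝ (Fin N)) (R + 1)) hc.continuousOn
  refine ⟨2 * max B 0, by positivity, fun x z hx hz => ?_⟩
  have hline : ∀ t : ℝ, HasDerivAt (fun t : ℝ => x + t • z) z t := fun t => by
    simpa using ((hasDerivAt_id t).smul_const z).const_add x
  have key := abs_add_sub_two_mul_le_of_deriv2_bound (h := fun t => u (x + t • z))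
    (h' := fun t => fderiv ℝ u (x + t • z) z)
    (h'' := fun t => fderiv ℝ (fderiv ℝ u) (x + t • z) z z) (B := max B 0 * ‖z‖ ^ 2)
    (fun t _ => ((hu.differentiable (by norm_num)) _).hasFDerivAt.comp_hasDerivAt t (hline t))
    (fun t _ => by
      have h1 := ((hu1.differentiable (by norm_num)) (x + t • z)).hasFDerivAt.comp_hasDerivAt t (hline t)
      simpa using h1.clm_apply (hasDerivAt_const t z))
    (fun t ht => by
      have hmem : x + t • z ∈ Metric.closedBall (0 : EuclideanSpace ℝ (Fin N)) (R + 1) := by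
        rw [mem_closedBall_zero_iff]
        refine (norm_add_le _ _).trans (add_le_add hx ?_)
        rw [norm_smul]
        exact mul_le_one₀ (abs_le.2 ht) (norm_nonneg _) hz
      calc |fderiv ℝ (fderiv ℝ u) (x + t • z) z z| ≤ ‖fderiv ℝ (fderiv ℝ u) (x + t • z) z‖ * ‖z‖ := by
            rw [← Real.norm_eq_abs]; exact ContinuousLinearMap.le_opNorm _ _
        _ ≤ ‖fderiv ℝ (fderiv ℝ u) (x + t • z)‖ * ‖z‖ * ‖z‖ := by
            gcongr; exact ContinuousLinearMap.le_opNorm _ _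
        _ ≤ max B 0 * ‖z‖ * ‖z‖ := by
            gcongr; exact (hB _ hmem).trans (le_max_left _ _)
        _ = _ := by ring)
  simp only [one_smul, zero_smul, add_zero, neg_smul] at key
  unfold secondDiff
  rw [sub_eq_add_neg x z]
  calc _ ≤ _ := key
    _ = _ := by ring

/-- The discrete Laplacian with step `h`. -/
noncomputable def discreteLaplacian {N : ℕ} (f : EuclideanSpace ℝ (Fin N) → ℝ) (h : ℝ)
    (x : EuclideanSpace ℝ (Fin N)) : ℝ :=
  ∑ i, secondDiff f x (h • EuclideanSpace.basisFun (Fin N) ℝ i) / h ^ 2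

theorem tendsto_discreteLaplacian {N : ℕ} {u : EuclideanSpace ℝ (Fin N) → ℝ}
    (hu : ContDiff ℝ 2 u) (x : EuclideanSpace ℝ (Fin N)) :
    Tendsto (fun h => discreteLaplacian u h x) (𝓝[>] 0)
      (𝓝 ((Laplacian.laplacian u : EuclideanSpace ℝ (Fin N) → ℝ) x)) := by
  have hu1 : ContDiff ℝ 1 (fderiv ℝ u) := hu.fderiv_right (by norm_num)
  rw [InnerProductSpace.laplacian_eq_iteratedFDeriv_orthonormalBasis u
    (EuclideanSpace.basisFun (Fin N) ℝ)]
  unfold discreteLaplacian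
  refine tendsto_finsetSum _ fun i _ => ?_
  set z := EuclideanSpace.basisFun (Fin N) ℝ i
  have hline : ∀ t : ℝ, HasDerivAt (fun t : ℝ => x + t • z) z t := fun t => by
    simpa using ((hasDerivAt_id t).smul_const z).const_add x
  have key := tendsto_second_difference_quotient (h := fun t => u (x + t • z))
    (h' := fun t => fderiv ℝ u (x + t • z) z) (L := fderiv ℝ (fderiv ℝ u) x z z)
    (fun t => ((hu.differentiable (by norm_num)) _).hasFDerivAt.comp_hasDerivAt t (hline t))
    (by
      have h1 := ((hu1.differentiable (by norm_num)) (x + (0 : ℝ) • z)).hasFDerivAt.comp_hasDerivAt 0 (hline 0)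
      simpa using h1.clm_apply (hasDerivAt_const 0 z))
  rw [iteratedFDeriv_two_apply]
  simp only [zero_smul, add_zero, neg_smul] at key
  simpa [secondDiff, sub_eq_add_neg] using key

/-! ### Integrals of powers of the norm, and the mass of `ψ_β` on balls. -/

theorem integrableOn_ball_norm_rpow {N : ℕ} (hN : 1 ≤ N) {e : ℝ} (he : -(N : ℝ) < e) (r : ℝ) :
    IntegrableOn (fun z : EuclideanSpace ℝ (Fin N) => ‖z‖ ^ e) (Metric.ball 0 r) := by
  have : Nonempty (Fin N) := ⟨⟨0, hN⟩⟩
  rw [integrableOn_fun_norm_addHaar volume (f := fun y : ℝ => y ^ e)]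
  rcases le_or_gt r 0 with hr | hr
  · rw [Set.Ioo_eq_empty (by linarith)]; exact integrableOn_empty
  · have h1 : IntegrableOn (fun y : ℝ => y ^ ((N : ℝ) - 1 + e)) (Set.Ioo 0 r) :=
      (intervalIntegral.integrableOn_Ioo_rpow_iff hr).2 (by linarith)
    refine h1.congr_fun (fun y hy => ?_) measurableSet_Ioo
    have hy0 : 0 < y := hy.1
    simp only [finrank_euclideanSpace, Fintype.card_fin, smul_eq_mul]
    rw [Real.rpow_add hy0, ← Real.rpow_natCast y (N - 1), Nat.cast_sub hN]
    simp

theorem measurableSet_le_norm {N : ℕ} (r : ℝ) :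
    MeasurableSet {z : EuclideanSpace ℝ (Fin N) | r ≤ ‖z‖} :=
  measurableSet_le measurable_const measurable_norm

theorem integrableOn_norm_rpow_far {N : ℕ} {e r : ℝ} (he : e < -(N : ℝ)) (hr : 0 < r) :
    IntegrableOn (fun z : EuclideanSpace ℝ (Fin N) => ‖z‖ ^ e) {z | r ≤ ‖z‖} := by
  have h1 : Integrable (fun z : EuclideanSpace ℝ (Fin N) => (1 + ‖z‖) ^ (-(-e))) :=
    integrable_one_add_norm (by simp; linarith)
  refine Integrable.mono' ((h1.const_mul ((1 + r⁻¹) ^ (-e))).integrableOn (s := {z | r ≤ ‖z‖})) ?_ ?_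
  · exact (measurable_norm.pow_const e).aestronglyMeasurable
  · refine (ae_restrict_iff' (measurableSet_le_norm r)).2 (Eventually.of_forall fun z hz => ?_)
    have hz' : r ≤ ‖z‖ := hz
    have hz0 : 0 < ‖z‖ := by linarith
    have he0 : e ≤ 0 := by have : (0 : ℝ) ≤ N := by positivity
                           linarith
    rw [Real.norm_of_nonneg (by positivity), neg_neg]
    have h2 : 1 + ‖z‖ ≤ (1 + r⁻¹) * ‖z‖ := by
      have : 1 ≤ r⁻¹ * ‖z‖ := by rw [inv_mul_eq_div, one_le_div hr]; exact hz'
      linarith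
    calc ‖z‖ ^ e = (1 + r⁻¹) ^ (-e) * ((1 + r⁻¹) * ‖z‖) ^ e := by
          rw [Real.mul_rpow (by positivity) hz0.le, ← mul_assoc, ← Real.rpow_add (by positivity)]
          simp
      _ ≤ (1 + r⁻¹) ^ (-e) * (1 + ‖z‖) ^ e := by
          exact mul_le_mul_of_nonneg_left
            (Real.rpow_le_rpow_of_nonpos (by positivity) h2 he0) (by positivity)

theorem setIntegral_norm_rpow_scale {N : ℕ} {S : Set ℝ} (hS : MeasurableSet S) (e : ℝ) {r : ℝ}
    (hr : 0 < r) :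
    ∫ z in {z : EuclideanSpace ℝ (Fin N) | ‖z‖ / r ∈ S}, ‖z‖ ^ e =
      r ^ ((N : ℝ) + e) * ∫ z in {z : EuclideanSpace ℝ (Fin N) | ‖z‖ ∈ S}, ‖z‖ ^ e := by
  have hm1 : MeasurableSet {z : EuclideanSpace ℝ (Fin N) | ‖z‖ / r ∈ S} :=
    (measurable_norm.div_const r) hS
  have hm2 : MeasurableSet {z : EuclideanSpace ℝ (Fin N) | ‖z‖ ∈ S} := measurable_norm hS
  rw [← integral_indicator hm1, ← integral_indicator hm2]
  have h := Measure.integral_comp_smul (volume : Measure (EuclideanSpace ℝ (Fin N)))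
    (Set.indicator {z : EuclideanSpace ℝ (Fin N) | ‖z‖ / r ∈ S} fun z => ‖z‖ ^ e) r
  have h2 : ∀ z : EuclideanSpace ℝ (Fin N),
      (Set.indicator {z : EuclideanSpace ℝ (Fin N) | ‖z‖ / r ∈ S} fun z => ‖z‖ ^ e) (r • z) =
      r ^ e * (Set.indicator {z : EuclideanSpace ℝ (Fin N) | ‖z‖ ∈ S} fun z => ‖z‖ ^ e) z := by
    intro z
    have hz : ‖r • z‖ = r * ‖z‖ := by rw [norm_smul, Real.norm_of_nonneg hr.le]
    have hz2 : ‖r • z‖ / r = ‖z‖ := by rw [hz]; field_simp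
    by_cases hmem : ‖z‖ ∈ S
    · rw [Set.indicator_of_mem (by simpa [hz2] using hmem), Set.indicator_of_mem (by simpa using hmem),
        hz, Real.mul_rpow hr.le (norm_nonneg _)]
    · rw [Set.indicator_of_notMem (by simpa [hz2] using hmem),
        Set.indicator_of_notMem (by simpa using hmem), mul_zero]
  simp_rw [h2] at h
  rw [integral_const_mul, abs_of_pos (by positivity), smul_eq_mul] at h
  simp only [finrank_euclideanSpace, Fintype.card_fin] at h
  rw [Real.rpow_add hr, Real.rpow_natCast, mul_assoc, h]
  field_simp

theorem setIntegral_ball_norm_rpow {N : ℕ} (e : ℝ) {r : ℝ} (hr : 0 < r) :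
    ∫ z in Metric.ball (0 : EuclideanSpace ℝ (Fin N)) r, ‖z‖ ^ e =
      r ^ ((N : ℝ) + e) * ∫ z in Metric.ball (0 : EuclideanSpace ℝ (Fin N)) 1, ‖z‖ ^ e := by
  have h := setIntegral_norm_rpow_scale (N := N) (measurableSet_Iio (a := (1 : ℝ))) e hr
  have e1 : {z : EuclideanSpace ℝ (Fin N) | ‖z‖ / r ∈ Set.Iio 1} = Metric.ball 0 r := by
    ext z; simp [div_lt_one hr]
  have e2 : {z : EuclideanSpace ℝ (Fin N) | ‖z‖ ∈ Set.Iio 1} = Metric.ball 0 1 := by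
    ext z; simp
  rwa [e1, e2] at h

theorem setIntegral_far_norm_rpow {N : ℕ} (e : ℝ) {r : ℝ} (hr : 0 < r) :
    ∫ z in {z : EuclideanSpace ℝ (Fin N) | r ≤ ‖z‖}, ‖z‖ ^ e =
      r ^ ((N : ℝ) + e) * ∫ z in {z : EuclideanSpace ℝ (Fin N) | 1 ≤ ‖z‖}, ‖z‖ ^ e := by
  have h := setIntegral_norm_rpow_scale (N := N) (measurableSet_Ici (a := (1 : ℝ))) e hr
  have e1 : {z : EuclideanSpace ℝ (Fin N) | ‖z‖ / r ∈ Set.Ici 1} = {z | r ≤ ‖z‖} := by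
    ext z; simp [one_le_div hr]
  have e2 : {z : EuclideanSpace ℝ (Fin N) | ‖z‖ ∈ Set.Ici 1} = {z | 1 ≤ ‖z‖} := by
    ext z; simp
  rwa [e1, e2] at h

/-- Growth of the mass of `ψ_β` on balls, for `0 ≤ β < N`. -/
theorem exists_setIntegral_ball_weightPsi_le_of_lt {N : ℕ} (hN : 1 ≤ N) {β : ℝ} (hβ0 : 0 ≤ β)
    (hβ : β < N) : ∃ c, 0 ≤ c ∧ ∀ r, 1 ≤ r →
      ∫ y in Metric.ball (0 : EuclideanSpace ℝ (Fin N)) r, weightPsi β y ≤ c * r ^ ((N : ℝ) - β) := by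
  refine ⟨∫ y in Metric.ball (0 : EuclideanSpace ℝ (Fin N)) 1, ‖y‖ ^ (-β),
    integral_nonneg fun _ => by positivity, fun r hr => ?_⟩
  have h := setIntegral_ball_norm_rpow (N := N) (-β) (r := r) (by linarith)
  rw [mul_comm, sub_eq_add_neg, ← h]
  refine setIntegral_mono_ae_restrict ?_ (integrableOn_ball_norm_rpow hN (by linarith) r) ?_
  · exact ((continuous_weightPsi β).locallyIntegrable.integrableOn_isCompact
      (isCompact_closedBall 0 r)).mono_set Metric.ball_subset_closedBall
  -- The origin has to be discarded: for `β ≠ 0` the convention for real powers gives `0 ^ (-β) =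
  -- 0`, which does not dominate `ψ_β(0) = 1`.
  · have : Nonempty (Fin N) := ⟨⟨0, hN⟩⟩
    have h0 : ∀ᵐ y : EuclideanSpace ℝ (Fin N), y ≠ 0 := Measure.ae_ne volume 0
    filter_upwards [ae_restrict_of_ae h0] with y hy
    have hy0 : 0 < ‖y‖ := norm_pos_iff.2 hy
    rw [← sqrt_rpow_eq_weightPsi]
    exact Real.rpow_le_rpow_of_nonpos hy0 (norm_le_bracket y) (by linarith)

/-- The mass grows like a logarithm here, and any positive power absorbs it. The comparison weight
has exponent `N - min κ N`, the minimum keeping this exponent nonnegative. -/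
theorem exists_setIntegral_ball_weightPsi_le_of_eq {N : ℕ} (hN : 1 ≤ N) {κ : ℝ} (hκ : 0 < κ) :
    ∃ c, 0 ≤ c ∧ ∀ r, 1 ≤ r →
      ∫ y in Metric.ball (0 : EuclideanSpace ℝ (Fin N)) r, weightPsi (N : ℝ) y ≤ c * r ^ κ := by
  have hN0 : (0 : ℝ) < N := by exact_mod_cast hN
  obtain ⟨c, hc, h⟩ := exists_setIntegral_ball_weightPsi_le_of_lt hN (β := (N : ℝ) - min κ N)
    (by linarith [min_le_right κ (N : ℝ)]) (by linarith [lt_min hκ hN0])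
  refine ⟨c, hc, fun r hr => ?_⟩
  have hinteg : ∀ b, IntegrableOn (weightPsi b) (Metric.ball (0 : EuclideanSpace ℝ (Fin N)) r) :=
    fun b => ((continuous_weightPsi b).locallyIntegrable.integrableOn_isCompact
      (isCompact_closedBall 0 r)).mono_set Metric.ball_subset_closedBall
  refine (setIntegral_mono (hinteg _) (hinteg _) fun y =>
    weightPsi_anti (a := (N : ℝ) - min κ N) (by linarith [lt_min hκ hN0]) y).trans ((h r hr).trans ?_)
  rw [sub_sub_cancel]
  gcongr
  exact min_le_left _ _

theorem integrable_weightPsi {N : ℕ} {β : ℝ} (hβ : (N : ℝ) < β) :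
    Integrable (weightPsi β : EuclideanSpace ℝ (Fin N) → ℝ) :=
  integrable_rpow_neg_one_add_norm_sq (by simpa using hβ)

theorem exists_setIntegral_ball_weightPsi_le_of_gt {N : ℕ} {β : ℝ} (hβ : (N : ℝ) < β) :
    ∃ c, 0 ≤ c ∧ ∀ r, 1 ≤ r →
      ∫ y in Metric.ball (0 : EuclideanSpace ℝ (Fin N)) r, weightPsi β y ≤ c * r ^ (0 : ℝ) := by
  refine ⟨∫ y : EuclideanSpace ℝ (Fin N), weightPsi β y,
    integral_nonneg fun y => (weightPsi_pos β y).le, fun r _ => ?_⟩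
  rw [Real.rpow_zero, mul_one]
  exact setIntegral_le_integral (integrable_weightPsi hβ)
    (Eventually.of_forall fun y => (weightPsi_pos β y).le)

/-! ### Decay of the fractional Laplacian of the weights. -/

theorem half_bracket_rpow {N : ℕ} (e : ℝ) (x : EuclideanSpace ℝ (Fin N)) :
    (√(1 + ‖x‖ ^ 2) / 2) ^ e = 2 ^ (-e) * weightPsi (-e) x := by
  rw [← sqrt_rpow_eq_weightPsi, Real.div_rpow (by positivity) (by norm_num), neg_neg,
    Real.rpow_neg (by norm_num)]
  field_simp

/-- Split according to the size of `x + z`. Where `|x+z| ≥ ⟨x⟩` the weight is at most `ψ_β(x)`, and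
the kernel integrates to a multiple of `⟨x⟩^(-2s)`. Where `|x+z| < ⟨x⟩` the kernel is at most
`(⟨x⟩/2)^(-q)`, and the weight has mass at most `c⟨x⟩^κ`. The resulting decays `⟨x⟩^(-β-2s)` and
`⟨x⟩^(-q+κ)` are compared by the hypotheses on `γ`. -/
theorem exists_far_integral_le_of_growth {N : ℕ} {s β γ κ c : ℝ} (hs : 0 < s)
    (hβ : 0 ≤ β) (hγ : γ ≤ 2 * s) (hκ : β + γ ≤ N + 2 * s - κ) (hc : 0 ≤ c)
    (hgrow : ∀ r, 1 ≤ r →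
      ∫ y in Metric.ball (0 : EuclideanSpace ℝ (Fin N)) r, weightPsi β y ≤ c * r ^ κ) :
    ∃ C, ∀ x : EuclideanSpace ℝ (Fin N),
      IntegrableOn (fun z => weightPsi β (x + z) * ‖z‖ ^ (-((N : ℝ) + 2 * s)))
        {z | √(1 + ‖x‖ ^ 2) / 2 ≤ ‖z‖} ∧
      ∫ z in {z | √(1 + ‖x‖ ^ 2) / 2 ≤ ‖z‖}, weightPsi β (x + z) * ‖z‖ ^ (-((N : ℝ) + 2 * s)) ≤
        C * weightPsi (β + γ) x := by
  set q := (N : ℝ) + 2 * s with hq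
  set c2 := ∫ z in {z : EuclideanSpace ℝ (Fin N) | 1 ≤ ‖z‖}, ‖z‖ ^ (-q) with hc2
  have hc20 : 0 ≤ c2 := integral_nonneg fun _ => by positivity
  refine ⟨c2 * 2 ^ (2 * s) + 2 ^ q * c, fun x => ?_⟩
  set l := √(1 + ‖x‖ ^ 2) with hl
  have hl1 : 1 ≤ l := one_le_bracket x
  set S : Set (EuclideanSpace ℝ (Fin N)) := {z | l / 2 ≤ ‖z‖} with hS
  have hSm : MeasurableSet S := measurableSet_le_norm _
  set f1 : EuclideanSpace ℝ (Fin N) → ℝ := S.indicator fun z => weightPsi β x * ‖z‖ ^ (-q) with hf1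
  set g : EuclideanSpace ℝ (Fin N) → ℝ := (Metric.ball 0 l).indicator (weightPsi β) with hg
  have hi1 : Integrable f1 := by
    rw [hf1, integrable_indicator_iff hSm]
    exact (integrableOn_norm_rpow_far (by rw [hq]; linarith) (by linarith)).const_mul _
  have hig : Integrable g := by
    rw [hg, integrable_indicator_iff measurableSet_ball]
    exact ((continuous_weightPsi β).locallyIntegrable.integrableOn_isCompact
      (isCompact_closedBall 0 l)).mono_set Metric.ball_subset_closedBall
  have hig' : Integrable fun z => (l / 2) ^ (-q) * g (x + z) := (hig.comp_add_left x).const_mul _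
  have hf10 : ∀ z, 0 ≤ f1 z := fun z =>
    Set.indicator_nonneg (fun z _ => by have := weightPsi_pos β x; positivity) z
  have hg0 : ∀ z, 0 ≤ g z := fun z =>
    Set.indicator_nonneg (fun z _ => (weightPsi_pos β z).le) z
  have hdom : ∀ z, S.indicator (fun z => weightPsi β (x + z) * ‖z‖ ^ (-q)) z ≤
      f1 z + (l / 2) ^ (-q) * g (x + z) := by
    intro z
    by_cases hz : z ∈ S
    · have hz' : l / 2 ≤ ‖z‖ := hz
      rw [Set.indicator_of_mem hz]
      by_cases hy : x + z ∈ Metric.ball (0 : EuclideanSpace ℝ (Fin N)) l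
      · have : g (x + z) = weightPsi β (x + z) := Set.indicator_of_mem hy _
        rw [this, mul_comm]
        refine le_add_of_nonneg_of_le (hf10 z) ?_
        have hN0 : (0 : ℝ) ≤ N := by positivity
        exact mul_le_mul_of_nonneg_right
          (Real.rpow_le_rpow_of_nonpos (by linarith) hz' (by rw [hq]; linarith))
          (weightPsi_pos β (x + z)).le
      · have h1 : f1 z = weightPsi β x * ‖z‖ ^ (-q) := Set.indicator_of_mem hz _
        rw [h1]
        refine le_add_of_le_of_nonneg ?_ (mul_nonneg (by positivity) (hg0 _))
        gcongr
        rw [← sqrt_rpow_eq_weightPsi, ← sqrt_rpow_eq_weightPsi]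
        refine Real.rpow_le_rpow_of_nonpos (by linarith) ?_ (by linarith)
        simp only [Metric.mem_ball, dist_zero_right, not_lt] at hy
        exact hy.trans (norm_le_bracket _)
    · rw [Set.indicator_of_notMem hz]
      exact add_nonneg (hf10 z) (mul_nonneg (by positivity) (hg0 _))
  have hinteg : IntegrableOn (fun z => weightPsi β (x + z) * ‖z‖ ^ (-q)) S := by
    rw [← integrable_indicator_iff hSm]
    refine Integrable.mono' (hi1.add hig') ?_ (Eventually.of_forall fun z => ?_)
    · refine (Measurable.indicator ?_ hSm).aestronglyMeasurable
      exact (((continuous_weightPsi β).comp (continuous_const.add continuous_id)).measurable).mul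
        (measurable_norm.pow_const _)
    · rw [Real.norm_of_nonneg (Set.indicator_nonneg (fun z _ => by
        have := weightPsi_pos β (x + z); positivity) z)]
      exact hdom z
  refine ⟨hinteg, ?_⟩
  rw [← integral_indicator hSm]
  have hI := integral_mono ((integrable_indicator_iff hSm).2 hinteg) (hi1.add hig') hdom
  refine hI.trans ?_
  simp only [Pi.add_apply]
  rw [integral_add hi1 hig', hf1, integral_indicator hSm, integral_const_mul, integral_const_mul,
    integral_add_left_eq_self g x, hg, integral_indicator measurableSet_ball,
    setIntegral_far_norm_rpow (-q) (by linarith), half_bracket_rpow, half_bracket_rpow, ← hc2]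
  have t1 : weightPsi β x * (2 ^ (-((N : ℝ) + -q)) * weightPsi (-((N : ℝ) + -q)) x * c2) ≤
      c2 * 2 ^ (2 * s) * weightPsi (β + γ) x := by
    have e : -((N : ℝ) + -q) = 2 * s := by rw [hq]; ring
    rw [e]
    calc weightPsi β x * (2 ^ (2 * s) * weightPsi (2 * s) x * c2)
        = c2 * 2 ^ (2 * s) * weightPsi (β + 2 * s) x := by rw [weightPsi_add]; ring
      _ ≤ _ := by gcongr; exact weightPsi_anti (by linarith) x
  have t2 : 2 ^ (- -q) * weightPsi (- -q) x *
      (∫ y in Metric.ball (0 : EuclideanSpace ℝ (Fin N)) l, weightPsi β y) ≤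
      2 ^ q * c * weightPsi (β + γ) x := by
    rw [neg_neg]
    have hw := (weightPsi_pos q x).le
    calc 2 ^ q * weightPsi q x * (∫ y in Metric.ball (0 : EuclideanSpace ℝ (Fin N)) l, weightPsi β y)
        ≤ 2 ^ q * weightPsi q x * (c * l ^ κ) := by gcongr; exact hgrow l hl1
      _ = 2 ^ q * c * weightPsi (q + -κ) x := by
        rw [weightPsi_add q, ← sqrt_rpow_eq_weightPsi (-κ), neg_neg]; ring
      _ ≤ _ := by gcongr; exact weightPsi_anti (by linarith) x
  calc _ ≤ _ := add_le_add t1 t2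
    _ = _ := by ring

/-- For `β ≤ 0` the weight grows, but in the far zone `1 + |x+z|² ≤ 10|z|²`, so it is absorbed into
the kernel as `|z|^(-β)`; the condition `-2s < β` is what keeps the product integrable at infinity.
Negative `β` do occur, when `N = 1` and `s > 1/2`. -/
theorem exists_far_integral_le_of_nonpos {N : ℕ} {s β : ℝ}
    (hβ : β ≤ 0) (hβs : -(2 * s) < β) :
    ∃ C, ∀ x : EuclideanSpace ℝ (Fin N),
      IntegrableOn (fun z => weightPsi β (x + z) * ‖z‖ ^ (-((N : ℝ) + 2 * s)))
        {z | √(1 + ‖x‖ ^ 2) / 2 ≤ ‖z‖} ∧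
      ∫ z in {z | √(1 + ‖x‖ ^ 2) / 2 ≤ ‖z‖}, weightPsi β (x + z) * ‖z‖ ^ (-((N : ℝ) + 2 * s)) ≤
        C * weightPsi (β + 2 * s) x := by
  set q := (N : ℝ) + 2 * s with hq
  set c2 := ∫ z in {z : EuclideanSpace ℝ (Fin N) | 1 ≤ ‖z‖}, ‖z‖ ^ (-β - q) with hc2
  refine ⟨10 ^ (-β / 2) * (2 ^ (β + 2 * s) * c2), fun x => ?_⟩
  set l := √(1 + ‖x‖ ^ 2) with hl
  have hl1 : 1 ≤ l := one_le_bracket x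
  have hl2 : l ^ 2 = 1 + ‖x‖ ^ 2 := Real.sq_sqrt (by positivity)
  set S : Set (EuclideanSpace ℝ (Fin N)) := {z | l / 2 ≤ ‖z‖} with hS
  have hSm : MeasurableSet S := measurableSet_le_norm _
  have hi : IntegrableOn (fun z : EuclideanSpace ℝ (Fin N) => 10 ^ (-β / 2) * ‖z‖ ^ (-β - q)) S :=
    (integrableOn_norm_rpow_far (by rw [hq]; linarith) (by linarith)).const_mul _
  have hdom : ∀ z ∈ S, weightPsi β (x + z) * ‖z‖ ^ (-q) ≤ 10 ^ (-β / 2) * ‖z‖ ^ (-β - q) := by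
    intro z hz
    have hz' : l / 2 ≤ ‖z‖ := hz
    have hz0 : 0 < ‖z‖ := by linarith
    have h1 : 1 + ‖x + z‖ ^ 2 ≤ 10 * ‖z‖ ^ 2 := by
      have h2 : ‖x + z‖ ^ 2 ≤ (‖x‖ + ‖z‖) ^ 2 := by gcongr; exact norm_add_le _ _
      nlinarith [sq_nonneg (‖x‖ - ‖z‖)]
    have h3 : weightPsi β (x + z) ≤ 10 ^ (-β / 2) * ‖z‖ ^ (-β) := by
      unfold weightPsi
      refine (Real.rpow_le_rpow (by positivity) h1 (by linarith)).trans (le_of_eq ?_)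
      rw [Real.mul_rpow (by norm_num) (by positivity), ← Real.rpow_natCast, ← Real.rpow_mul hz0.le]
      congr 2; push_cast; ring
    calc weightPsi β (x + z) * ‖z‖ ^ (-q) ≤ 10 ^ (-β / 2) * ‖z‖ ^ (-β) * ‖z‖ ^ (-q) := by gcongr
      _ = _ := by rw [mul_assoc, ← Real.rpow_add hz0]; rfl
  have hinteg : IntegrableOn (fun z => weightPsi β (x + z) * ‖z‖ ^ (-q)) S := by
    refine Integrable.mono' hi ?_ ((ae_restrict_iff' hSm).2 (Eventually.of_forall fun z hz => ?_))
    · exact ((((continuous_weightPsi β).comp (continuous_const.add continuous_id)).measurable).mul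
        (measurable_norm.pow_const _)).aestronglyMeasurable
    · rw [Real.norm_of_nonneg (by have := weightPsi_pos β (x + z); positivity)]
      exact hdom z hz
  refine ⟨hinteg, (setIntegral_mono_on hinteg hi hSm hdom).trans (le_of_eq ?_)⟩
  rw [integral_const_mul, setIntegral_far_norm_rpow _ (by linarith), half_bracket_rpow, ← hc2,
    show -((N : ℝ) + (-β - q)) = β + 2 * s by rw [hq]; ring]
  ring

/-- The decay exponents `γ` for which `(-Δ)^s ψ_β = O(⟨x⟩^(-β-γ))`. -/
def AdmissibleDecay (N : ℕ) (s β γ : ℝ) : Prop :=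
  (-(2 * s) < β ∧ β < N ∧ γ = 2 * s) ∨ (β = N ∧ γ < 2 * s) ∨ ((N : ℝ) < β ∧ β + γ = N + 2 * s)

theorem exists_far_integral_le {N : ℕ} (hN : 1 ≤ N) {s β γ : ℝ} (hs : 0 < s)
    (h : AdmissibleDecay N s β γ) :
    ∃ C, ∀ x : EuclideanSpace ℝ (Fin N),
      IntegrableOn (fun z => weightPsi β (x + z) * ‖z‖ ^ (-((N : ℝ) + 2 * s)))
        {z | √(1 + ‖x‖ ^ 2) / 2 ≤ ‖z‖} ∧
      ∫ z in {z | √(1 + ‖x‖ ^ 2) / 2 ≤ ‖z‖}, weightPsi β (x + z) * ‖z‖ ^ (-((N : ℝ) + 2 * s)) ≤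
        C * weightPsi (β + γ) x := by
  have hN0 : (0 : ℝ) ≤ N := by positivity
  rcases h with ⟨h1, h2, rfl⟩ | ⟨rfl, h2⟩ | ⟨h1, h2⟩
  · rcases le_total β 0 with h0 | h0
    · exact exists_far_integral_le_of_nonpos h0 h1
    · obtain ⟨c, hc, hg⟩ := exists_setIntegral_ball_weightPsi_le_of_lt hN h0 h2
      exact exists_far_integral_le_of_growth hs h0 le_rfl (by linarith) hc hg
  -- The slack `2s - γ > 0` is spent on the logarithmic growth of the mass.
  · obtain ⟨c, hc, hg⟩ := exists_setIntegral_ball_weightPsi_le_of_eq hN (κ := 2 * s - γ) (by linarith)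
    exact exists_far_integral_le_of_growth hs hN0 h2.le (by linarith) hc hg
  · obtain ⟨c, hc, hg⟩ := exists_setIntegral_ball_weightPsi_le_of_gt h1
    exact exists_far_integral_le_of_growth hs (by linarith) (by linarith) (by linarith) hc hg

/-- A majorant of the second differences of the truncated weights against the kernel. -/
noncomputable def diffMajorant {N : ℕ} (s β C : ℝ) (x z : EuclideanSpace ℝ (Fin N)) : ℝ :=
  (Metric.ball 0 (√(1 + ‖x‖ ^ 2) / 2)).indicator
    (fun z => C * weightPsi (β + 2) x * ‖z‖ ^ (2 - ((N : ℝ) + 2 * s))) z +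
  {z : EuclideanSpace ℝ (Fin N) | √(1 + ‖x‖ ^ 2) / 2 ≤ ‖z‖}.indicator
    (fun z => (weightPsi β (x + z) + weightPsi β (x - z) + 2 * weightPsi β x) *
      ‖z‖ ^ (-((N : ℝ) + 2 * s))) z

/-- Scaling settles the near part: `⟨x⟩^(-β-2)` times `∫ |z|^(2-q)` over the ball of radius `⟨x⟩/2`
is of order `⟨x⟩^(-β-2s)`, finite because `s < 1`. The constant term of the far part has the same
order, and only the translated weights can decay more slowly. -/
theorem exists_integral_diffMajorant_le {N : ℕ} (hN : 1 ≤ N) {s β γ : ℝ} (hs : 0 < s) (hs1 : s < 1)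
    (h : AdmissibleDecay N s β γ) (C : ℝ) (hC : 0 ≤ C) :
    ∃ D, ∀ x : EuclideanSpace ℝ (Fin N), Integrable (diffMajorant s β C x) ∧
      ∫ z, diffMajorant s β C x z ≤ D * weightPsi (β + γ) x := by
  obtain ⟨C1, hC1⟩ := exists_far_integral_le hN hs h
  have hγ : γ ≤ 2 * s := by
    rcases h with ⟨_, _, rfl⟩ | ⟨_, h⟩ | ⟨h1, h2⟩
    · exact le_rfl
    · exact h.le
    · linarith
  set q := (N : ℝ) + 2 * s with hq
  set c1 := ∫ z in Metric.ball (0 : EuclideanSpace ℝ (Fin N)) 1, ‖z‖ ^ (2 - q) with hc1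
  set c2 := ∫ z in {z : EuclideanSpace ℝ (Fin N) | 1 ≤ ‖z‖}, ‖z‖ ^ (-q) with hc2
  have hc10 : 0 ≤ c1 := integral_nonneg fun _ => by positivity
  have hc20 : 0 ≤ c2 := integral_nonneg fun _ => by positivity
  refine ⟨C * (2 ^ (2 * s - 2) * c1) + (C1 + C1 + 2 * (2 ^ (2 * s) * c2)), fun x => ?_⟩
  obtain ⟨hi, hI⟩ := hC1 x
  set l := √(1 + ‖x‖ ^ 2) with hl
  have hl1 : 1 ≤ l := one_le_bracket x
  set S : Set (EuclideanSpace ℝ (Fin N)) := {z | l / 2 ≤ ‖z‖} with hS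
  have hSm : MeasurableSet S := measurableSet_le_norm _
  have hn : IntegrableOn (fun z : EuclideanSpace ℝ (Fin N) => C * weightPsi (β + 2) x * ‖z‖ ^ (2 - q))
      (Metric.ball 0 (l / 2)) :=
    (integrableOn_ball_norm_rpow hN (by rw [hq]; linarith) _).const_mul _
  have hcon : IntegrableOn (fun z : EuclideanSpace ℝ (Fin N) => ‖z‖ ^ (-q)) S :=
    integrableOn_norm_rpow_far (by rw [hq]; linarith) (by linarith)
  -- Reflection `z ↦ -z` reduces the term in `x - z` to the one in `x + z`.
  have hneg : ∀ z, S.indicator (fun z => weightPsi β (x - z) * ‖z‖ ^ (-q)) z =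
      S.indicator (fun z => weightPsi β (x + z) * ‖z‖ ^ (-q)) (-z) := by
    intro z
    by_cases hz : z ∈ S
    · rw [Set.indicator_of_mem hz, Set.indicator_of_mem (by simpa [hS] using hz), norm_neg,
        sub_eq_add_neg]
    · rw [Set.indicator_of_notMem hz, Set.indicator_of_notMem (by simpa [hS] using hz)]
  have hi' : IntegrableOn (fun z => weightPsi β (x - z) * ‖z‖ ^ (-q)) S := by
    rw [← integrable_indicator_iff hSm] at hi ⊢
    exact hi.comp_neg.congr (Eventually.of_forall fun z => (hneg z).symm)
  have hI' : ∫ z in S, weightPsi β (x - z) * ‖z‖ ^ (-q) =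
      ∫ z in S, weightPsi β (x + z) * ‖z‖ ^ (-q) := by
    rw [← integral_indicator hSm, ← integral_indicator hSm]
    simp_rw [hneg]
    exact integral_neg_eq_self (fun z => S.indicator (fun z => weightPsi β (x + z) * ‖z‖ ^ (-q)) z) volume
  have hfar : IntegrableOn (fun z => weightPsi β (x + z) * ‖z‖ ^ (-q) +
      weightPsi β (x - z) * ‖z‖ ^ (-q) + 2 * weightPsi β x * ‖z‖ ^ (-q)) S :=
    (hi.add hi').add (hcon.const_mul _)
  have hfun : diffMajorant s β C x = fun z =>
      (Metric.ball 0 (l / 2)).indicator (fun z => C * weightPsi (β + 2) x * ‖z‖ ^ (2 - q)) z +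
      S.indicator (fun z => weightPsi β (x + z) * ‖z‖ ^ (-q) +
        weightPsi β (x - z) * ‖z‖ ^ (-q) + 2 * weightPsi β x * ‖z‖ ^ (-q)) z := by
    ext z
    unfold diffMajorant
    simp only [add_mul]
    rfl
  have i1 := (integrable_indicator_iff measurableSet_ball).2 hn
  have i2 := (integrable_indicator_iff hSm).2 hfar
  have hsplit : ∫ z in S, (weightPsi β (x + z) * ‖z‖ ^ (-q) +
      weightPsi β (x - z) * ‖z‖ ^ (-q) + 2 * weightPsi β x * ‖z‖ ^ (-q)) =
      (∫ z in S, weightPsi β (x + z) * ‖z‖ ^ (-q)) + (∫ z in S, weightPsi β (x + z) * ‖z‖ ^ (-q)) +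
        ∫ z in S, 2 * weightPsi β x * ‖z‖ ^ (-q) := by
    have ha : IntegrableOn (fun z => weightPsi β (x + z) * ‖z‖ ^ (-q) +
      weightPsi β (x - z) * ‖z‖ ^ (-q)) S := hi.add hi'
    rw [integral_add ha (hcon.const_mul _), integral_add hi hi', hI']
  rw [hfun]
  refine ⟨i1.add i2, ?_⟩
  rw [integral_add i1 i2, integral_indicator measurableSet_ball, integral_indicator hSm,
    hsplit, integral_const_mul,
    integral_const_mul, setIntegral_ball_norm_rpow _ (by linarith),
    setIntegral_far_norm_rpow _ (by linarith), half_bracket_rpow, half_bracket_rpow, ← hc1, ← hc2,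
    show -((N : ℝ) + (2 - q)) = 2 * s - 2 by rw [hq]; ring,
    show -((N : ℝ) + -q) = 2 * s by rw [hq]; ring]
  have hmono : weightPsi (β + 2 * s) x ≤ weightPsi (β + γ) x := weightPsi_anti (by linarith) x
  have t1 : C * weightPsi (β + 2) x * (2 ^ (2 * s - 2) * weightPsi (2 * s - 2) x * c1) ≤
      C * (2 ^ (2 * s - 2) * c1) * weightPsi (β + γ) x := by
    calc _ = C * (2 ^ (2 * s - 2) * c1) * weightPsi (β + 2 * s) x := by
          rw [show β + 2 * s = (β + 2) + (2 * s - 2) by ring, weightPsi_add (β + 2)]; ring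
      _ ≤ _ := by gcongr
  have t2 : 2 * weightPsi β x * (2 ^ (2 * s) * weightPsi (2 * s) x * c2) ≤
      2 * (2 ^ (2 * s) * c2) * weightPsi (β + γ) x := by
    calc _ = 2 * (2 ^ (2 * s) * c2) * weightPsi (β + 2 * s) x := by
          rw [weightPsi_add]; ring
      _ ≤ _ := by gcongr
  calc _ ≤ _ := add_le_add t1 (add_le_add (add_le_add hI hI) t2)
    _ = _ := by ring

theorem diffMajorant_nonneg {N : ℕ} {s β C : ℝ} (hC : 0 ≤ C) (x z : EuclideanSpace ℝ (Fin N)) :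
    0 ≤ diffMajorant s β C x z := by
  unfold diffMajorant
  refine add_nonneg (Set.indicator_nonneg (fun z _ => ?_) z) (Set.indicator_nonneg (fun z _ => ?_) z)
  · have := weightPsi_pos (β + 2) x
    positivity
  · have := weightPsi_pos β x
    have := weightPsi_pos β (x + z)
    have := weightPsi_pos β (x - z)
    positivity

/-- A single majorant serves all `R ≥ 1`, hence also the limit weight `ψ_β`; this uniformity
justifies the later passage `R → ∞`. -/
theorem exists_abs_secondDiff_cutoffWeight_mul_le (N : ℕ) (s β : ℝ) :
    ∃ C, 0 < C ∧
      (∀ R, 1 ≤ R → ∀ x z : EuclideanSpace ℝ (Fin N), ‖z‖ ≤ √(1 + ‖x‖ ^ 2) / 2 →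
        |secondDiff (cutoffWeight β R) x z| ≤ C * weightPsi (β + 2) x * ‖z‖ ^ 2) ∧
      (∀ R, 1 ≤ R → ∀ x z : EuclideanSpace ℝ (Fin N),
        |secondDiff (cutoffWeight β R) x z * ‖z‖ ^ (-((N : ℝ) + 2 * s))| ≤ diffMajorant s β C x z) ∧
      ∀ x z : EuclideanSpace ℝ (Fin N),
        |secondDiff (weightPsi β) x z * ‖z‖ ^ (-((N : ℝ) + 2 * s))| ≤ diffMajorant s β C x z := by
  obtain ⟨C, hC, h⟩ := exists_abs_secondDiff_cutoffWeight_le N β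
  have key : ∀ R, 1 ≤ R → ∀ x z : EuclideanSpace ℝ (Fin N),
      |secondDiff (cutoffWeight β R) x z * ‖z‖ ^ (-((N : ℝ) + 2 * s))| ≤ diffMajorant s β C x z := by
    intro R hR x z
    rcases eq_or_ne z 0 with rfl | hz
    · have : secondDiff (cutoffWeight β R) x 0 = 0 := by simp [secondDiff]; ring
      rw [this, zero_mul, abs_zero]
      exact diffMajorant_nonneg hC.le _ _
    have hz0 : 0 < ‖z‖ := norm_pos_iff.2 hz
    rw [abs_mul, abs_of_pos (show 0 < ‖z‖ ^ (-((N : ℝ) + 2 * s)) by positivity)]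
    unfold diffMajorant
    by_cases hzl : ‖z‖ < √(1 + ‖x‖ ^ 2) / 2
    · rw [Set.indicator_of_mem (by simpa using hzl), Set.indicator_of_notMem (by simpa using hzl),
        add_zero]
      calc _ ≤ C * weightPsi (β + 2) x * ‖z‖ ^ 2 * ‖z‖ ^ (-((N : ℝ) + 2 * s)) := by
            gcongr; exact h R hR x z hzl.le
        _ = _ := by
            rw [mul_assoc, ← Real.rpow_natCast, ← Real.rpow_add hz0]
            congr 2
    · rw [Set.indicator_of_notMem (by simpa using hzl),
        Set.indicator_of_mem (by simpa using hzl), zero_add]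
      gcongr
      have h1 := cutoffWeight_nonneg β R (x + z)
      have h2 := cutoffWeight_nonneg β R (x - z)
      have h3 := cutoffWeight_nonneg β R x
      have h4 := cutoffWeight_le β hR (x + z)
      have h5 := cutoffWeight_le β hR (x - z)
      have h6 := cutoffWeight_le β hR x
      unfold secondDiff
      rw [abs_le]
      constructor <;> linarith
  refine ⟨C, hC, h, key, fun x z => ?_⟩
  refine le_of_tendsto (((tendsto_secondDiff_cutoffWeight β x z).mul_const _).abs)
    (Eventually.of_forall fun n => key _ ?_ x z)
  have : (0 : ℝ) ≤ n := by positivity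
  linarith

/-! ### Gaussian subordination and the superharmonicity of `ψ_β`. -/

/-- The unnormalised heat kernel `t^(-N/2) exp(-|x|²/t)`. -/
noncomputable def heatProfile {N : ℕ} (t : ℝ) (x : EuclideanSpace ℝ (Fin N)) : ℝ :=
  t ^ (-(N : ℝ) / 2) * Real.exp (-‖x‖ ^ 2 / t)

theorem heatProfile_nonneg {N : ℕ} {t : ℝ} (ht : 0 < t) (x : EuclideanSpace ℝ (Fin N)) :
    0 ≤ heatProfile t x := by unfold heatProfile; positivity

theorem measurable_heatProfile {N : ℕ} :
    Measurable fun p : ℝ × EuclideanSpace ℝ (Fin N) => heatProfile p.1 p.2 := by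
  unfold heatProfile
  fun_prop

/-- The semigroup law up to normalization, by completing the square in `z` around `-(τ/(t+τ)) x`;
the new inverse variance is `b = 1/t + 1/τ`. -/
theorem integral_heatProfile_mul {N : ℕ} {t τ : ℝ} (ht : 0 < t) (hτ : 0 < τ)
    (x : EuclideanSpace ℝ (Fin N)) :
    ∫ z, heatProfile τ z * heatProfile t (x + z) =
      Real.pi ^ ((N : ℝ) / 2) * heatProfile (t + τ) x := by
  set b := (t + τ) / (t * τ) with hb
  have hb0 : 0 < b := by positivity
  have hpt : ∀ z : EuclideanSpace ℝ (Fin N), heatProfile τ z * heatProfile t (x + z) =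
      (τ ^ (-(N : ℝ) / 2) * t ^ (-(N : ℝ) / 2) * Real.exp (-‖x‖ ^ 2 / (t + τ))) *
        Real.exp (-b * ‖z + (τ / (t + τ)) • x‖ ^ 2) := by
    intro z
    have hexp : -‖z‖ ^ 2 / τ + -‖x + z‖ ^ 2 / t =
        -‖x‖ ^ 2 / (t + τ) + -b * ‖z + (τ / (t + τ)) • x‖ ^ 2 := by
      rw [norm_add_sq_real, norm_add_sq_real, inner_smul_right, norm_smul, mul_pow,
        Real.norm_eq_abs, sq_abs, real_inner_comm x z, hb]
      field_simp
      ring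
    unfold heatProfile
    calc _ = τ ^ (-(N : ℝ) / 2) * t ^ (-(N : ℝ) / 2) *
          (Real.exp (-‖z‖ ^ 2 / τ) * Real.exp (-‖x + z‖ ^ 2 / t)) := by ring
      _ = _ := by rw [← Real.exp_add, hexp, Real.exp_add]; ring
  simp_rw [hpt]
  rw [integral_const_mul,
    integral_add_right_eq_self (fun z : EuclideanSpace ℝ (Fin N) => Real.exp (-b * ‖z‖ ^ 2)),
    GaussianFourier.integral_rexp_neg_mul_sq_norm hb0]
  unfold heatProfile
  have : (Real.pi / b) ^ ((Module.finrank ℝ (EuclideanSpace ℝ (Fin N)) : ℝ) / 2) =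
      Real.pi ^ ((N : ℝ) / 2) * (t ^ ((N : ℝ) / 2) * τ ^ ((N : ℝ) / 2)) * (t + τ) ^ (-(N : ℝ) / 2) := by
    rw [finrank_euclideanSpace, Fintype.card_fin, hb, neg_div, Real.rpow_neg (by positivity),
      Real.div_rpow (by positivity) (by positivity), Real.div_rpow (by positivity) (by positivity),
      Real.mul_rpow ht.le hτ.le]
    field_simp
  rw [this, neg_div, Real.rpow_neg ht.le, Real.rpow_neg hτ.le]
  field_simp

theorem lintegral_heatProfile_mul {N : ℕ} {t τ : ℝ} (ht : 0 < t) (hτ : 0 < τ)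
    (x : EuclideanSpace ℝ (Fin N)) :
    ∫⁻ z, ENNReal.ofReal (heatProfile τ z) * ENNReal.ofReal (heatProfile t (x + z)) =
      ENNReal.ofReal (Real.pi ^ ((N : ℝ) / 2)) * ENNReal.ofReal (heatProfile (t + τ) x) := by
  have h := integral_heatProfile_mul ht hτ x
  have hpos : 0 < Real.pi ^ ((N : ℝ) / 2) * heatProfile (t + τ) x := by
    unfold heatProfile; positivity
  rw [← ENNReal.ofReal_mul (by positivity), ← h, ofReal_integral_eq_lintegral_ofReal]
  · refine lintegral_congr fun z => ?_
    rw [ENNReal.ofReal_mul (heatProfile_nonneg hτ z)]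
  · exact Integrable.of_integral_ne_zero (by rw [h]; exact hpos.ne')
  · exact Eventually.of_forall fun z => mul_nonneg (heatProfile_nonneg hτ z) (heatProfile_nonneg ht _)

theorem lintegral_heatProfile {N : ℕ} {τ : ℝ} (hτ : 0 < τ) :
    ∫⁻ z : EuclideanSpace ℝ (Fin N), ENNReal.ofReal (heatProfile τ z) =
      ENNReal.ofReal (Real.pi ^ ((N : ℝ) / 2)) := by
  have h : ∫ z : EuclideanSpace ℝ (Fin N), heatProfile τ z = Real.pi ^ ((N : ℝ) / 2) := by
    have hpt : ∀ z : EuclideanSpace ℝ (Fin N), heatProfile τ z =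
        τ ^ (-(N : ℝ) / 2) * Real.exp (-τ⁻¹ * ‖z‖ ^ 2) := fun z => by
      unfold heatProfile; congr 2; field_simp
    simp_rw [hpt]
    rw [integral_const_mul, GaussianFourier.integral_rexp_neg_mul_sq_norm (by positivity),
      finrank_euclideanSpace, Fintype.card_fin, neg_div, Real.rpow_neg hτ.le, div_inv_eq_mul,
      Real.mul_rpow Real.pi_pos.le hτ.le]
    field_simp
  rw [← h, ofReal_integral_eq_lintegral_ofReal]
  · exact Integrable.of_integral_ne_zero (by rw [h]; positivity)
  · exact Eventually.of_forall fun z => heatProfile_nonneg hτ z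

/-- The Gamma integral after `t ↦ 1/t`. It yields both Gaussian mixtures: `ψ_β` with `b = 1 + |x|²`,
and the kernel `|z|^(-q)` with `b = |z|²`. -/
theorem integral_rpow_mul_exp_neg_div {a b : ℝ} (ha : 0 < a) (hb : 0 < b) :
    ∫ t in Set.Ioi (0 : ℝ), t ^ (-a - 1) * Real.exp (-b / t) = Real.Gamma a * b ^ (-a) := by
  have h := integral_comp_rpow_Ioi (fun y : ℝ => y ^ (a - 1) * Real.exp (-(b * y)))
    (p := -1) (by norm_num)
  rw [Real.integral_rpow_mul_exp_neg_mul_Ioi ha hb] at h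
  rw [mul_comm, Real.rpow_neg hb.le, ← Real.inv_rpow hb.le, ← one_div, ← h]
  refine setIntegral_congr_fun measurableSet_Ioi fun t ht => ?_
  have ht0 : 0 < t := ht
  simp only [abs_neg, abs_one, one_mul, smul_eq_mul]
  rw [← mul_assoc, ← Real.rpow_mul ht0.le, ← Real.rpow_add ht0, Real.rpow_neg_one]
  congr 2 <;> ring

theorem integrableOn_rpow_mul_exp_neg_div {a b : ℝ} (ha : 0 < a) (hb : 0 < b) :
    IntegrableOn (fun t : ℝ => t ^ (-a - 1) * Real.exp (-b / t)) (Set.Ioi 0) :=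
  Integrable.of_integral_ne_zero (by
    rw [integral_rpow_mul_exp_neg_div ha hb]
    have := Real.Gamma_pos_of_pos ha
    positivity)

theorem lintegral_rpow_mul_sub_rpow_le {s ε t : ℝ} (hs : 0 < s) (hε : 0 < ε) (ht : ε < t) :
    ∫⁻ τ in Set.Ioo ε t, ENNReal.ofReal (τ ^ (-1 - s) * (t - τ) ^ (s - 1)) ≤
      ENNReal.ofReal (ε ^ (-s) / s * t ^ (s - 1)) := by
  have ht0 : 0 < t := hε.trans ht
  -- An explicit antiderivative: up to the factor `-1/(st)` it is `(t/τ - 1)^s`. Its vanishing at `τ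
  -- = t` leaves only the boundary term at `ε`.
  set f : ℝ → ℝ := fun τ => -(1 / (s * t)) * (τ ^ (-s) * (t - τ) ^ s) with hf
  have hcont : ContinuousOn f (Set.Icc ε t) := by
    refine ContinuousOn.mul continuousOn_const (ContinuousOn.mul ?_ ?_)
    · exact continuousOn_id.rpow_const fun τ hτ => Or.inl (ne_of_gt (hε.trans_le hτ.1))
    · exact (continuousOn_const.sub continuousOn_id).rpow_const fun τ _ => Or.inr hs.le
  have hderiv : ∀ τ ∈ Set.Ioo ε t, HasDerivAt f (τ ^ (-1 - s) * (t - τ) ^ (s - 1)) τ := by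
    intro τ hτ
    have hτ0 : 0 < τ := hε.trans hτ.1
    have hτt : 0 < t - τ := by linarith [hτ.2]
    have h1 := (hasDerivAt_id τ).rpow_const (p := -s) (Or.inl hτ0.ne')
    have h2 := ((hasDerivAt_id τ).const_sub t).rpow_const (p := s) (Or.inl hτt.ne')
    have h3 := (h1.mul h2).const_mul (-(1 / (s * t)))
    convert! h3 using 1
    simp only [id]
    have e1 : τ ^ (-s) = τ ^ (-1 - s) * τ := by
      rw [← Real.rpow_add_one hτ0.ne']; congr 1; ring
    have e2 : (t - τ) ^ s = (t - τ) ^ (s - 1) * (t - τ) := by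
      rw [← Real.rpow_add_one hτt.ne']; congr 1; ring
    rw [show -s - 1 = -1 - s by ring, e1, e2]
    field_simp
    ring
  have hnn : ∀ τ ∈ Set.Ioo ε t, 0 ≤ τ ^ (-1 - s) * (t - τ) ^ (s - 1) := by
    intro τ hτ
    have hτ0 : 0 < τ := hε.trans hτ.1
    have hτt : 0 < t - τ := by linarith [hτ.2]
    positivity
  -- The integrand is singular at `τ = t`; its sign together with continuity of the antiderivative
  -- gives integrability.
  have hinteg := intervalIntegral.integrableOn_deriv_of_nonneg hcont hderiv hnn
  have hI := intervalIntegral.integral_eq_sub_of_hasDerivAt_of_le ht.le hcont hderiv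
    ((intervalIntegrable_iff_integrableOn_Ioc_of_le ht.le).2 hinteg)
  rw [intervalIntegral.integral_of_le ht.le, integral_Ioc_eq_integral_Ioo] at hI
  rw [← ofReal_integral_eq_lintegral_ofReal (hinteg.mono_set Set.Ioo_subset_Ioc_self)
    ((ae_restrict_iff' measurableSet_Ioo).2 (Eventually.of_forall hnn)), hI]
  refine ENNReal.ofReal_le_ofReal ?_
  simp only [hf, sub_self, Real.zero_rpow hs.ne', mul_zero, zero_sub]
  have h1 : (t - ε) ^ s ≤ t ^ s := Real.rpow_le_rpow (by linarith) (by linarith) hs.le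
  have e : t ^ s = t ^ (s - 1) * t := by
    rw [← Real.rpow_add_one ht0.ne']; congr 1; ring
  calc -(-(1 / (s * t)) * (ε ^ (-s) * (t - ε) ^ s)) = 1 / (s * t) * (ε ^ (-s) * (t - ε) ^ s) := by ring
    _ ≤ 1 / (s * t) * (ε ^ (-s) * (t ^ (s - 1) * t)) := by rw [← e]; gcongr
    _ = _ := by field_simp

theorem lintegral_rpow_Ioi {s ε : ℝ} (hs : 0 < s) (hε : 0 < ε) :
    ∫⁻ τ in Set.Ioi ε, ENNReal.ofReal (τ ^ (-1 - s)) = ENNReal.ofReal (ε ^ (-s) / s) := by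
  have hinteg := integrableOn_Ioi_rpow_of_lt (a := -1 - s) (by linarith) hε
  rw [← ofReal_integral_eq_lintegral_ofReal hinteg, integral_Ioi_rpow_of_lt (by linarith) hε]
  · congr 1
    rw [show -1 - s + 1 = -s by ring]
    field_simp
  · refine (ae_restrict_iff' measurableSet_Ioi).2 (Eventually.of_forall fun τ hτ => ?_)
    have : 0 < τ := hε.trans hτ
    simp only [Pi.zero_apply]
    positivity

/-- The mixing density that represents `ψ_β` as a superposition of Gaussians, extended by zero. -/
noncomputable def mixingDensity (N : ℕ) (β : ℝ) : ℝ → ENNReal :=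
  (Set.Ioi 0).indicator fun t => ENNReal.ofReal (t ^ (((N : ℝ) - β) / 2 - 1) * Real.exp (-1 / t))

/-- The jump density `τ^(-1-s)` truncated below at `ε`. -/
noncomputable def jumpDensity (s ε : ℝ) : ℝ → ENNReal :=
  (Set.Ioi ε).indicator fun τ => ENNReal.ofReal (τ ^ (-1 - s))

theorem measurable_mixingDensity (N : ℕ) (β : ℝ) : Measurable (mixingDensity N β) := by
  unfold mixingDensity
  exact Measurable.indicator (by fun_prop) measurableSet_Ioi

theorem measurable_jumpDensity (s ε : ℝ) : Measurable (jumpDensity s ε) := by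
  unfold jumpDensity
  exact Measurable.indicator (by fun_prop) measurableSet_Ioi

theorem lintegral_mixingDensity {N : ℕ} {β : ℝ} (hβ : 0 < β) (x : EuclideanSpace ℝ (Fin N)) :
    ∫⁻ t, mixingDensity N β t * ENNReal.ofReal (heatProfile t x) =
      ENNReal.ofReal (Real.Gamma (β / 2)) * ENNReal.ofReal (weightPsi β x) := by
  have hΓ := Real.Gamma_pos_of_pos (half_pos hβ)
  have h1 := integral_rpow_mul_exp_neg_div (half_pos hβ) (b := 1 + ‖x‖ ^ 2) (by positivity)
  have h2 := integrableOn_rpow_mul_exp_neg_div (half_pos hβ) (b := 1 + ‖x‖ ^ 2) (by positivity)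
  unfold weightPsi
  rw [← ENNReal.ofReal_mul hΓ.le, neg_div, ← h1, ofReal_integral_eq_lintegral_ofReal h2,
    ← lintegral_indicator measurableSet_Ioi]
  · refine lintegral_congr fun t => ?_
    unfold mixingDensity
    by_cases ht : t ∈ Set.Ioi (0 : ℝ)
    · have ht0 : 0 < t := ht
      rw [Set.indicator_of_mem ht, Set.indicator_of_mem ht, ← ENNReal.ofReal_mul (by positivity)]
      congr 1
      unfold heatProfile
      calc _ = (t ^ (((N : ℝ) - β) / 2 - 1) * t ^ (-(N : ℝ) / 2)) *
            (Real.exp (-1 / t) * Real.exp (-‖x‖ ^ 2 / t)) := by ring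
        _ = _ := by
          rw [← Real.rpow_add ht0, ← Real.exp_add]
          congr 2 <;> ring
    · rw [Set.indicator_of_notMem ht, Set.indicator_of_notMem ht, zero_mul]
  · refine (ae_restrict_iff' measurableSet_Ioi).2 (Eventually.of_forall fun τ hτ => ?_)
    have : 0 < τ := hτ
    simp only [Pi.zero_apply]
    positivity

/-- The mixing density is a supersolution of the truncated fractional derivative of order `s`. -/
theorem lintegral_jumpDensity_mul_mixingDensity_le {N : ℕ} {s β ε : ℝ} (hs : 0 < s)
    (hβ : β ≤ (N : ℝ) - 2 * s) (hε : 0 < ε) (t : ℝ) :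
    ∫⁻ τ, jumpDensity s ε τ * mixingDensity N β (t - τ) ≤
      ENNReal.ofReal (ε ^ (-s) / s) * mixingDensity N β t := by
  set a := ((N : ℝ) - β) / 2 with ha
  have has : s ≤ a := by rw [ha]; linarith
  rcases le_or_gt t ε with ht | ht
  · have : ∀ τ, jumpDensity s ε τ * mixingDensity N β (t - τ) = 0 := by
      intro τ
      rcases le_or_gt τ ε with h | h
      · unfold jumpDensity
        rw [Set.indicator_of_notMem (by simpa using h), zero_mul]
      · unfold mixingDensity
        rw [Set.indicator_of_notMem (by simp; linarith), mul_zero]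
    simp [this]
  have ht0 : 0 < t := hε.trans ht
  -- The density factors as `t^(s-1)` times `t^(a-s) exp(-1/t)`. The second factor is nondecreasing
  -- exactly because `a ≥ s`, that is `β ≤ N - 2s`, so it comes out of the integral at its value at
  -- `t`; the first is handled by the explicit antiderivative.
  have hle : ∀ τ, jumpDensity s ε τ * mixingDensity N β (t - τ) ≤
      ENNReal.ofReal (t ^ (a - s) * Real.exp (-1 / t)) *
      (Set.Ioo ε t).indicator
        (fun τ => ENNReal.ofReal (τ ^ (-1 - s) * (t - τ) ^ (s - 1))) τ := by
    intro τ
    by_cases hτ : τ ∈ Set.Ioo ε t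
    · have hτ0 : 0 < τ := hε.trans hτ.1
      have hτt : 0 < t - τ := by linarith [hτ.2]
      unfold jumpDensity mixingDensity
      rw [Set.indicator_of_mem hτ, Set.indicator_of_mem (Set.mem_Ioi.2 hτ.1),
        Set.indicator_of_mem (Set.mem_Ioi.2 hτt), ← ENNReal.ofReal_mul (by positivity),
        ← ENNReal.ofReal_mul (by positivity)]
      refine ENNReal.ofReal_le_ofReal ?_
      have e1 : (t - τ) ^ (a - 1) = (t - τ) ^ (a - s) * (t - τ) ^ (s - 1) := by
        rw [← Real.rpow_add hτt]; congr 1; ring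
      have h1 : (t - τ) ^ (a - s) ≤ t ^ (a - s) :=
        Real.rpow_le_rpow hτt.le (by linarith) (by linarith)
      have h2 : Real.exp (-1 / (t - τ)) ≤ Real.exp (-1 / t) := by
        apply Real.exp_le_exp.2
        rw [neg_div, neg_div, neg_le_neg_iff]
        exact one_div_le_one_div_of_le hτt (by linarith)
      rw [e1]
      calc τ ^ (-1 - s) * ((t - τ) ^ (a - s) * (t - τ) ^ (s - 1) * Real.exp (-1 / (t - τ)))
          ≤ τ ^ (-1 - s) * (t ^ (a - s) * (t - τ) ^ (s - 1) * Real.exp (-1 / t)) := by gcongr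
        _ = _ := by ring
    · rw [Set.indicator_of_notMem hτ, mul_zero]
      refine le_of_eq ?_
      by_cases h : ε < τ
      · have h' : t ≤ τ := by
          by_contra hcon
          exact hτ ⟨h, not_le.1 hcon⟩
        unfold mixingDensity
        rw [Set.indicator_of_notMem (by simp; linarith), mul_zero]
      · unfold jumpDensity
        rw [Set.indicator_of_notMem (by simpa using h), zero_mul]
  refine (lintegral_mono hle).trans ?_
  rw [lintegral_const_mul' _ _ ENNReal.ofReal_ne_top, lintegral_indicator measurableSet_Ioo]
  refine (mul_le_mul_right (lintegral_rpow_mul_sub_rpow_le hs hε ht) _).trans (le_of_eq ?_)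
  unfold mixingDensity
  rw [Set.indicator_of_mem (Set.mem_Ioi.2 ht0), ← ENNReal.ofReal_mul (by positivity),
    ← ENNReal.ofReal_mul (by positivity)]
  congr 1
  have e1 : t ^ (a - 1) = t ^ (a - s) * t ^ (s - 1) := by
    rw [← Real.rpow_add ht0]; congr 1; ring
  rw [e1]; ring

/-- The subordinated kernel, truncated at times below `ε`. -/
noncomputable def jumpKernel {N : ℕ} (s ε : ℝ) (z : EuclideanSpace ℝ (Fin N)) : ENNReal :=
  ∫⁻ τ, jumpDensity s ε τ * ENNReal.ofReal (heatProfile τ z)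

theorem measurable_jumpKernel {N : ℕ} (s ε : ℝ) :
    Measurable (jumpKernel s ε : EuclideanSpace ℝ (Fin N) → ENNReal) := by
  unfold jumpKernel
  refine Measurable.lintegral_prod_right' (f := fun p : EuclideanSpace ℝ (Fin N) × ℝ =>
    jumpDensity s ε p.2 * ENNReal.ofReal (heatProfile p.2 p.1)) ?_
  exact ((measurable_jumpDensity s ε).comp measurable_snd).mul
    (measurable_heatProfile.comp measurable_swap).ennreal_ofReal

theorem lintegral_jumpKernel {N : ℕ} {s ε : ℝ} (hs : 0 < s) (hε : 0 < ε) :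
    ∫⁻ z : EuclideanSpace ℝ (Fin N), jumpKernel s ε z =
      ENNReal.ofReal (ε ^ (-s) / s) * ENNReal.ofReal (Real.pi ^ ((N : ℝ) / 2)) := by
  unfold jumpKernel
  rw [lintegral_lintegral_swap]
  · have : ∀ τ, ∫⁻ z : EuclideanSpace ℝ (Fin N), jumpDensity s ε τ * ENNReal.ofReal (heatProfile τ z) =
        jumpDensity s ε τ * ENNReal.ofReal (Real.pi ^ ((N : ℝ) / 2)) := by
      intro τ
      rcases le_or_gt τ ε with h | h
      · have h0 : jumpDensity s ε τ = 0 := by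
          unfold jumpDensity
          exact Set.indicator_of_notMem (by simpa using h) _
        simp [h0]
      · rw [lintegral_const_mul, lintegral_heatProfile (hε.trans h)]
        exact (measurable_heatProfile.comp (measurable_const.prodMk measurable_id)).ennreal_ofReal
    simp_rw [this]
    rw [lintegral_mul_const _ (measurable_jumpDensity s ε)]
    unfold jumpDensity
    rw [lintegral_indicator measurableSet_Ioi, lintegral_rpow_Ioi hs hε]
  · exact (((measurable_jumpDensity s ε).comp measurable_snd).mul
      (measurable_heatProfile.comp measurable_swap).ennreal_ofReal).aemeasurable

/-- Expanding both factors into Gaussians, Tonelli and the semigroup law turn the convolution in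
space into one in the time variable, where the density inequality applies. The right side is
`ψ_β(x)` times the total mass of the kernel. -/
theorem lintegral_weightPsi_mul_jumpKernel_le {N : ℕ} {s β ε : ℝ} (hs : 0 < s) (hβ0 : 0 < β)
    (hβ : β ≤ (N : ℝ) - 2 * s) (hε : 0 < ε) (x : EuclideanSpace ℝ (Fin N)) :
    ∫⁻ z, ENNReal.ofReal (weightPsi β (x + z)) * jumpKernel s ε z ≤
      ENNReal.ofReal (weightPsi β x) *
        (ENNReal.ofReal (ε ^ (-s) / s) * ENNReal.ofReal (Real.pi ^ ((N : ℝ) / 2))) := by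
  set k := jumpDensity s ε with hk
  set g := mixingDensity N β with hg
  set G : ℝ → EuclideanSpace ℝ (Fin N) → ENNReal := fun t x => ENNReal.ofReal (heatProfile t x) with hG
  set P := ENNReal.ofReal (Real.pi ^ ((N : ℝ) / 2)) with hP
  set c := ENNReal.ofReal (ε ^ (-s) / s) with hc
  set Γ := ENNReal.ofReal (Real.Gamma (β / 2)) with hΓ
  have hΓ0 : Γ ≠ 0 := by
    have := Real.Gamma_pos_of_pos (half_pos hβ0)
    simpa [hΓ] using this
  have hΓt : Γ ≠ ⊤ := ENNReal.ofReal_ne_top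
  have mk : Measurable k := measurable_jumpDensity s ε
  have mg : Measurable g := measurable_mixingDensity N β
  have mG : Measurable fun p : ℝ × EuclideanSpace ℝ (Fin N) => G p.1 p.2 :=
    measurable_heatProfile.ennreal_ofReal
  have mG1 : ∀ y, Measurable fun t => G t y := fun y =>
    mG.comp (measurable_id.prodMk measurable_const)
  have hψ : ∀ y, ∫⁻ t, g t * G t y = Γ * ENNReal.ofReal (weightPsi β y) :=
    fun y => lintegral_mixingDensity hβ0 y
  have hconv : ∀ t τ, k τ * g t * (∫⁻ z, G τ z * G t (x + z)) = k τ * g t * (P * G (t + τ) x) := by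
    intro t τ
    rcases le_or_gt τ ε with h | h
    · have h0 : k τ = 0 := Set.indicator_of_notMem (by simpa using h) _
      simp [h0]
    rcases le_or_gt t 0 with h' | h'
    · have h0 : g t = 0 := Set.indicator_of_notMem (by simpa using h') _
      simp [h0]
    congr 1
    exact lintegral_heatProfile_mul h' (hε.trans h) x
  have step : Γ * (∫⁻ z, ENNReal.ofReal (weightPsi β (x + z)) * jumpKernel s ε z) ≤
      Γ * (ENNReal.ofReal (weightPsi β x) * (c * P)) := by
    have mtri : Measurable fun p : (EuclideanSpace ℝ (Fin N) × ℝ) × ℝ =>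
        k p.1.2 * g p.2 * (G p.1.2 p.1.1 * G p.2 (x + p.1.1)) := by
      have m1 := mG.comp (f := fun p : (EuclideanSpace ℝ (Fin N) × ℝ) × ℝ => (p.1.2, p.1.1))
        (by fun_prop)
      have m2 := mG.comp (f := fun p : (EuclideanSpace ℝ (Fin N) × ℝ) × ℝ => (p.2, x + p.1.1))
        (by fun_prop)
      exact ((mk.comp (by fun_prop)).mul (mg.comp (by fun_prop))).mul (m1.mul m2)
    calc Γ * (∫⁻ z, ENNReal.ofReal (weightPsi β (x + z)) * jumpKernel s ε z)
        = ∫⁻ z, ∫⁻ τ, ∫⁻ t, k τ * g t * (G τ z * G t (x + z)) := by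
          rw [← lintegral_const_mul' _ _ hΓt]
          refine lintegral_congr fun z => ?_
          rw [← mul_assoc, ← hψ (x + z)]
          unfold jumpKernel
          rw [← lintegral_const_mul]
          · refine lintegral_congr fun τ => ?_
            rw [mul_comm, ← lintegral_const_mul]
            · refine lintegral_congr fun t => ?_
              simp only [hk, hG]; ring
            · exact mg.mul (mG1 _)
          · exact mk.mul (mG1 z)
      _ = ∫⁻ τ, ∫⁻ z, ∫⁻ t, k τ * g t * (G τ z * G t (x + z)) := by
          rw [lintegral_lintegral_swap]
          exact (Measurable.lintegral_prod_right' mtri).aemeasurable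
      _ = ∫⁻ τ, ∫⁻ t, k τ * g t * (P * G (t + τ) x) := by
          refine lintegral_congr fun τ => ?_
          rw [lintegral_lintegral_swap]
          · refine lintegral_congr fun t => ?_
            rw [← hconv, lintegral_const_mul]
            exact (mG.comp (f := fun z => (τ, z)) (by fun_prop)).mul
              (mG.comp (f := fun z => (t, x + z)) (by fun_prop))
          · exact (mtri.comp (g := fun p : (EuclideanSpace ℝ (Fin N) × ℝ) × ℝ =>
              k p.1.2 * g p.2 * (G p.1.2 p.1.1 * G p.2 (x + p.1.1)))
              (f := fun p : EuclideanSpace ℝ (Fin N) × ℝ => ((p.1, τ), p.2)) (by fun_prop)).aemeasurable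
      -- Extending the mixing density by zero to the whole line makes the substitution `t ↦ t - τ` a
      -- plain translation.
      _ = ∫⁻ τ, ∫⁻ t, P * G t x * (k τ * g (t - τ)) := by
          refine lintegral_congr fun τ => ?_
          rw [← lintegral_sub_right_eq_self (fun t => k τ * g t * (P * G (t + τ) x)) τ]
          refine lintegral_congr fun t => ?_
          rw [sub_add_cancel]; ring
      _ = ∫⁻ t, ∫⁻ τ, P * G t x * (k τ * g (t - τ)) := by
          rw [lintegral_lintegral_swap]
          refine Measurable.aemeasurable ?_
          refine Measurable.mul (measurable_const.mul ((mG1 x).comp measurable_snd)) ?_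
          exact (mk.comp measurable_fst).mul (mg.comp (measurable_snd.sub measurable_fst))
      _ ≤ ∫⁻ t, P * G t x * (c * g t) := by
          refine lintegral_mono fun t => ?_
          rw [lintegral_const_mul]
          · exact mul_le_mul_right (lintegral_jumpDensity_mul_mixingDensity_le hs hβ hε t) _
          · exact mk.mul (mg.comp (measurable_const.sub measurable_id))
      _ = c * P * ∫⁻ t, g t * G t x := by
          have hm : Measurable fun t => g t * G t x := mg.mul (mG1 x)
          rw [← lintegral_const_mul _ hm]
          refine lintegral_congr fun t => ?_
          ring
      _ = _ := by rw [hψ]; ring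
  exact (ENNReal.mul_le_mul_iff_right hΓ0 hΓt).1 step

/-- Real-valued version of the truncated subordinated kernel. -/
noncomputable def jumpKernelReal {N : ℕ} (s ε : ℝ) (z : EuclideanSpace ℝ (Fin N)) : ℝ :=
  (jumpKernel s ε z).toReal

theorem rpow_mul_heatProfile {N : ℕ} (s : ℝ) {τ : ℝ} (hτ : 0 < τ) (z : EuclideanSpace ℝ (Fin N)) :
    τ ^ (-1 - s) * heatProfile τ z =
      τ ^ (-(((N : ℝ) + 2 * s) / 2) - 1) * Real.exp (-‖z‖ ^ 2 / τ) := by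
  unfold heatProfile
  rw [← mul_assoc, ← Real.rpow_add hτ]
  congr 2; ring

theorem jumpKernelReal_eq {N : ℕ} {s ε : ℝ} (hs : 0 < s) (hε : 0 < ε) {z : EuclideanSpace ℝ (Fin N)}
    (hz : z ≠ 0) :
    IntegrableOn (fun τ => τ ^ (-(((N : ℝ) + 2 * s) / 2) - 1) * Real.exp (-‖z‖ ^ 2 / τ)) (Set.Ioi 0) ∧
    ENNReal.ofReal (jumpKernelReal s ε z) = jumpKernel s ε z ∧
    jumpKernelReal s ε z = ∫ τ in Set.Ioi ε,
      τ ^ (-(((N : ℝ) + 2 * s) / 2) - 1) * Real.exp (-‖z‖ ^ 2 / τ) := by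
  have hz0 : 0 < ‖z‖ := norm_pos_iff.2 hz
  have hinteg := integrableOn_rpow_mul_exp_neg_div (a := ((N : ℝ) + 2 * s) / 2) (b := ‖z‖ ^ 2)
    (by positivity) (by positivity)
  have hnn : ∀ᵐ τ ∂(volume.restrict (Set.Ioi ε)),
      0 ≤ τ ^ (-(((N : ℝ) + 2 * s) / 2) - 1) * Real.exp (-‖z‖ ^ 2 / τ) := by
    refine (ae_restrict_iff' measurableSet_Ioi).2 (Eventually.of_forall fun τ hτ => ?_)
    have : 0 < τ := hε.trans hτ
    positivity
  have h1 : jumpKernel s ε z = ENNReal.ofReal (∫ τ in Set.Ioi ε,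
      τ ^ (-(((N : ℝ) + 2 * s) / 2) - 1) * Real.exp (-‖z‖ ^ 2 / τ)) := by
    rw [ofReal_integral_eq_lintegral_ofReal (hinteg.mono_set (Set.Ioi_subset_Ioi hε.le)) hnn,
      ← lintegral_indicator measurableSet_Ioi]
    unfold jumpKernel
    refine lintegral_congr fun τ => ?_
    unfold jumpDensity
    by_cases hτ : τ ∈ Set.Ioi ε
    · have hτ0 : 0 < τ := hε.trans hτ
      rw [Set.indicator_of_mem hτ, Set.indicator_of_mem hτ, ← ENNReal.ofReal_mul (by positivity),
        rpow_mul_heatProfile s hτ0]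
    · rw [Set.indicator_of_notMem hτ, Set.indicator_of_notMem hτ, zero_mul]
  refine ⟨hinteg, ?_, ?_⟩
  · unfold jumpKernelReal
    rw [ENNReal.ofReal_toReal]
    rw [h1]; exact ENNReal.ofReal_ne_top
  · unfold jumpKernelReal
    rw [h1, ENNReal.toReal_ofReal (integral_nonneg_of_ae hnn)]

theorem jumpKernelReal_nonneg {N : ℕ} (s ε : ℝ) (z : EuclideanSpace ℝ (Fin N)) :
    0 ≤ jumpKernelReal s ε z := ENNReal.toReal_nonneg

theorem jumpKernelReal_neg {N : ℕ} (s ε : ℝ) (z : EuclideanSpace ℝ (Fin N)) :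
    jumpKernelReal s ε (-z) = jumpKernelReal s ε z := by
  simp only [jumpKernelReal, jumpKernel, heatProfile, norm_neg]

theorem gamma_mul_norm_rpow {N : ℕ} {s : ℝ} (hs : 0 < s) {z : EuclideanSpace ℝ (Fin N)} (hz : z ≠ 0) :
    ∫ τ in Set.Ioi (0 : ℝ), τ ^ (-(((N : ℝ) + 2 * s) / 2) - 1) * Real.exp (-‖z‖ ^ 2 / τ) =
      Real.Gamma (((N : ℝ) + 2 * s) / 2) * ‖z‖ ^ (-((N : ℝ) + 2 * s)) := by
  have hz0 : 0 < ‖z‖ := norm_pos_iff.2 hz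
  rw [integral_rpow_mul_exp_neg_div (by positivity) (by positivity), ← Real.rpow_natCast,
    ← Real.rpow_mul hz0.le]
  congr 2; push_cast; ring

theorem jumpKernelReal_le {N : ℕ} {s ε : ℝ} (hs : 0 < s) (hε : 0 < ε) {z : EuclideanSpace ℝ (Fin N)}
    (hz : z ≠ 0) :
    jumpKernelReal s ε z ≤ Real.Gamma (((N : ℝ) + 2 * s) / 2) * ‖z‖ ^ (-((N : ℝ) + 2 * s)) := by
  obtain ⟨hinteg, _, h⟩ := jumpKernelReal_eq hs hε hz
  rw [h, ← gamma_mul_norm_rpow hs hz]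
  refine setIntegral_mono_set hinteg ?_ (Set.Ioi_subset_Ioi hε.le).eventuallyLE
  refine (ae_restrict_iff' measurableSet_Ioi).2 (Eventually.of_forall fun τ hτ => ?_)
  have : 0 < τ := hτ
  simp only [Pi.zero_apply]
  positivity

theorem tendsto_jumpKernelReal {N : ℕ} {s : ℝ} (hs : 0 < s) {z : EuclideanSpace ℝ (Fin N)}
    (hz : z ≠ 0) :
    Tendsto (fun n : ℕ => jumpKernelReal s (1 / ((n : ℝ) + 1)) z) atTop
      (𝓝 (Real.Gamma (((N : ℝ) + 2 * s) / 2) * ‖z‖ ^ (-((N : ℝ) + 2 * s)))) := by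
  have hε : ∀ n : ℕ, 0 < 1 / ((n : ℝ) + 1) := fun n => by positivity
  have hU : ⋃ n : ℕ, Set.Ioi (1 / ((n : ℝ) + 1)) = Set.Ioi (0 : ℝ) := by
    ext t
    simp only [Set.mem_iUnion, Set.mem_Ioi]
    exact ⟨fun ⟨n, hn⟩ => (hε n).trans hn, fun ht => exists_nat_one_div_lt ht⟩
  have hinteg := (jumpKernelReal_eq hs one_pos hz).1
  rw [← gamma_mul_norm_rpow hs hz, ← hU]
  rw [← hU] at hinteg
  refine (tendsto_setIntegral_of_monotone (fun _ => measurableSet_Ioi) ?_ hinteg).congr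
    fun n => ((jumpKernelReal_eq hs (hε n) hz).2.2).symm
  intro m n hmn
  refine Set.Ioi_subset_Ioi ?_
  exact one_div_le_one_div_of_le (by positivity) (by exact_mod_cast Nat.add_le_add_right hmn 1)

/-- With finite total mass `m` and an even kernel `J`, the integral splits as `2 (∫ ψ_β(x+z) J(z) dz
- m ψ_β(x))`; without the truncation at `ε` these pieces would diverge separately. -/
theorem integral_secondDiff_mul_jumpKernelReal_nonpos {N : ℕ} (hN : 1 ≤ N) {s β ε : ℝ} (hs : 0 < s)
    (hβ0 : 0 < β) (hβ : β ≤ (N : ℝ) - 2 * s) (hε : 0 < ε) (x : EuclideanSpace ℝ (Fin N)) :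
    ∫ z, secondDiff (weightPsi β) x z * jumpKernelReal s ε z ≤ 0 := by
  have : Nonempty (Fin N) := ⟨⟨0, hN⟩⟩
  have hne : ∀ᵐ z : EuclideanSpace ℝ (Fin N), z ≠ 0 := Measure.ae_ne volume 0
  set J : EuclideanSpace ℝ (Fin N) → ℝ := jumpKernelReal s ε with hJ
  set m := ε ^ (-s) / s * Real.pi ^ ((N : ℝ) / 2) with hm
  have hm0 : 0 ≤ m := by positivity
  have hJ0 : ∀ z, 0 ≤ J z := jumpKernelReal_nonneg s ε
  have hJm : Measurable J := (measurable_jumpKernel s ε).ennreal_toReal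
  have hJl : ∫⁻ z, ENNReal.ofReal (J z) = ENNReal.ofReal m := by
    rw [hm, ENNReal.ofReal_mul (by positivity), ← lintegral_jumpKernel hs hε]
    refine lintegral_congr_ae ?_
    filter_upwards [hne] with z hz using (jumpKernelReal_eq hs hε hz).2.1
  have hJi : Integrable J := by
    refine ⟨hJm.aestronglyMeasurable, ?_⟩
    rw [hasFiniteIntegral_iff_ofReal (Eventually.of_forall hJ0), hJl]
    exact ENNReal.ofReal_lt_top
  have hJI : ∫ z, J z = m := by
    rw [integral_eq_lintegral_of_nonneg_ae (Eventually.of_forall hJ0) hJm.aestronglyMeasurable, hJl,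
      ENNReal.toReal_ofReal hm0]
  have hFm : Measurable fun z => weightPsi β (x + z) * J z :=
    ((continuous_weightPsi β).comp (continuous_const.add continuous_id)).measurable.mul hJm
  have hF0 : ∀ z, 0 ≤ weightPsi β (x + z) * J z := fun z =>
    mul_nonneg (weightPsi_pos β _).le (hJ0 z)
  have hFl : ∫⁻ z, ENNReal.ofReal (weightPsi β (x + z) * J z) ≤ ENNReal.ofReal (weightPsi β x * m) := by
    rw [ENNReal.ofReal_mul (weightPsi_pos β x).le, hm, ENNReal.ofReal_mul (by positivity)]
    refine le_trans (le_of_eq ?_) (lintegral_weightPsi_mul_jumpKernel_le hs hβ0 hβ hε x)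
    refine lintegral_congr_ae ?_
    filter_upwards [hne] with z hz
    rw [ENNReal.ofReal_mul (weightPsi_pos β _).le, hJ, (jumpKernelReal_eq hs hε hz).2.1]
  have hFi : Integrable fun z => weightPsi β (x + z) * J z := by
    refine ⟨hFm.aestronglyMeasurable, ?_⟩
    rw [hasFiniteIntegral_iff_ofReal (Eventually.of_forall hF0)]
    exact hFl.trans_lt ENNReal.ofReal_lt_top
  have hFI : ∫ z, weightPsi β (x + z) * J z ≤ weightPsi β x * m := by
    rw [integral_eq_lintegral_of_nonneg_ae (Eventually.of_forall hF0) hFm.aestronglyMeasurable]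
    exact ENNReal.toReal_le_of_le_ofReal (mul_nonneg (weightPsi_pos β x).le hm0) hFl
  have hneg : ∀ z, weightPsi β (x - z) * J z = (fun z => weightPsi β (x + z) * J z) (-z) := fun z => by
    simp only [hJ, jumpKernelReal_neg, sub_eq_add_neg]
  have hFi' : Integrable fun z => weightPsi β (x - z) * J z :=
    hFi.comp_neg.congr (Eventually.of_forall fun z => (hneg z).symm)
  have hFI' : ∫ z, weightPsi β (x - z) * J z = ∫ z, weightPsi β (x + z) * J z := by
    simp_rw [hneg]
    exact integral_neg_eq_self (fun z => weightPsi β (x + z) * J z) volume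
  have hsplit : ∫ z, secondDiff (weightPsi β) x z * J z =
      (∫ z, weightPsi β (x + z) * J z) + (∫ z, weightPsi β (x - z) * J z) -
        2 * weightPsi β x * ∫ z, J z := by
    rw [← integral_const_mul, ← integral_add hFi hFi', ← integral_sub]
    · refine integral_congr_ae (Eventually.of_forall fun z => ?_)
      simp only [secondDiff]; ring
    · exact hFi.add hFi'
    · exact hJi.const_mul _
  rw [hsplit, hFI', hJI]
  linarith

/-- For `0 < β ≤ N - 2s` the weight `ψ_β` is `s`-superharmonic. -/
theorem integral_secondDiff_weightPsi_nonpos {N : ℕ} (hN : 1 ≤ N) {s β : ℝ} (hs : 0 < s)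
    (hs1 : s < 1) (hβ0 : 0 < β) (hβ : β ≤ (N : ℝ) - 2 * s) (x : EuclideanSpace ℝ (Fin N)) :
    ∫ z, secondDiff (weightPsi β) x z * ‖z‖ ^ (-((N : ℝ) + 2 * s)) ≤ 0 := by
  have : Nonempty (Fin N) := ⟨⟨0, hN⟩⟩
  have hne : ∀ᵐ z : EuclideanSpace ℝ (Fin N), z ≠ 0 := Measure.ae_ne volume 0
  obtain ⟨C, hC, -, -, hmaj⟩ := exists_abs_secondDiff_cutoffWeight_mul_le N s β
  obtain ⟨D, hD⟩ := exists_integral_diffMajorant_le hN hs hs1 (β := β) (γ := 2 * s)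
    (Or.inl ⟨by linarith, by linarith, rfl⟩) C hC.le
  set Γ := Real.Gamma (((N : ℝ) + 2 * s) / 2) with hΓ
  have hΓ0 : 0 < Γ := Real.Gamma_pos_of_pos (by positivity)
  have hε : ∀ n : ℕ, 0 < 1 / ((n : ℝ) + 1) := fun n => by positivity
  have hcont : Continuous fun z => secondDiff (weightPsi β) x z := by
    unfold secondDiff
    have h := continuous_weightPsi (N := N) β
    exact ((h.comp (continuous_const.add continuous_id)).add
      (h.comp (continuous_const.sub continuous_id))).sub continuous_const
  have hlim := tendsto_integral_of_dominated_convergence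
    (F := fun (n : ℕ) z => secondDiff (weightPsi β) x z * jumpKernelReal s (1 / ((n : ℝ) + 1)) z)
    (f := fun z => secondDiff (weightPsi β) x z * (Γ * ‖z‖ ^ (-((N : ℝ) + 2 * s))))
    (μ := volume)
    (fun z => Γ * diffMajorant s β C x z)
    (fun n => (hcont.measurable.mul
      (measurable_jumpKernel s _).ennreal_toReal).aestronglyMeasurable)
    ((hD x).1.const_mul Γ)
    (fun n => by
      filter_upwards [hne] with z hz
      have h1 := jumpKernelReal_le hs (hε n) hz
      have h2 := hmaj x z
      rw [abs_mul, abs_of_nonneg (show 0 ≤ ‖z‖ ^ (-((N : ℝ) + 2 * s)) by positivity)] at h2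
      rw [Real.norm_eq_abs, abs_mul, abs_of_nonneg (jumpKernelReal_nonneg _ _ _)]
      calc _ ≤ |secondDiff (weightPsi β) x z| * (Γ * ‖z‖ ^ (-((N : ℝ) + 2 * s))) := by gcongr
        _ = Γ * (|secondDiff (weightPsi β) x z| * ‖z‖ ^ (-((N : ℝ) + 2 * s))) := by ring
        _ ≤ _ := by gcongr)
    (by
      filter_upwards [hne] with z hz
      exact (tendsto_jumpKernelReal hs hz).const_mul _)
  have hle := le_of_tendsto hlim (Eventually.of_forall fun n =>
    integral_secondDiff_mul_jumpKernelReal_nonpos hN hs hβ0 hβ (hε n) x)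
  have heq : ∫ z, secondDiff (weightPsi β) x z * (Γ * ‖z‖ ^ (-((N : ℝ) + 2 * s))) =
      Γ * ∫ z, secondDiff (weightPsi β) x z * ‖z‖ ^ (-((N : ℝ) + 2 * s)) := by
    rw [← integral_const_mul]
    congr 1; ext z; ring
  rw [heq] at hle
  exact nonpos_of_mul_nonpos_right hle hΓ0

/-! ### The truncated singular integral and the discrete Laplacian: bounds and symmetry. -/

/-- The kernel `|z|^(-N-2s)` truncated at `|z| ≥ ε`. -/
noncomputable def truncKernel {N : ℕ} (s ε : ℝ) : EuclideanSpace ℝ (Fin N) → ℝ :=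
  {z | ε ≤ ‖z‖}.indicator fun z => ‖z‖ ^ (-((N : ℝ) + 2 * s))

/-- The truncated singular integral without its normalization constant. -/
noncomputable def truncOperator {N : ℕ} (s ε : ℝ) (f : EuclideanSpace ℝ (Fin N) → ℝ)
    (x : EuclideanSpace ℝ (Fin N)) : ℝ :=
  ∫ y, (f x - f y) * truncKernel s ε (x - y)

theorem fracLaplacianTrunc_eq {N : ℕ} (s ε : ℝ) (f : EuclideanSpace ℝ (Fin N) → ℝ)
    (x : EuclideanSpace ℝ (Fin N)) :
    fracLaplacianTrunc s f x ε = fracLaplacianConst N s * truncOperator s ε f x := by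
  unfold fracLaplacianTrunc truncOperator
  rw [← integral_indicator (measurableSet_le measurable_const (by fun_prop))]
  congr 2
  ext y
  unfold truncKernel
  by_cases hy : ε ≤ ‖x - y‖
  · rw [Set.indicator_of_mem (by simpa using hy), Set.indicator_of_mem (by simpa using hy),
      Real.rpow_neg (norm_nonneg _), div_eq_mul_inv]
  · rw [Set.indicator_of_notMem (by simpa using hy), Set.indicator_of_notMem (by simpa using hy),
      mul_zero]

theorem fracLaplacianConst_pos {N : ℕ} {s : ℝ} (hs : 0 < s) (hs1 : s < 1) :
    0 < fracLaplacianConst N s := by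
  unfold fracLaplacianConst
  have h1 : 0 < Real.Gamma (((N : ℝ) + 2 * s) / 2) := Real.Gamma_pos_of_pos (by positivity)
  have h2 : 0 < Real.Gamma (1 - s) := Real.Gamma_pos_of_pos (by linarith)
  positivity

theorem truncKernel_nonneg {N : ℕ} (s ε : ℝ) (z : EuclideanSpace ℝ (Fin N)) :
    0 ≤ truncKernel s ε z := Set.indicator_nonneg (fun _ _ => by positivity) z

theorem truncKernel_neg {N : ℕ} (s ε : ℝ) (z : EuclideanSpace ℝ (Fin N)) :
    truncKernel s ε (-z) = truncKernel s ε z := by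
  unfold truncKernel
  by_cases hz : ε ≤ ‖z‖
  · rw [Set.indicator_of_mem (by simpa using hz), Set.indicator_of_mem (by simpa using hz), norm_neg]
  · rw [Set.indicator_of_notMem (by simpa using hz), Set.indicator_of_notMem (by simpa using hz)]

theorem measurable_truncKernel {N : ℕ} (s ε : ℝ) :
    Measurable (truncKernel s ε : EuclideanSpace ℝ (Fin N) → ℝ) :=
  (measurable_norm.pow_const _).indicator (measurableSet_le_norm ε)

theorem integrable_truncKernel {N : ℕ} {s ε : ℝ} (hs : 0 < s) (hε : 0 < ε) :
    Integrable (truncKernel s ε : EuclideanSpace ℝ (Fin N) → ℝ) := by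
  unfold truncKernel
  rw [integrable_indicator_iff (measurableSet_le_norm ε)]
  exact integrableOn_norm_rpow_far (by linarith) hε

/-- Off the diagonal the kernel is controlled by the weight of `𝓛^s`, locally uniformly. -/
theorem exists_truncKernel_sub_le {N : ℕ} {s ε R : ℝ} (hs : 0 < s) (hε : 0 < ε) (hR : 0 ≤ R) :
    ∃ M, 0 ≤ M ∧ ∀ x y : EuclideanSpace ℝ (Fin N), ‖x‖ ≤ R →
      truncKernel s ε (x - y) ≤ M * (1 + ‖y‖ ^ ((N : ℝ) + 2 * s))⁻¹ := by
  set q := (N : ℝ) + 2 * s with hq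
  have hq0 : 0 < q := by positivity
  refine ⟨(1 + R / ε) ^ q + (ε⁻¹) ^ q, by positivity, fun x y hx => ?_⟩
  unfold truncKernel
  by_cases hy : ε ≤ ‖x - y‖
  · rw [Set.indicator_of_mem (by simpa using hy)]
    have h0 : 0 < ‖x - y‖ := hε.trans_le hy
    have h1 : ‖y‖ ≤ (1 + R / ε) * ‖x - y‖ := by
      have h2 : ‖y‖ ≤ ‖x - y‖ + ‖x‖ := by
        calc ‖y‖ = ‖x - (x - y)‖ := by simp
          _ ≤ ‖x‖ + ‖x - y‖ := norm_sub_le _ _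
          _ = _ := add_comm _ _
      have h3 : R ≤ R / ε * ‖x - y‖ := by
        calc R = R / ε * ε := by field_simp
          _ ≤ _ := by gcongr
      linarith
    have h4 : ‖y‖ ^ q ≤ (1 + R / ε) ^ q * ‖x - y‖ ^ q := by
      rw [← Real.mul_rpow (by positivity) h0.le]
      exact Real.rpow_le_rpow (norm_nonneg _) h1 hq0.le
    have h5 : 1 ≤ (ε⁻¹) ^ q * ‖x - y‖ ^ q := by
      rw [← Real.mul_rpow (by positivity) h0.le]
      refine Real.one_le_rpow ?_ hq0.le
      rw [inv_mul_eq_div, one_le_div hε]; exact hy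
    rw [Real.rpow_neg h0.le, ← div_eq_mul_inv, inv_eq_one_div,
      div_le_div_iff₀ (by positivity) (by positivity)]
    nlinarith
  · rw [Set.indicator_of_notMem (by simpa using hy)]
    positivity

theorem integrable_inv_one_add_norm_rpow {N : ℕ} {s : ℝ} (hs : 0 < s) :
    Integrable fun y : EuclideanSpace ℝ (Fin N) => (1 + ‖y‖ ^ ((N : ℝ) + 2 * s))⁻¹ := by
  set q := (N : ℝ) + 2 * s with hq
  have hq0 : 0 < q := by positivity
  have h1 : Integrable (fun z : EuclideanSpace ℝ (Fin N) => (1 + ‖z‖) ^ (-q)) :=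
    integrable_one_add_norm (by simp [hq, hs])
  refine Integrable.mono' (h1.const_mul (2 ^ q)) ?_ (Eventually.of_forall fun y => ?_)
  · exact ((measurable_norm.pow_const q).const_add 1).inv.aestronglyMeasurable
  · rw [Real.norm_of_nonneg (by positivity), Real.rpow_neg (by positivity), ← div_eq_mul_inv,
      inv_eq_one_div, div_le_div_iff₀ (by positivity) (by positivity), one_mul, mul_add, mul_one,
      ← Real.mul_rpow (by norm_num) (norm_nonneg _)]
    rcases le_total ‖y‖ 1 with h | h
    · have : (1 + ‖y‖) ^ q ≤ 2 ^ q := Real.rpow_le_rpow (by positivity) (by linarith) hq0.le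
      have : 0 ≤ (2 * ‖y‖) ^ q := by positivity
      linarith
    · have : (1 + ‖y‖) ^ q ≤ (2 * ‖y‖) ^ q := Real.rpow_le_rpow (by positivity) (by linarith) hq0.le
      have : (0 : ℝ) ≤ 2 ^ q := by positivity
      linarith

theorem MemLs.of_hasCompactSupport {N : ℕ} {s : ℝ} {f : EuclideanSpace ℝ (Fin N) → ℝ}
    (hf : Continuous f) (hc : HasCompactSupport f) : MemLs s f := by
  have h1 : Integrable f := hf.integrable_of_hasCompactSupport hc
  refine Integrable.mono' h1.abs ?_ (Eventually.of_forall fun x => ?_)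
  · exact (hf.measurable.abs.div
      ((measurable_norm.pow_const _).const_add 1)).aestronglyMeasurable
  · rw [Real.norm_of_nonneg (by positivity)]
    refine div_le_self (abs_nonneg _) ?_
    have : 0 ≤ ‖x‖ ^ ((N : ℝ) + 2 * s) := by positivity
    linarith

theorem MemLs.integrable_mul_truncKernel {N : ℕ} {s ε : ℝ} {f : EuclideanSpace ℝ (Fin N) → ℝ}
    (hm : MemLs s f) (hs : 0 < s) (hε : 0 < ε) (hf : Continuous f) (x : EuclideanSpace ℝ (Fin N)) :
    Integrable fun y => f y * truncKernel s ε (x - y) := by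
  obtain ⟨M, hM, h⟩ := exists_truncKernel_sub_le (N := N) hs hε (norm_nonneg x)
  refine Integrable.mono' (hm.const_mul M) ?_ (Eventually.of_forall fun y => ?_)
  · exact (hf.measurable.mul ((measurable_truncKernel s ε).comp
      (measurable_const.sub measurable_id))).aestronglyMeasurable
  · rw [Real.norm_eq_abs, abs_mul, abs_of_nonneg (truncKernel_nonneg _ _ _)]
    calc _ ≤ |f y| * (M * (1 + ‖y‖ ^ ((N : ℝ) + 2 * s))⁻¹) := by
          gcongr; exact h x y le_rfl
      _ = _ := by rw [div_eq_mul_inv]; ring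

theorem integrable_truncKernel_sub {N : ℕ} {s ε : ℝ} (hs : 0 < s) (hε : 0 < ε)
    (x : EuclideanSpace ℝ (Fin N)) : Integrable fun y => truncKernel s ε (x - y) :=
  (integrable_truncKernel hs hε).comp_sub_left x

theorem integrable_truncOperator_integrand {N : ℕ} {s ε : ℝ} {f : EuclideanSpace ℝ (Fin N) → ℝ}
    (hm : MemLs s f) (hs : 0 < s) (hε : 0 < ε) (hf : Continuous f) (x : EuclideanSpace ℝ (Fin N)) :
    Integrable fun y => (f x - f y) * truncKernel s ε (x - y) := by
  have := ((integrable_truncKernel_sub hs hε x).const_mul (f x)).sub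
    (hm.integrable_mul_truncKernel hs hε hf x)
  refine this.congr (Eventually.of_forall fun y => ?_)
  simp only [Pi.sub_apply]; ring

theorem truncOperator_eq_sub {N : ℕ} {s ε : ℝ} {f : EuclideanSpace ℝ (Fin N) → ℝ}
    (hm : MemLs s f) (hs : 0 < s) (hε : 0 < ε) (hf : Continuous f) (x : EuclideanSpace ℝ (Fin N)) :
    truncOperator s ε f x = (∫ z : EuclideanSpace ℝ (Fin N), truncKernel s ε z) * f x -
      ∫ y, f y * truncKernel s ε (x - y) := by
  unfold truncOperator
  rw [← integral_sub_left_eq_self (truncKernel s ε) volume x, mul_comm, ← integral_const_mul,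
    ← integral_sub ((integrable_truncKernel_sub hs hε x).const_mul (f x))
      (hm.integrable_mul_truncKernel hs hε hf x)]
  congr 1; ext y; ring

theorem measurable_truncOperator {N : ℕ} {s ε : ℝ} {f : EuclideanSpace ℝ (Fin N) → ℝ}
    (hf : Continuous f) : StronglyMeasurable (truncOperator s ε f) := by
  unfold truncOperator
  refine StronglyMeasurable.integral_prod_right'
    (f := fun p : EuclideanSpace ℝ (Fin N) × EuclideanSpace ℝ (Fin N) =>
      (f p.1 - f p.2) * truncKernel s ε (p.1 - p.2)) ?_
  refine Measurable.stronglyMeasurable ?_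
  exact ((hf.measurable.comp measurable_fst).sub (hf.measurable.comp measurable_snd)).mul
    ((measurable_truncKernel s ε).comp (measurable_fst.sub measurable_snd))

/-- Average the substitutions `y = x + z` and `y = x - z`, using that the kernel is even. The
symmetrized form is the one that stays bounded as `ε → 0`. -/
theorem integrable_secondDiff_mul_truncKernel {N : ℕ} {s ε : ℝ} {f : EuclideanSpace ℝ (Fin N) → ℝ}
    (hm : MemLs s f) (hs : 0 < s) (hε : 0 < ε) (hf : Continuous f) (x : EuclideanSpace ℝ (Fin N)) :
    Integrable (fun z => secondDiff f x z * truncKernel s ε z) ∧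
    truncOperator s ε f x = -(1 / 2) * ∫ z, secondDiff f x z * truncKernel s ε z := by
  set F : EuclideanSpace ℝ (Fin N) → ℝ := fun y => (f x - f y) * truncKernel s ε (x - y) with hF
  have hi : Integrable F := integrable_truncOperator_integrand hm hs hε hf x
  have h1 : Integrable fun z => F (x + z) := hi.comp_add_left x
  have h2 : Integrable fun z => F (x - z) := hi.comp_sub_left x
  have hpt : ∀ z, secondDiff f x z * truncKernel s ε z = -(F (x + z) + F (x - z)) := by
    intro z
    simp only [hF, secondDiff, sub_add_cancel_left, sub_sub_cancel, truncKernel_neg]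
    ring
  refine ⟨((h1.add h2).neg).congr (Eventually.of_forall fun z => (hpt z).symm), ?_⟩
  simp_rw [hpt]
  rw [integral_neg, integral_add h1 h2, integral_add_left_eq_self F x,
    integral_sub_left_eq_self F volume x]
  simp only [truncOperator, hF]
  ring

/-- Compare with truncation at distance `1`, which the `𝓛^s` norm controls. The remaining shell `ε ≤
|z| < 1` is symmetrized, and the second difference supplies `|z|²` against the kernel. -/
theorem exists_abs_truncOperator_le {N : ℕ} (hN : 1 ≤ N) {s : ℝ} {u : EuclideanSpace ℝ (Fin N) → ℝ}
    (hs : 0 < s) (hs1 : s < 1) (hu : ContDiff ℝ 2 u) (hm : MemLs s u) {R : ℝ} (hR : 0 ≤ R) :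
    ∃ B, ∀ ε, 0 < ε → ε ≤ 1 → ∀ x : EuclideanSpace ℝ (Fin N), ‖x‖ ≤ R →
      |truncOperator s ε u x| ≤ B := by
  have huc := hu.continuous
  obtain ⟨B, hB0, hB⟩ := exists_abs_secondDiff_le_of_contDiff hu R
  obtain ⟨M, hM, hK⟩ := exists_truncKernel_sub_le (N := N) hs one_pos hR
  obtain ⟨U, hU⟩ := IsCompact.exists_bound_of_continuousOn (f := u)
    (isCompact_closedBall (0 : EuclideanSpace ℝ (Fin N)) R) huc.continuousOn
  set q := (N : ℝ) + 2 * s with hq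
  have hnear := (integrableOn_ball_norm_rpow hN (e := 2 - q) (by rw [hq]; linarith) 1).const_mul B
  have hω := integrable_inv_one_add_norm_rpow (N := N) hs
  set B1 := ∫ y : EuclideanSpace ℝ (Fin N), (U * M * (1 + ‖y‖ ^ q)⁻¹ + M * (|u y| / (1 + ‖y‖ ^ q)))
    with hB1
  set B2 := ∫ z in Metric.ball (0 : EuclideanSpace ℝ (Fin N)) 1, B * ‖z‖ ^ (2 - q) with hB2
  refine ⟨B1 + 1 / 2 * B2, fun ε hε hε1 x hx => ?_⟩
  have hUx : |u x| ≤ U := hU x (by simpa using hx)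
  have hone : |truncOperator s 1 u x| ≤ B1 := by
    unfold truncOperator
    rw [← Real.norm_eq_abs]
    refine norm_integral_le_of_norm_le ((hω.const_mul (U * M)).add (hm.const_mul M))
      (Eventually.of_forall fun y => ?_)
    rw [Real.norm_eq_abs, abs_mul, abs_of_nonneg (truncKernel_nonneg _ _ _)]
    calc |u x - u y| * truncKernel s 1 (x - y) ≤ (U + |u y|) * (M * (1 + ‖y‖ ^ q)⁻¹) := by
          have h1 : |u x - u y| ≤ U + |u y| := (abs_sub _ _).trans (by linarith)
          have h2 := hK x y hx
          have h3 := truncKernel_nonneg s 1 (x - y)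
          have h4 : 0 ≤ U + |u y| := (abs_nonneg _).trans h1
          gcongr
      _ = _ := by simp only [div_eq_mul_inv]; ring
  obtain ⟨i1, e1⟩ := integrable_secondDiff_mul_truncKernel hm hs hε huc x
  obtain ⟨i2, e2⟩ := integrable_secondDiff_mul_truncKernel hm hs one_pos huc x
  have hdiff : |∫ z, (secondDiff u x z * truncKernel s ε z - secondDiff u x z * truncKernel s 1 z)| ≤
      B2 := by
    rw [← Real.norm_eq_abs, hB2, ← integral_indicator measurableSet_ball]
    refine norm_integral_le_of_norm_le ((integrable_indicator_iff measurableSet_ball).2 hnear)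
      (Eventually.of_forall fun z => ?_)
    rw [Real.norm_eq_abs, ← mul_sub]
    unfold truncKernel
    rcases lt_or_ge ‖z‖ 1 with hz | hz
    · rw [Set.indicator_of_mem (s := Metric.ball 0 1) (by simpa using hz),
        Set.indicator_of_notMem (s := {z | 1 ≤ ‖z‖}) (by simpa using hz), sub_zero]
      by_cases hz2 : ε ≤ ‖z‖
      · have hz0 : 0 < ‖z‖ := hε.trans_le hz2
        rw [Set.indicator_of_mem (by simpa using hz2), abs_mul,
          abs_of_nonneg (show 0 ≤ ‖z‖ ^ (-q) by positivity)]
        calc _ ≤ B * ‖z‖ ^ 2 * ‖z‖ ^ (-q) := by gcongr; exact hB x z hx hz.le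
          _ = _ := by
            rw [mul_assoc, ← Real.rpow_natCast, ← Real.rpow_add hz0]
            congr 2
      · rw [Set.indicator_of_notMem (by simpa using hz2), mul_zero, abs_zero]
        positivity
    · rw [Set.indicator_of_mem (s := {z | ε ≤ ‖z‖}) (by simp; linarith),
        Set.indicator_of_mem (s := {z | 1 ≤ ‖z‖}) (by simpa using hz), sub_self, mul_zero, abs_zero]
      exact Set.indicator_nonneg (fun _ _ => by positivity) z
  rw [integral_sub i1 i2] at hdiff
  have : truncOperator s ε u x = truncOperator s 1 u x - 1 / 2 *
      ((∫ z, secondDiff u x z * truncKernel s ε z) - ∫ z, secondDiff u x z * truncKernel s 1 z) := by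
    rw [e1, e2]; ring
  rw [this]
  refine (abs_sub _ _).trans (add_le_add hone ?_)
  rw [abs_mul, abs_of_pos (by norm_num : (0 : ℝ) < 1 / 2)]
  gcongr

/-- Fubini with a symmetric kernel. Compact support of `φ` keeps `x` bounded, so the kernel is
dominated by a multiple of the `𝓛^s` weight in `y`. -/
theorem integral_mul_truncOperator_comm {N : ℕ} {s ε : ℝ} (hs : 0 < s) (hε : 0 < ε)
    {φ w : EuclideanSpace ℝ (Fin N) → ℝ} (hφ : Continuous φ) (hφc : HasCompactSupport φ)
    (hw : Continuous w) (hwm : MemLs s w) :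
    Integrable (fun x => φ x * truncOperator s ε w x) ∧
    Integrable (fun x => w x * truncOperator s ε φ x) ∧
    ∫ x, φ x * truncOperator s ε w x = ∫ x, w x * truncOperator s ε φ x := by
  obtain ⟨R, hR0, hR⟩ : ∃ R, 0 ≤ R ∧ ∀ x, R < ‖x‖ → φ x = 0 := by
    obtain ⟨R, hR⟩ := hφc.isCompact.isBounded.subset_closedBall 0
    refine ⟨max R 0, le_max_right _ _, fun x hx => ?_⟩
    by_contra hne
    have := hR (subset_tsupport φ hne)
    rw [mem_closedBall_zero_iff] at this
    exact absurd (this.trans (le_max_left _ _)) (not_le.2 hx)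
  obtain ⟨M, hM, hK⟩ := exists_truncKernel_sub_le (N := N) hs hε hR0
  have hφm : MemLs s φ := MemLs.of_hasCompactSupport hφ hφc
  have hφi : Integrable φ := hφ.integrable_of_hasCompactSupport hφc
  set κ := ∫ z : EuclideanSpace ℝ (Fin N), truncKernel s ε z with hκ
  set G : EuclideanSpace ℝ (Fin N) → EuclideanSpace ℝ (Fin N) → ℝ :=
    fun x y => φ x * (w y * truncKernel s ε (x - y)) with hG
  have hGi : Integrable (Function.uncurry G)
      ((volume : Measure (EuclideanSpace ℝ (Fin N))).prod volume) := by
    have hdom := hφi.abs.mul_prod (hwm.const_mul M)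
    refine Integrable.mono' hdom ?_ (Eventually.of_forall fun p => ?_)
    · refine Measurable.aestronglyMeasurable ?_
      exact (hφ.measurable.comp measurable_fst).mul ((hw.measurable.comp measurable_snd).mul
        ((measurable_truncKernel s ε).comp (measurable_fst.sub measurable_snd)))
    · simp only [Function.uncurry, hG, Real.norm_eq_abs, abs_mul,
        abs_of_nonneg (truncKernel_nonneg _ _ _)]
      rcases le_or_gt ‖p.1‖ R with h | h
      · calc |φ p.1| * (|w p.2| * truncKernel s ε (p.1 - p.2))
            ≤ |φ p.1| * (|w p.2| * (M * (1 + ‖p.2‖ ^ ((N : ℝ) + 2 * s))⁻¹)) := by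
              gcongr; exact hK _ _ h
          _ = _ := by rw [div_eq_mul_inv]; ring
      · rw [hR _ h]; simp
  have hφw : Integrable fun x => φ x * w x :=
    (hφ.mul hw).integrable_of_hasCompactSupport hφc.mul_right
  have e1 : (fun x => φ x * truncOperator s ε w x) = fun x => κ * (φ x * w x) - ∫ y, G x y := by
    ext x
    rw [truncOperator_eq_sub hwm hs hε hw, ← hκ, hG]
    simp only []
    rw [integral_const_mul]; ring
  have e2 : (fun x => w x * truncOperator s ε φ x) = fun x => κ * (φ x * w x) - ∫ y, G y x := by
    ext x
    rw [truncOperator_eq_sub hφm hs hε hφ, ← hκ, hG]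
    simp only []
    have : ∀ y, φ y * (w x * truncKernel s ε (y - x)) = w x * (φ y * truncKernel s ε (x - y)) := by
      intro y
      rw [← truncKernel_neg s ε (y - x), neg_sub]; ring
    simp_rw [this]
    rw [integral_const_mul]; ring
  have i1 : Integrable fun x => ∫ y, G x y := hGi.integral_prod_left
  have i2 : Integrable fun x => ∫ y, G y x := hGi.integral_prod_right
  rw [e1, e2]
  refine ⟨(hφw.const_mul κ).sub i1, (hφw.const_mul κ).sub i2, ?_⟩
  rw [integral_sub (hφw.const_mul κ) i1, integral_sub (hφw.const_mul κ) i2,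
    integral_integral_swap hGi]

theorem integral_mul_discreteLaplacian_comm {N : ℕ} {φ w : EuclideanSpace ℝ (Fin N) → ℝ}
    (hφ : Continuous φ) (hφc : HasCompactSupport φ) (hw : Continuous w) (h : ℝ) :
    Integrable (fun x => φ x * discreteLaplacian w h x) ∧
    Integrable (fun x => w x * discreteLaplacian φ h x) ∧
    ∫ x, φ x * discreteLaplacian w h x = ∫ x, w x * discreteLaplacian φ h x := by
  have hsh : ∀ z : EuclideanSpace ℝ (Fin N), Integrable (fun x => φ x * w (x + z)) := fun z =>
    (hφ.mul (hw.comp (continuous_id.add continuous_const))).integrable_of_hasCompactSupport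
      hφc.mul_right
  have hsh' : ∀ z : EuclideanSpace ℝ (Fin N), Integrable (fun x => w x * φ (x + z)) := fun z => by
    have := (hsh (-z)).comp_add_right z
    refine this.congr (Eventually.of_forall fun x => ?_)
    simp [mul_comm]
  have heq : ∀ z : EuclideanSpace ℝ (Fin N), ∫ x, w x * φ (x + z) = ∫ x, φ x * w (x + -z) := by
    intro z
    rw [← integral_add_right_eq_self (fun x => φ x * w (x + -z)) z]
    congr 1; ext x; simp [mul_comm]
  have h0 : Integrable (fun x => φ x * w x) := by simpa using hsh 0
  have h0' : Integrable (fun x => w x * φ x) := by simpa using hsh' 0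
  have ex1 : ∀ z, (fun x => φ x * (secondDiff w x z / h ^ 2)) = fun x =>
      (1 / h ^ 2) * ((φ x * w (x + z) + φ x * w (x + -z)) - 2 * (φ x * w x)) := fun z => by
    ext x; unfold secondDiff; rw [sub_eq_add_neg x z]; ring
  have ex2 : ∀ z, (fun x => w x * (secondDiff φ x z / h ^ 2)) = fun x =>
      (1 / h ^ 2) * ((w x * φ (x + z) + w x * φ (x + -z)) - 2 * (w x * φ x)) := fun z => by
    ext x; unfold secondDiff; rw [sub_eq_add_neg x z]; ring
  have a1 : ∀ z, Integrable fun x => φ x * w (x + z) + φ x * w (x + -z) := fun z =>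
    (hsh z).add (hsh (-z))
  have a2 : ∀ z, Integrable fun x => w x * φ (x + z) + w x * φ (x + -z) := fun z =>
    (hsh' z).add (hsh' (-z))
  have i1 : ∀ z, Integrable fun x => φ x * (secondDiff w x z / h ^ 2) := fun z => by
    rw [ex1]; exact ((a1 z).sub (h0.const_mul 2)).const_mul _
  have i2 : ∀ z, Integrable fun x => w x * (secondDiff φ x z / h ^ 2) := fun z => by
    rw [ex2]; exact ((a2 z).sub (h0'.const_mul 2)).const_mul _
  have e : ∀ z, ∫ x, φ x * (secondDiff w x z / h ^ 2) = ∫ x, w x * (secondDiff φ x z / h ^ 2) := by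
    intro z
    rw [ex1, ex2, integral_const_mul, integral_const_mul,
      integral_sub (a1 z) (h0.const_mul 2), integral_sub (a2 z) (h0'.const_mul 2),
      integral_add (hsh _) (hsh _), integral_add (hsh' _) (hsh' _), heq, heq, neg_neg]
    simp only [mul_comm (w _)]
    ring
  unfold discreteLaplacian
  simp only [Finset.mul_sum]
  refine ⟨integrable_finsetSum _ fun i _ => i1 _, integrable_finsetSum _ fun i _ => i2 _, ?_⟩
  rw [integral_finsetSum _ fun i _ => i1 _, integral_finsetSum _ fun i _ => i2 _]
  exact Finset.sum_congr rfl fun i _ => e _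

/-! ### Convexity of `|a|^p` and its consequences for difference operators. -/

/-- A subgradient of `a ↦ |a|^p`. -/
noncomputable def powSubgradient (p a : ℝ) : ℝ := p * |a| ^ (p - 1) * SignType.sign a

theorem measurable_powSubgradient (p : ℝ) : Measurable (powSubgradient p) := by
  have h : powSubgradient p = fun a => p * |a| ^ (p - 1) *
      (if 0 < a then 1 else if a < 0 then -1 else 0) := by
    ext a
    unfold powSubgradient
    rcases lt_trichotomy a 0 with ha | rfl | ha
    · simp [ha, not_lt.2 ha.le]
    · simp
    · simp [ha]
  rw [h]
  refine (measurable_const.mul (measurable_id.abs.pow_const _)).mul ?_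
  exact Measurable.ite measurableSet_Ioi measurable_const
    (Measurable.ite measurableSet_Iio measurable_const measurable_const)

theorem powSubgradient_mul_self {p : ℝ} (hp : 1 ≤ p) (a : ℝ) :
    powSubgradient p a * a = p * |a| ^ p := by
  unfold powSubgradient
  rcases eq_or_ne a 0 with rfl | ha
  · simp [Real.zero_rpow (by linarith : p ≠ 0)]
  · have h0 : 0 < |a| := abs_pos.2 ha
    have : |a| ^ p = |a| ^ (p - 1) * |a| := by
      rw [← Real.rpow_add_one h0.ne']; congr 1; ring
    rw [mul_assoc, sign_mul_self, this]; ring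

theorem powSubgradient_abs_le {p : ℝ} (hp : 1 ≤ p) {a U : ℝ} (ha : |a| ≤ U) :
    |powSubgradient p a| ≤ p * U ^ (p - 1) := by
  unfold powSubgradient
  have h1 : |((SignType.sign a : SignType) : ℝ)| ≤ 1 := by
    rcases lt_trichotomy a 0 with ha | rfl | ha
    · simp [ha]
    · simp
    · simp [ha]
  rw [abs_mul, abs_mul, abs_of_nonneg (by linarith : 0 ≤ p),
    abs_of_nonneg (show 0 ≤ |a| ^ (p - 1) by positivity)]
  have h2 : |a| ^ (p - 1) ≤ U ^ (p - 1) := Real.rpow_le_rpow (abs_nonneg a) ha (by linarith)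
  refine (mul_le_of_le_one_right (by positivity) h1).trans ?_
  gcongr

/-- The supporting-line inequality for `|a|^p`, from Bernoulli's inequality for the ratio `|b|/|a|`;
it covers every `p ≥ 1`, including `p = 1`. -/
theorem powSubgradient_mul_sub_le {p : ℝ} (hp : 1 ≤ p) (a b : ℝ) :
    powSubgradient p a * (b - a) ≤ |b| ^ p - |a| ^ p := by
  rw [mul_sub, powSubgradient_mul_self hp]
  rcases eq_or_ne a 0 with rfl | ha
  · have : 0 ≤ |b| ^ p := by positivity
    simpa [powSubgradient, Real.zero_rpow (by linarith : p ≠ 0)] using this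
  have h0 : 0 < |a| := abs_pos.2 ha
  have hsb : (SignType.sign a : ℝ) * b ≤ |b| := by
    rcases lt_or_gt_of_ne ha with h | h
    · simpa [h] using neg_le_abs b
    · simpa [h] using le_abs_self b
  have hB := one_add_mul_self_le_rpow_one_add (s := |b| / |a| - 1)
    (by have : 0 ≤ |b| / |a| := by positivity
        linarith) hp
  rw [add_sub_cancel, Real.div_rpow (abs_nonneg _) (abs_nonneg _)] at hB
  have e : |a| ^ p = |a| ^ (p - 1) * |a| := by
    rw [← Real.rpow_add_one h0.ne']; congr 1; ring
  have hap : 0 < |a| ^ p := by positivity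
  have hB2 : |a| ^ p * (1 + p * (|b| / |a| - 1)) ≤ |b| ^ p := by
    calc _ ≤ |a| ^ p * (|b| ^ p / |a| ^ p) := by gcongr
      _ = _ := by field_simp
  have e3 : |a| ^ p * (1 + p * (|b| / |a| - 1)) =
      |a| ^ p + p * |a| ^ (p - 1) * |b| - p * |a| ^ p := by
    rw [e]; field_simp; ring
  have h4 : powSubgradient p a * b ≤ p * |a| ^ (p - 1) * |b| := by
    unfold powSubgradient
    rw [mul_assoc]
    gcongr
  linarith

theorem powSubgradient_mul_discreteLaplacian_le {N : ℕ} {p : ℝ} (hp : 1 ≤ p)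
    (u : EuclideanSpace ℝ (Fin N) → ℝ) (h : ℝ) (x : EuclideanSpace ℝ (Fin N)) :
    powSubgradient p (u x) * discreteLaplacian u h x ≤
      discreteLaplacian (fun y => |u y| ^ p) h x := by
  unfold discreteLaplacian
  rw [Finset.mul_sum]
  refine Finset.sum_le_sum fun i _ => ?_
  set z := h • EuclideanSpace.basisFun (Fin N) ℝ i
  rw [← mul_div_assoc]
  refine div_le_div_of_nonneg_right ?_ (by positivity)
  have h1 := powSubgradient_mul_sub_le hp (u x) (u (x + z))
  have h2 := powSubgradient_mul_sub_le hp (u x) (u (x - z))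
  unfold secondDiff
  linarith

/-- The nonlocal Kato-type inequality: the supporting line at `u x` is integrated against the
nonnegative kernel. -/
theorem truncOperator_abs_rpow_le {N : ℕ} {s ε p : ℝ} (hp : 1 ≤ p) (hs : 0 < s) (hε : 0 < ε)
    {u : EuclideanSpace ℝ (Fin N) → ℝ} (hu : Continuous u) (hm : MemLs s u)
    (hmw : MemLs s fun x => |u x| ^ p) (x : EuclideanSpace ℝ (Fin N)) :
    truncOperator s ε (fun y => |u y| ^ p) x ≤ powSubgradient p (u x) * truncOperator s ε u x := by
  have hw : Continuous fun y => |u y| ^ p := hu.abs.rpow_const fun _ => Or.inr (by linarith)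
  unfold truncOperator
  rw [← integral_const_mul]
  refine integral_mono (integrable_truncOperator_integrand hmw hs hε hw x)
    ((integrable_truncOperator_integrand hm hs hε hu x).const_mul _) fun y => ?_
  have h1 := powSubgradient_mul_sub_le hp (u x) (u y)
  have h2 := truncKernel_nonneg s ε (x - y)
  simp only
  rw [← mul_assoc]
  gcongr
  linarith

theorem continuous_discreteLaplacian {N : ℕ} {u : EuclideanSpace ℝ (Fin N) → ℝ} (hu : Continuous u)
    (h : ℝ) : Continuous (discreteLaplacian u h) := by
  unfold discreteLaplacian secondDiff
  fun_prop

theorem norm_smul_basisFun {N : ℕ} {h : ℝ} (hh : 0 < h) (i : Fin N) :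
    ‖h • EuclideanSpace.basisFun (Fin N) ℝ i‖ = h := by
  rw [norm_smul, (EuclideanSpace.basisFun (Fin N) ℝ).norm_eq_one, mul_one, Real.norm_of_nonneg hh.le]

theorem abs_discreteLaplacian_le {N : ℕ} {f : EuclideanSpace ℝ (Fin N) → ℝ} {h B : ℝ} (hh : 0 < h)
    {x : EuclideanSpace ℝ (Fin N)}
    (hB : ∀ z : EuclideanSpace ℝ (Fin N), ‖z‖ = h → |secondDiff f x z| ≤ B * ‖z‖ ^ 2) :
    |discreteLaplacian f h x| ≤ N * B := by
  unfold discreteLaplacian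
  refine (Finset.abs_sum_le_sum_abs _ _).trans ?_
  have : ∀ i ∈ (Finset.univ : Finset (Fin N)),
      |secondDiff f x (h • EuclideanSpace.basisFun (Fin N) ℝ i) / h ^ 2| ≤ B := by
    intro i _
    have h1 := hB _ (norm_smul_basisFun hh i)
    rw [norm_smul_basisFun hh i] at h1
    rw [abs_div, abs_of_pos (show 0 < h ^ 2 by positivity), div_le_iff₀ (by positivity)]
    exact h1
  refine (Finset.sum_le_sum this).trans ?_
  simp

/-! ### Testing the equation and removing the truncation of the operators. -/

/-- The step sizes `1/(n+2)`. -/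
noncomputable def stepSize (n : ℕ) : ℝ := 1 / ((n : ℝ) + 2)

theorem stepSize_pos (n : ℕ) : 0 < stepSize n := by unfold stepSize; positivity

/-- The bound `1/2` places every step inside the near zone `‖z‖ ≤ ⟨x⟩/2`, for every `x`. -/
theorem stepSize_le (n : ℕ) : stepSize n ≤ 1 / 2 := by
  unfold stepSize
  exact one_div_le_one_div_of_le (by norm_num) (by linarith [(by positivity : (0 : ℝ) ≤ n)])

theorem tendsto_stepSize : Tendsto stepSize atTop (𝓝[>] 0) := by
  refine tendsto_nhdsWithin_iff.2 ⟨?_, Eventually.of_forall stepSize_pos⟩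
  have h : Tendsto (fun n : ℕ => (n : ℝ) + 2) atTop atTop :=
    tendsto_atTop_add_const_right _ _ tendsto_natCast_atTop_atTop
  exact h.inv_tendsto_atTop.congr fun n => by simp [stepSize]

/-- The difference operators applied to a solution converge, tested against a compactly supported
function and the subgradient, and are bounded by the same operators acting on the test function. -/
theorem discrete_weak_inequality {N : ℕ} (hN : 1 ≤ N) {s p : ℝ} (hs : 0 < s) (hs1 : s < 1)
    (hp : 1 ≤ p) {ρ c u : EuclideanSpace ℝ (Fin N) → ℝ} (hu : IsClassicalSolution s ρ c u)
    (hmw : MemLs s fun x => |u x| ^ p) {φ : EuclideanSpace ℝ (Fin N) → ℝ} (hφ : Continuous φ)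
    (hφc : HasCompactSupport φ) (hφ0 : ∀ x, 0 ≤ φ x) :
    ∃ L : ℕ → ℝ, Tendsto L atTop (𝓝 (∫ x, φ x * (ρ x * c x * (p * |u x| ^ p)))) ∧
      ∀ n, L n ≤ ∫ x, |u x| ^ p * (discreteLaplacian φ (stepSize n) x -
        fracLaplacianConst N s * truncOperator s (stepSize n) φ x) := by
  have huc := hu.contDiff.continuous
  have hw : Continuous fun y => |u y| ^ p := huc.abs.rpow_const fun _ => Or.inr (by linarith)
  have hC := fracLaplacianConst_pos (N := N) hs hs1
  set C := fracLaplacianConst N s with hCdef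
  obtain ⟨R, hR0, hR⟩ : ∃ R, 0 ≤ R ∧ ∀ x, R < ‖x‖ → φ x = 0 := by
    obtain ⟨R, hR⟩ := hφc.isCompact.isBounded.subset_closedBall 0
    refine ⟨max R 0, le_max_right _ _, fun x hx => ?_⟩
    by_contra hne
    have := hR (subset_tsupport φ hne)
    rw [mem_closedBall_zero_iff] at this
    exact absurd (this.trans (le_max_left _ _)) (not_le.2 hx)
  obtain ⟨B, hB0, hB⟩ := exists_abs_secondDiff_le_of_contDiff hu.contDiff R
  obtain ⟨B', hB'⟩ := exists_abs_truncOperator_le hN hs hs1 hu.contDiff hu.memLs hR0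
  obtain ⟨U, hU⟩ := IsCompact.exists_bound_of_continuousOn (f := u)
    (isCompact_closedBall (0 : EuclideanSpace ℝ (Fin N)) R) huc.continuousOn
  -- The limit is taken with the operators acting on `u`, where `C²` regularity and the equation
  -- apply; convergence for `|u|^p` is never required.
  set F : ℕ → EuclideanSpace ℝ (Fin N) → ℝ := fun n x => φ x * (powSubgradient p (u x) *
    (discreteLaplacian u (stepSize n) x - C * truncOperator s (stepSize n) u x)) with hF
  have hFm : ∀ n, AEStronglyMeasurable (F n) volume := fun n => by
    refine Measurable.aestronglyMeasurable ?_
    exact hφ.measurable.mul (((measurable_powSubgradient p).comp huc.measurable).mul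
      ((continuous_discreteLaplacian huc _).measurable.sub
        ((measurable_truncOperator huc).measurable.const_mul _)))
  set b : EuclideanSpace ℝ (Fin N) → ℝ := fun x => φ x * ((p * U ^ (p - 1)) * (N * B + C * B')) with hb
  have hbi : Integrable b := (hφ.integrable_of_hasCompactSupport hφc).mul_const _
  have hFb : ∀ n x, ‖F n x‖ ≤ b x := by
    intro n x
    have hstep := stepSize_le n
    rcases le_or_gt ‖x‖ R with hx | hx
    · have hUx : |u x| ≤ U := hU x (by simpa using hx)
      have h1 := powSubgradient_abs_le hp hUx
      have h2 : |discreteLaplacian u (stepSize n) x| ≤ N * B :=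
        abs_discreteLaplacian_le (stepSize_pos n) fun z hz => hB x z hx (by linarith)
      have h3 := hB' _ (stepSize_pos n) (by linarith) x hx
      have h4 : |discreteLaplacian u (stepSize n) x - C * truncOperator s (stepSize n) u x| ≤
          N * B + C * B' := by
        refine (abs_sub _ _).trans (add_le_add h2 ?_)
        rw [abs_mul, abs_of_pos hC]
        gcongr
      rw [Real.norm_eq_abs, hF, hb]
      simp only []
      rw [abs_mul, abs_of_nonneg (hφ0 x), abs_mul]
      have := hφ0 x
      have := (abs_nonneg _).trans h1
      gcongr
    · simp [hF, hb, hR x hx]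
  have hFi : ∀ n, Integrable (F n) := fun n => hbi.mono' (hFm n) (Eventually.of_forall (hFb n))
  refine ⟨fun n => ∫ x, F n x, ?_, fun n => ?_⟩
  · refine tendsto_integral_of_dominated_convergence b hFm hbi
      (fun n => Eventually.of_forall (hFb n)) (Eventually.of_forall fun x => ?_)
    obtain ⟨ℓ, hℓ, heq⟩ := hu.equation x
    have h1 := (tendsto_discreteLaplacian hu.contDiff x).comp tendsto_stepSize
    have h2 := hℓ.comp tendsto_stepSize
    have h3 := ((h1.sub h2).const_mul (powSubgradient p (u x))).const_mul (φ x)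
    have e : φ x * (ρ x * c x * (p * |u x| ^ p)) = φ x * (powSubgradient p (u x) *
        ((Laplacian.laplacian u : EuclideanSpace ℝ (Fin N) → ℝ) x - ℓ)) := by
      rw [← powSubgradient_mul_self hp, sub_eq_zero.1 heq]; ring
    rw [e]
    refine h3.congr fun n => ?_
    simp only [Function.comp, hF]
    rw [fracLaplacianTrunc_eq]
  · obtain ⟨a1, a2, a3⟩ := integral_mul_truncOperator_comm hs (stepSize_pos n) hφ hφc hw hmw
    obtain ⟨d1, d2, d3⟩ := integral_mul_discreteLaplacian_comm hφ hφc hw (stepSize n)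
    -- Convexity passes from `u` to `|u|^p` at fixed step, after which the symmetry of both
    -- operators moves them onto `φ`.
    have hle : ∫ x, F n x ≤ ∫ x, (φ x * discreteLaplacian (fun y => |u y| ^ p) (stepSize n) x -
        C * (φ x * truncOperator s (stepSize n) (fun y => |u y| ^ p) x)) := by
      refine integral_mono (hFi n) (d1.sub (a1.const_mul C)) fun x => ?_
      have t1 := powSubgradient_mul_discreteLaplacian_le hp u (stepSize n) x
      have t2 := truncOperator_abs_rpow_le hp hs (stepSize_pos n) huc hu.memLs hmw x
      simp only [hF]
      calc _ ≤ φ x * (discreteLaplacian (fun y => |u y| ^ p) (stepSize n) x -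
            C * truncOperator s (stepSize n) (fun y => |u y| ^ p) x) := by
            refine mul_le_mul_of_nonneg_left ?_ (hφ0 x)
            nlinarith
        _ = _ := by ring
    refine hle.trans (le_of_eq ?_)
    rw [integral_sub d1 (a1.const_mul C), integral_const_mul, a3, d3, ← integral_const_mul,
      ← integral_sub d2 (a2.const_mul C)]
    congr 1; ext x; ring

/-- The second-difference integral, equal to `-2 (-Δ)^s f / C_{N,s}` for smooth `f`. -/
noncomputable def diffIntegral {N : ℕ} (s : ℝ) (f : EuclideanSpace ℝ (Fin N) → ℝ)
    (x : EuclideanSpace ℝ (Fin N)) : ℝ :=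
  ∫ z, secondDiff f x z * ‖z‖ ^ (-((N : ℝ) + 2 * s))

theorem continuous_secondDiff {N : ℕ} {f : EuclideanSpace ℝ (Fin N) → ℝ} (hf : Continuous f)
    (x : EuclideanSpace ℝ (Fin N)) : Continuous fun z => secondDiff f x z := by
  unfold secondDiff
  fun_prop

theorem tendsto_integral_secondDiff_mul_truncKernel {N : ℕ} (hN : 1 ≤ N) {s : ℝ}
    {f H : EuclideanSpace ℝ (Fin N) → ℝ} (hf : Continuous f) {x : EuclideanSpace ℝ (Fin N)}
    (hH : Integrable H)
    (hfH : ∀ z, |secondDiff f x z * ‖z‖ ^ (-((N : ℝ) + 2 * s))| ≤ H z) :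
    Tendsto (fun n => ∫ z, secondDiff f x z * truncKernel s (stepSize n) z) atTop
      (𝓝 (diffIntegral s f x)) ∧
    ∀ n, |∫ z, secondDiff f x z * truncKernel s (stepSize n) z| ≤ ∫ z, H z := by
  have : Nonempty (Fin N) := ⟨⟨0, hN⟩⟩
  have hne : ∀ᵐ z : EuclideanSpace ℝ (Fin N), z ≠ 0 := Measure.ae_ne volume 0
  have hdom : ∀ n z, ‖secondDiff f x z * truncKernel s (stepSize n) z‖ ≤ H z := by
    intro n z
    unfold truncKernel
    by_cases hz : stepSize n ≤ ‖z‖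
    · rw [Set.indicator_of_mem (by simpa using hz)]; exact hfH z
    · rw [Set.indicator_of_notMem (by simpa using hz), mul_zero, norm_zero]
      exact (abs_nonneg _).trans (hfH z)
  refine ⟨?_, fun n => ?_⟩
  · refine tendsto_integral_of_dominated_convergence H (fun n => ?_) hH
      (fun n => Eventually.of_forall (hdom n)) ?_
    · exact ((continuous_secondDiff hf x).measurable.mul
        (measurable_truncKernel s _)).aestronglyMeasurable
    · filter_upwards [hne] with z hz
      have hz0 : 0 < ‖z‖ := norm_pos_iff.2 hz
      refine tendsto_const_nhds.congr' ?_
      have h0 : Tendsto stepSize atTop (𝓝 0) := tendsto_stepSize.mono_right nhdsWithin_le_nhds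
      filter_upwards [h0.eventually (Iio_mem_nhds hz0)] with n hn
      unfold truncKernel
      rw [Set.indicator_of_mem (by simpa using (le_of_lt hn))]
  · exact norm_integral_le_of_norm_le hH (Eventually.of_forall (hdom n))

/-- The integral inequality obtained by testing the equation with the truncated weight. -/
theorem weak_inequality_cutoff {N : ℕ} (hN : 1 ≤ N) {s p β γ A D R : ℝ} (hs : 0 < s) (hs1 : s < 1)
    (hp : 1 ≤ p) (hγ : 0 ≤ γ) (hR : 1 ≤ R) {ρ c u : EuclideanSpace ℝ (Fin N) → ℝ}
    (hu : IsClassicalSolution s ρ c u)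
    (hmw : MemLs s fun x => |u x| ^ p) (hwψ : MemWeightedLp p (weightPsi β) u)
    (hA : ∀ x z : EuclideanSpace ℝ (Fin N), ‖z‖ ≤ √(1 + ‖x‖ ^ 2) / 2 →
        |secondDiff (cutoffWeight β R) x z| ≤ A * weightPsi (β + 2) x * ‖z‖ ^ 2)
    {H : EuclideanSpace ℝ (Fin N) → EuclideanSpace ℝ (Fin N) → ℝ} (hHi : ∀ x, Integrable (H x))
    (hHD : ∀ x, ∫ z, H x z ≤ D * weightPsi (β + γ) x)
    (hH : ∀ x z, |secondDiff (cutoffWeight β R) x z * ‖z‖ ^ (-((N : ℝ) + 2 * s))| ≤ H x z) :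
    Integrable (fun x => |u x| ^ p * (N * A * weightPsi (β + 2) x +
        fracLaplacianConst N s / 2 * diffIntegral s (cutoffWeight β R) x)) ∧
    ∫ x, cutoffWeight β R x * (ρ x * c x * (p * |u x| ^ p)) ≤
      ∫ x, |u x| ^ p * (N * A * weightPsi (β + 2) x +
        fracLaplacianConst N s / 2 * diffIntegral s (cutoffWeight β R) x) := by
  have huc := hu.contDiff.continuous
  have hw : Continuous fun y => |u y| ^ p := huc.abs.rpow_const fun _ => Or.inr (by linarith)
  have hw0 : ∀ x, 0 ≤ |u x| ^ p := fun x => by positivity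
  have hC := fracLaplacianConst_pos (N := N) hs hs1
  set C := fracLaplacianConst N s with hCdef
  set φ : EuclideanSpace ℝ (Fin N) → ℝ := cutoffWeight β R with hφdef
  have hφ : Continuous φ := continuous_cutoffWeight β R
  have hφc : HasCompactSupport φ := hasCompactSupport_cutoffWeight β hR
  have hφm : MemLs s φ := MemLs.of_hasCompactSupport hφ hφc
  have hwψ' : Integrable fun x => |u x| ^ p * weightPsi β x := hwψ
  obtain ⟨L, hL, hLn⟩ := discrete_weak_inequality hN hs hs1 hp hu hmw hφ hφc (cutoffWeight_nonneg β R)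
  set Q : ℕ → EuclideanSpace ℝ (Fin N) → ℝ := fun n x =>
    ∫ z, secondDiff φ x z * truncKernel s (stepSize n) z with hQ
  have hQT : ∀ n x, truncOperator s (stepSize n) φ x = -(1 / 2) * Q n x := fun n x =>
    (integrable_secondDiff_mul_truncKernel hφm hs (stepSize_pos n) hφ x).2
  have hQlim : ∀ x, Tendsto (fun n => Q n x) atTop (𝓝 (diffIntegral s φ x)) := fun x =>
    (tendsto_integral_secondDiff_mul_truncKernel hN hφ (hHi x) (hH x)).1
  have hQb : ∀ n x, |Q n x| ≤ D * weightPsi (β + γ) x := fun n x =>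
    ((tendsto_integral_secondDiff_mul_truncKernel hN hφ (hHi x) (hH x)).2 n).trans (hHD x)
  have hQm : ∀ n, Measurable (Q n) := fun n => by
    have : Q n = fun x => -2 * truncOperator s (stepSize n) φ x := by
      ext x; rw [hQT]; ring
    rw [this]
    exact (measurable_truncOperator hφ).measurable.const_mul _
  -- Evaluate the bound at `x = 0` with a vector of length `1/2`, the edge of the near zone there.
  have hA0 : 0 ≤ A := by
    have h1 := (abs_nonneg _).trans (hA 0 ((1 / 2 : ℝ) • EuclideanSpace.basisFun (Fin N) ℝ ⟨0, hN⟩)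
      (by rw [norm_smul_basisFun (by norm_num)]; simp))
    rw [norm_smul_basisFun (by norm_num)] at h1
    have h2 := weightPsi_pos (β + 2) (0 : EuclideanSpace ℝ (Fin N))
    by_contra hcon
    push Not at hcon
    nlinarith [mul_neg_of_neg_of_pos hcon h2]
  have hD0 : 0 ≤ D := by
    have h1 := (abs_nonneg _).trans (hQb 0 0)
    exact nonneg_of_mul_nonneg_left h1 (weightPsi_pos _ _)
  set G : ℕ → EuclideanSpace ℝ (Fin N) → ℝ := fun n x =>
    |u x| ^ p * (N * A * weightPsi (β + 2) x + C / 2 * Q n x) with hG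
  set g : EuclideanSpace ℝ (Fin N) → ℝ := fun x =>
    |u x| ^ p * (N * A * weightPsi (β + 2) x + C / 2 * diffIntegral s φ x) with hg
  -- Since `γ ≥ 0`, the weights `ψ_{β+2}` and `ψ_{β+γ}` are at most `ψ_β`, so the weighted `L^p`
  -- hypothesis supplies the dominating function.
  set b : EuclideanSpace ℝ (Fin N) → ℝ := fun x => (N * A + C / 2 * D) * (|u x| ^ p * weightPsi β x)
    with hb
  have hbi : Integrable b := hwψ'.const_mul _
  have hGm : ∀ n, AEStronglyMeasurable (G n) volume := fun n => by
    refine Measurable.aestronglyMeasurable ?_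
    exact hw.measurable.mul (((continuous_weightPsi _).measurable.const_mul _).add
      ((hQm n).const_mul _))
  have hGb : ∀ n x, ‖G n x‖ ≤ b x := by
    intro n x
    have h1 := hQb n x
    have h2 : weightPsi (β + γ) x ≤ weightPsi β x := weightPsi_anti (by linarith) x
    have h3 : weightPsi (β + 2) x ≤ weightPsi β x := weightPsi_anti (by linarith) x
    have h4 := weightPsi_pos (β + 2) x
    rw [Real.norm_eq_abs, hG, hb]
    simp only []
    rw [abs_mul, abs_of_nonneg (hw0 x)]
    have h5 : |N * A * weightPsi (β + 2) x + C / 2 * Q n x| ≤ (N * A + C / 2 * D) * weightPsi β x := by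
      refine (abs_add_le _ _).trans ?_
      rw [abs_of_nonneg (by positivity), abs_mul, abs_of_pos (by positivity : 0 < C / 2), add_mul,
        mul_assoc (C / 2)]
      gcongr
      exact h1.trans (by gcongr)
    calc _ ≤ |u x| ^ p * ((N * A + C / 2 * D) * weightPsi β x) := by gcongr
      _ = _ := by ring
  have hGi : ∀ n, Integrable (G n) := fun n => hbi.mono' (hGm n) (Eventually.of_forall (hGb n))
  have hptlim : ∀ x, Tendsto (fun n => G n x) atTop (𝓝 (g x)) := fun x =>
    (((hQlim x).const_mul (C / 2)).const_add _).const_mul _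
  have hGlim : Tendsto (fun n => ∫ x, G n x) atTop (𝓝 (∫ x, g x)) :=
    tendsto_integral_of_dominated_convergence b hGm hbi
      (fun n => Eventually.of_forall (hGb n)) (Eventually.of_forall hptlim)
  have hgi : Integrable g := by
    refine hbi.mono' (aestronglyMeasurable_of_tendsto_ae atTop hGm (Eventually.of_forall hptlim))
      (Eventually.of_forall fun x => ?_)
    exact le_of_tendsto (hptlim x).norm (Eventually.of_forall fun n => hGb n x)
  refine ⟨hgi, le_of_tendsto_of_tendsto' hL hGlim fun n => (hLn n).trans ?_⟩
  obtain ⟨a1, a2, a3⟩ := integral_mul_truncOperator_comm hs (stepSize_pos n) hφ hφc hw hmw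
  obtain ⟨d1, d2, d3⟩ := integral_mul_discreteLaplacian_comm hφ hφc hw (stepSize n)
  have hi : Integrable fun x => |u x| ^ p * (discreteLaplacian φ (stepSize n) x -
      C * truncOperator s (stepSize n) φ x) := by
    refine (d2.sub (a2.const_mul C)).congr (Eventually.of_forall fun x => ?_)
    simp only [Pi.sub_apply]; ring
  refine integral_mono hi (hGi n) fun x => ?_
  simp only [hG]
  refine mul_le_mul_of_nonneg_left ?_ (hw0 x)
  rw [hQT]
  have h1 : |discreteLaplacian φ (stepSize n) x| ≤ N * (A * weightPsi (β + 2) x) :=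
    abs_discreteLaplacian_le (stepSize_pos n) fun z hz => hA x z (by
      have := stepSize_le n
      have := one_le_bracket x
      linarith)
  have h2 := (le_abs_self _).trans h1
  linarith

theorem tendsto_diffIntegral_cutoffWeight {N : ℕ} {s β : ℝ}
    {x : EuclideanSpace ℝ (Fin N)} {H : EuclideanSpace ℝ (Fin N) → ℝ} (hH : Integrable H)
    (hdom : ∀ R, 1 ≤ R → ∀ z,
      |secondDiff (cutoffWeight β R) x z * ‖z‖ ^ (-((N : ℝ) + 2 * s))| ≤ H z) :
    Tendsto (fun n : ℕ => diffIntegral s (cutoffWeight β ((n : ℝ) + 1)) x) atTop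
      (𝓝 (diffIntegral s (weightPsi β) x)) := by
  refine tendsto_integral_of_dominated_convergence H (fun n => ?_) hH
    (fun n => Eventually.of_forall fun z => hdom _ ?_ z) (Eventually.of_forall fun z => ?_)
  · exact ((continuous_secondDiff (continuous_cutoffWeight β _) x).measurable.mul
      (measurable_norm.pow_const _)).aestronglyMeasurable
  · linarith [(by positivity : (0 : ℝ) ≤ n)]
  · exact (tendsto_secondDiff_cutoffWeight β x z).mul_const _

/-! ### Choice of the decay exponent and conclusion. -/

/-- In case (i) the value `γ = 2s` serves only for domination, the decisive bound being the sign. At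
`β = N` one takes `γ = α`, strictly below `2s`; for `β > N` the largest available value is `N + 2s -
β`. -/
theorem exists_admissibleDecay {N : ℕ} (hN : 1 ≤ N) {s α β : ℝ} (hs0 : 0 < s) (hs1 : s < 1)
    (hα : 0 ≤ α)
    (hcases :
      (0 < β ∧ β ≤ (N : ℝ) - 2 * s ∧ α ≤ 2) ∨
      ((N : ℝ) - 2 * s < β ∧ β < (N : ℝ) ∧ α ≤ 2 * s) ∨
      (β = (N : ℝ) ∧ α < 2 * s) ∨
      ((N : ℝ) < β ∧ α + β ≤ 2 * s + (N : ℝ))) :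
    ∃ γ, 0 ≤ γ ∧ AdmissibleDecay N s β γ ∧ α ≤ 2 ∧
      ((∀ x : EuclideanSpace ℝ (Fin N), diffIntegral s (weightPsi β) x ≤ 0) ∨ α ≤ γ) := by
  rcases hcases with ⟨h1, h2, h3⟩ | ⟨h1, h2, h3⟩ | ⟨h1, h2⟩ | ⟨h1, h2⟩
  · exact ⟨2 * s, by linarith, Or.inl ⟨by linarith, by linarith, rfl⟩, h3,
      Or.inl fun x => integral_secondDiff_weightPsi_nonpos hN hs0 hs1 h1 h2 x⟩
  · have hN1 : (1 : ℝ) ≤ N := by exact_mod_cast hN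
    exact ⟨2 * s, by linarith, Or.inl ⟨by linarith, h2, rfl⟩, by linarith, Or.inr h3⟩
  · exact ⟨α, hα, Or.inr (Or.inl ⟨h1, h2⟩), by linarith, Or.inr le_rfl⟩
  · exact ⟨N + 2 * s - β, by linarith, Or.inr (Or.inr ⟨h1, by ring⟩), by linarith,
      Or.inr (by linarith)⟩

theorem theorem2p5 (N : ℕ) (hN : 1 ≤ N) (s : ℝ) (hs0 : 0 < s) (hs1 : s < 1)
    (α β C₀ : ℝ) (hα : 0 ≤ α) (hC₀ : 0 < C₀)
    (hcases :
      (0 < β ∧ β ≤ (N : ℝ) - 2 * s ∧ α ≤ 2) ∨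
      ((N : ℝ) - 2 * s < β ∧ β < (N : ℝ) ∧ α ≤ 2 * s) ∨
      (β = (N : ℝ) ∧ α < 2 * s) ∨
      ((N : ℝ) < β ∧ α + β ≤ 2 * s + (N : ℝ))) :
    ∃ K : ℝ, ∀ (ρ c : EuclideanSpace ℝ (Fin N) → ℝ), Continuous ρ →
      (∀ x, C₀ * (1 + ‖x‖ ^ 2) ^ (-α / 2) ≤ ρ x) →
      Continuous c →
      ∀ c₀ : ℝ, 0 < c₀ → (∀ x, c₀ ≤ c x) →
      ∀ p : ℝ, 1 ≤ p → K ≤ p * c₀ →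
      ∀ u : EuclideanSpace ℝ (Fin N) → ℝ, IsClassicalSolution s ρ c u →
        MemLs s (fun x => |u x| ^ p) →
        MemWeightedLp p (weightPsi β) u →
        ∀ x, u x = 0 := by
  obtain ⟨γ, hγ0, hadm, hα2, hsign⟩ := exists_admissibleDecay hN hs0 hs1 hα hcases
  obtain ⟨A, hA0, hA, hmajR, hmaj⟩ := exists_abs_secondDiff_cutoffWeight_mul_le N s β
  obtain ⟨D, hD⟩ := exists_integral_diffMajorant_le hN hs0 hs1 hadm A hA0.le
  have hCN := fracLaplacianConst_pos (N := N) hs0 hs1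
  set CN := fracLaplacianConst N s with hCNdef
  have hD0 : 0 ≤ D := by
    have h1 : 0 ≤ ∫ z, diffMajorant s β A (0 : EuclideanSpace ℝ (Fin N)) z :=
      integral_nonneg fun z => diffMajorant_nonneg hA0.le _ _
    exact nonneg_of_mul_nonneg_left (h1.trans (hD 0).2) (weightPsi_pos _ _)
  -- The sign is known for `ψ_β` but not for its truncations, so this one-sided bound enters only
  -- after `R → ∞`.
  have hψ : ∀ x : EuclideanSpace ℝ (Fin N),
      diffIntegral s (weightPsi β) x ≤ D * weightPsi (β + α) x := by
    intro x
    have h0 := weightPsi_pos (β + α) x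
    rcases hsign with h | h
    · exact (h x).trans (by positivity)
    · have h1 : ‖diffIntegral s (weightPsi β) x‖ ≤ ∫ z, diffMajorant s β A x z :=
        norm_integral_le_of_norm_le (hD x).1 (Eventually.of_forall (hmaj x))
      refine (le_abs_self _).trans (h1.trans ((hD x).2.trans ?_))
      gcongr
      exact weightPsi_anti (by linarith) x
  set A' := N * A + CN / 2 * D with hA'
  -- `A'` is fixed before `ρ`, `c`, `p` and `u` appear. The extra `1` turns the final `κ I ≤ A' I`
  -- into `I ≤ 0`.
  refine ⟨(A' + 1) / C₀, ?_⟩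
  intro ρ c hρ hρ0 hc c₀ hc₀ hcc p hp hK u hu hmw hwψ
  have huc := hu.contDiff.continuous
  have hw : Continuous fun y => |u y| ^ p := huc.abs.rpow_const fun _ => Or.inr (by linarith)
  have hw0 : ∀ x, 0 ≤ |u x| ^ p := fun x => by positivity
  have hwψ' : Integrable fun x => |u x| ^ p * weightPsi β x := hwψ
  have hR : ∀ n : ℕ, (1 : ℝ) ≤ (n : ℝ) + 1 := fun n => by
    linarith [(by positivity : (0 : ℝ) ≤ n)]
  have hweak := fun n : ℕ => weak_inequality_cutoff hN hs0 hs1 hp hγ0 (hR n) hu hmw hwψ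
    (hA _ (hR n)) (fun x => (hD x).1) (fun x => (hD x).2) (hmajR _ (hR n))
  set κ := p * c₀ * C₀ with hκ
  have hκA : A' + 1 ≤ κ := by
    rw [hκ]
    exact (div_le_iff₀ hC₀).1 hK
  have hκ0 : 0 ≤ κ := by rw [hκ]; positivity
  have hIi : Integrable fun x => |u x| ^ p * weightPsi (β + α) x := by
    refine hwψ'.mono' (hw.mul (continuous_weightPsi _)).aestronglyMeasurable
      (Eventually.of_forall fun x => ?_)
    have h1 := weightPsi_pos (β + α) x
    rw [Real.norm_of_nonneg (by positivity)]
    gcongr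
    exact weightPsi_anti (by linarith) x
  -- The left side is reduced to `w ψ_α` before `R → ∞`, because `ρ c w ψ_β` is not known to be
  -- integrable: `ρ` and `c` have no upper bounds.
  have hlow : ∀ n : ℕ, ∫ x, κ * (cutoffWeight β ((n : ℝ) + 1) x * (weightPsi α x * |u x| ^ p)) ≤
      ∫ x, cutoffWeight β ((n : ℝ) + 1) x * (ρ x * c x * (p * |u x| ^ p)) := by
    intro n
    have hφ := continuous_cutoffWeight (N := N) β ((n : ℝ) + 1)
    have hφc := hasCompactSupport_cutoffWeight (N := N) β (hR n)
    refine integral_mono ?_ ?_ fun x => ?_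
    · exact ((hφ.mul ((continuous_weightPsi α).mul hw)).integrable_of_hasCompactSupport
        hφc.mul_right).const_mul κ
    · exact (hφ.mul ((hρ.mul hc).mul (continuous_const.mul hw))).integrable_of_hasCompactSupport
        hφc.mul_right
    · have h1 : C₀ * weightPsi α x ≤ ρ x := hρ0 x
      have h2 := weightPsi_pos α x
      have h3 : C₀ * weightPsi α x * c₀ ≤ ρ x * c x := by
        have := hcc x
        have h4 : 0 ≤ ρ x := le_trans (by positivity) h1
        gcongr
      calc κ * (cutoffWeight β ((n : ℝ) + 1) x * (weightPsi α x * |u x| ^ p))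
          = cutoffWeight β ((n : ℝ) + 1) x * (C₀ * weightPsi α x * c₀ * (p * |u x| ^ p)) := by
            rw [hκ]; ring
        _ ≤ _ := by
            have := cutoffWeight_nonneg β ((n : ℝ) + 1) x
            gcongr
  have hlimL : Tendsto (fun n : ℕ =>
      ∫ x, κ * (cutoffWeight β ((n : ℝ) + 1) x * (weightPsi α x * |u x| ^ p))) atTop
      (𝓝 (∫ x, κ * (|u x| ^ p * weightPsi (β + α) x))) := by
    refine tendsto_integral_of_dominated_convergence
      (fun x => κ * (|u x| ^ p * weightPsi (β + α) x)) (fun n => ?_) (hIi.const_mul κ)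
      (fun n => Eventually.of_forall fun x => ?_) (Eventually.of_forall fun x => ?_)
    · exact (continuous_const.mul ((continuous_cutoffWeight β _).mul
        ((continuous_weightPsi α).mul hw))).aestronglyMeasurable
    · have h1 := cutoffWeight_nonneg β ((n : ℝ) + 1) x
      have h2 := (weightPsi_pos α x).le
      have h3 := cutoffWeight_le β (hR n) x
      rw [Real.norm_of_nonneg (by positivity), weightPsi_add]
      calc _ ≤ κ * (weightPsi β x * (weightPsi α x * |u x| ^ p)) := by gcongr
        _ = _ := by ring
    · have h := ((tendsto_cutoffWeight β x).mul_const (weightPsi α x * |u x| ^ p)).const_mul κ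
      convert! h using 2
      rw [weightPsi_add]; ring
  have hQb : ∀ (n : ℕ) (x : EuclideanSpace ℝ (Fin N)),
      |diffIntegral s (cutoffWeight β ((n : ℝ) + 1)) x| ≤ D * weightPsi (β + γ) x := by
    intro n x
    have h1 : ‖diffIntegral s (cutoffWeight β ((n : ℝ) + 1)) x‖ ≤ ∫ z, diffMajorant s β A x z :=
      norm_integral_le_of_norm_le (hD x).1 (Eventually.of_forall (hmajR _ (hR n) x))
    exact h1.trans (hD x).2
  set g : EuclideanSpace ℝ (Fin N) → ℝ := fun x => |u x| ^ p * (N * A * weightPsi (β + 2) x +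
    CN / 2 * diffIntegral s (weightPsi β) x) with hg
  set G : ℕ → EuclideanSpace ℝ (Fin N) → ℝ := fun n x => |u x| ^ p * (N * A * weightPsi (β + 2) x +
    CN / 2 * diffIntegral s (cutoffWeight β ((n : ℝ) + 1)) x) with hG
  have hbi : Integrable fun x => A' * (|u x| ^ p * weightPsi β x) := hwψ'.const_mul _
  have hGb : ∀ n x, ‖G n x‖ ≤ A' * (|u x| ^ p * weightPsi β x) := by
    intro n x
    have h1 := hQb n x
    have h2 : weightPsi (β + γ) x ≤ weightPsi β x := weightPsi_anti (by linarith) x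
    have h3 : weightPsi (β + 2) x ≤ weightPsi β x := weightPsi_anti (by linarith) x
    have h4 := weightPsi_pos (β + 2) x
    rw [Real.norm_eq_abs, hG]
    simp only []
    rw [abs_mul, abs_of_nonneg (hw0 x)]
    have h5 : |N * A * weightPsi (β + 2) x +
        CN / 2 * diffIntegral s (cutoffWeight β ((n : ℝ) + 1)) x| ≤ A' * weightPsi β x := by
      refine (abs_add_le _ _).trans ?_
      rw [abs_of_nonneg (by positivity), abs_mul, abs_of_pos (by positivity : 0 < CN / 2), hA', add_mul,
        mul_assoc (CN / 2)]
      gcongr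
      exact h1.trans (by gcongr)
    calc _ ≤ |u x| ^ p * (A' * weightPsi β x) := by gcongr
      _ = _ := by ring
  have hptlim : ∀ x, Tendsto (fun n => G n x) atTop (𝓝 (g x)) := fun x =>
    (((tendsto_diffIntegral_cutoffWeight (hD x).1 fun R hR z => hmajR R hR x z).const_mul
      (CN / 2)).const_add _).const_mul _
  have hGm : ∀ n, AEStronglyMeasurable (G n) volume := fun n => (hweak n).1.aestronglyMeasurable
  have hlimR : Tendsto (fun n => ∫ x, G n x) atTop (𝓝 (∫ x, g x)) :=
    tendsto_integral_of_dominated_convergence _ hGm hbi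
      (fun n => Eventually.of_forall (hGb n)) (Eventually.of_forall hptlim)
  have hgi : Integrable g := by
    refine hbi.mono' (aestronglyMeasurable_of_tendsto_ae atTop hGm (Eventually.of_forall hptlim))
      (Eventually.of_forall fun x => ?_)
    exact le_of_tendsto (hptlim x).norm (Eventually.of_forall fun n => hGb n x)
  have hfin : ∫ x, κ * (|u x| ^ p * weightPsi (β + α) x) ≤ ∫ x, g x :=
    le_of_tendsto_of_tendsto' hlimL hlimR fun n => (hlow n).trans (hweak n).2
  have hgle : ∫ x, g x ≤ ∫ x, A' * (|u x| ^ p * weightPsi (β + α) x) := by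
    refine integral_mono hgi (hIi.const_mul A') fun x => ?_
    simp only [hg]
    have h1 : weightPsi (β + 2) x ≤ weightPsi (β + α) x := weightPsi_anti (by linarith) x
    calc _ ≤ |u x| ^ p * (N * A * weightPsi (β + α) x + CN / 2 * (D * weightPsi (β + α) x)) := by
          gcongr
          exact hψ x
      _ = _ := by rw [hA']; ring
  rw [integral_const_mul] at hfin hgle
  set I := ∫ x, |u x| ^ p * weightPsi (β + α) x with hI
  have hpos : ∀ x, 0 ≤ |u x| ^ p * weightPsi (β + α) x := fun x =>
    mul_nonneg (hw0 x) (weightPsi_pos _ _).le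
  have hI0 : 0 ≤ I := integral_nonneg hpos
  have hIz : I = 0 := by nlinarith
  have hae := (integral_eq_zero_iff_of_nonneg hpos hIi).1 hIz
  have heq : (fun x => |u x| ^ p * weightPsi (β + α) x) = fun _ => (0 : ℝ) :=
    Continuous.ae_eq_iff_eq volume (hw.mul (continuous_weightPsi _)) continuous_const |>.1 hae
  intro x
  have hx := congrFun heq x
  have h1 := (mul_eq_zero.1 hx).resolve_right (weightPsi_pos _ _).ne'
  exact abs_eq_zero.1 ((Real.rpow_eq_zero (abs_nonneg _) (by linarith)).1 h1)
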